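/- **Setting.** Let $\{X_{t,T}:1\le t\le T\}_{T\in\mathbb N}$ be a triangular array of random elements of $L^2([0,1],\mathbb R)$ and, for each $u\in[0,1]$, let $\{X^{(u)}_t\}_{t\in\mathbb Z}$ be a strictly stationary $L^2([0,1],\mathbb R)$-valued process on the same probability space. All $X_{t,T}$ and $X^{(u)}_t$ have mean zero and $\mathbb E\|\cdot\|_2^k<\infty$ for every $k$. The array is locally stationary: there are $\rho>0$, $C<\infty$ and nonnegative random variables $P^{(u)}_{t,T}$ with $\mathbb E|P^{(u)}_{t,T}|^\rho\le C$ for all $u,t,T$ and $$\|X_{t,T}-X^{(u)}_t\|_2\le\Big(\Big|\frac tT-u\Big|+\frac1T\Big)P^{(u)}_{t,T}\quad\text{a.s.},\qquad 1\le t\le T,\ u\in[0,1].$$ Write $Y^{(T)}_t=X_{t,T}-X^{(t/T)}_t$ and $Y^{(u,v)}_t=(X^{(u)}_t-X^{(v)}_t)/(u-v)$ for $u\ne v$. For every $k\ge2$ there are nonnegative kernels $\kappa_{k;s_1,\dots,s_{k-1}}\in L^2([0,1]^k,\mathbb R)$, not depending on $T$, and an integer $\ell\ge1$, with $\sum_{s\in\mathbb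 Z^{k-1}}(1+|s_j|^\ell)\|\kappa_{k;s}\|_2<\infty$ for $j=1,\dots,k-1$, such that, with $\kappa=\kappa_{k;t_1-t_k,\dots,t_{k-1}-t_k}$ and $\mathrm{Cum}$ the joint cumulant kernel on $[0,1]^k$: 1. $\|\mathrm{Cum}(X_{t_1,T},\dots,X_{t_{k-1},T},Y^{(T)}_{t_k})\|_2\le\frac1T\|\kappa\|_2$ for $1\le t_i\le T$; 2. $\|\mathrm{Cum}(X^{(u_1)}_{t_1},\dots,X^{(u_{k-1})}_{t_{k-1}},Y^{(u_k,v)}_{t_k})\|_2\le\|\kappa\|_2$ for $u_1,\dots,u_k,v\in[0,1]$, $u_k\neq v$, and $t_i\in\mathbb Z$; 3. $\sup_{u\in[0,1]}\|\mathrm{Cum}(X^{(u)}_{t_1},\dots,X^{(u)}_{t_k})\|_2\le\|\kappa\|_2$ for $t_i\in\mathbb Z$; 4. $u\mapsto\mathrm{Cum}(X^{(u)}_{t_1},\dots,X^{(u)}_{t_k})\in L^2([0,1]^k)$ is differentiable on $[0,1]$ with derivative of norm at most $\|\kappa\|_2$, for $t_i\in\mathbb Z$. The time-varying spectral kernel and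 its demeaned version are the elements of $L^2([0,1]^2,\mathbb C)$ $$f_{u,\omega}(\tau,\sigma)=\sum_{h\in\mathbb Z}\mathbb E\big(X^{(u)}_{t+h}(\tau)X^{(u)}_t(\sigma)\big)e^{-\mathrm i2\pi\omega h},\qquad g_{u,\omega}=f_{u,\omega}-\int_0^1f_{v,\omega}\,dv .$$ **Estimator and statistic.** Let $T=B\,T_B$, with $B$ blocks of length $T_B$, $K$ tapers, and let $I_b$ be the indicator of $((b-1)/B,b/B]$. With $v_b^k(t)=\sqrt{\tfrac{2}{T_B+1}}\,\sin\frac{\pi k[t-(b-1)T_B]}{T_B+1}$ put $$\widetilde X_T^{(k),b,\omega}=\sum_{t=1}^Tv_b^k(t)I_b(t/T)X_{t,T}e^{-\mathrm i2\pi\omega t},\qquad \widehat f_{b/B,\omega}(\tau,\sigma)=\frac1K\sum_{k=1}^K\widetilde X_T^{(k),b,\omega}(\tau)\overline{\widetilde X_T^{(k),b,\omega}(\sigma)},$$ $$\widehat g_{b/B,\omega}=\widehat f_{b/B,\omega}-\frac1B\sum_{l=1}^B\widehat f_{l/B,\omega},\qquad Q^0(\omega_1,\omega_2)=\sum_{b=1}^B\int_{\omega_1}^{\omega_2}\int_0^1\int_0^1|\widehat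 g_{b/B,\omega}(\tau,\sigma)|^2\,d\tau\,d\sigma\,d\omega .$$ **Statement.** Let $0\le\omega_1<\omega_2\le\frac12$ and suppose that $g$ does not vanish almost everywhere on the band: the set of $(u,\omega)\in[0,1]\times[\omega_1,\omega_2]$ for which $g_{u,\omega}(\tau,\sigma)\ne0$ on a set of $(\tau,\sigma)$ of positive Lebesgue measure has itself positive Lebesgue measure. (In particular $g_{u,\omega}=g_u$ for all $\omega$ in the band, with $g_u(\tau,\sigma)\neq0$ on a set of $(u,\tau,\sigma)$ of positive measure, is allowed.) Let $T,B,K\to\infty$ along a sequence, $B$ dividing $T$, with $T/K^2\to\infty$ and $T/(BK)\to\infty$. Then $$\frac{K\,Q^0(\omega_1,\omega_2)}{B}\longrightarrow\infty\quad\text{in probability},$$ that is, $\mathbb P\big(KQ^0(\omega_1,\omega_2)/B>M\big)\to1$ for every real $M$. Consequently the stationarity test is consistent: for all (possibly random) critical values $c$ that are bounded above in probability along the sequence, the test that rejects when $KQ^0(\omega_1,\omega_2)/B>c$ has power tending to $1$, i.e. $\mathbb P\big(KQ^0(\omega_1,\omega_2)/B>c\big)\to1$. -/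

import Mathlib

open MeasureTheory ProbabilityTheory Filter Topology

noncomputable section

namespace FunctionalTimeSeries

/-! ### Random functions and kernels -/

/-- The class of `f` in `L²`; it is only used for square integrable `f`. -/
def toL2 {α E : Type*} [MeasureSpace α] [NormedAddCommGroup E] (f : α → E) :
    Lp E 2 (volume : Measure α) :=
  open Classical in if h : MemLp f 2 volume then h.toLp f else 0

/-- A random element of `L²([0,1], ℝ)`, given by a jointly measurable version. -/
structure RandomL2 (Ω : Type*) [MeasurableSpace Ω] where
  /-- the value at sample point `x` and argument `τ` -/
  val : Ω → unitInterval → ℝ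
  measurable_val : Measurable (Function.uncurry val)
  memLp_val : ∀ x, MemLp (val x) 2 volume

/-- The random element as a map into the Hilbert space `L²([0,1], ℝ)`. -/
def RandomL2.elem {Ω : Type*} [MeasurableSpace Ω] (X : RandomL2 Ω) (x : Ω) :
    Lp ℝ 2 (volume : Measure unitInterval) :=
  (X.memLp_val x).toLp (X.val x)

/-- The joint cumulant of `k` real random variables:
`∑_π (-1)^(|π|-1) (|π|-1)! ∏_{A ∈ π} E ∏_{i ∈ A} Z i`, over all partitions `π` of the indices. -/
def jointCumulant {Ω : Type*} [MeasurableSpace Ω] (μ : Measure Ω) {k : ℕ}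
    (Z : Fin k → Ω → ℝ) : ℝ :=
  ∑ π : Finpartition (Finset.univ : Finset (Fin k)),
    (-1 : ℝ) ^ (π.parts.card - 1) * ((π.parts.card - 1).factorial : ℝ) *
      ∏ A ∈ π.parts, ∫ x, ∏ i ∈ A, Z i x ∂μ

/-- The joint cumulant kernel `(τ₁, …, τ_k) ↦ Cum(Z₁(τ₁), …, Z_k(τ_k))` on `[0,1]^k`. -/
def cumKernel {Ω : Type*} [MeasurableSpace Ω] (μ : Measure Ω) {k : ℕ}
    (Z : Fin k → Ω → unitInterval → ℝ) : (Fin k → unitInterval) → ℝ :=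
  fun τ => jointCumulant μ (fun i x => Z i x (τ i))

/-! ### Local stationarity -/

/-- Strict stationarity: the joint laws in `L²([0,1], ℝ)` of finitely many values are invariant
under time shifts. -/
def StrictlyStationary {Ω : Type*} [MeasurableSpace Ω] (μ : Measure Ω)
    (Z : ℤ → RandomL2 Ω) : Prop :=
  letI : MeasurableSpace (Lp ℝ 2 (volume : Measure unitInterval)) := borel _
  ∀ (n : ℕ) (t : Fin n → ℤ) (h : ℤ),
    IdentDistrib (fun x (i : Fin n) => (Z (t i + h)).elem x)
      (fun x (i : Fin n) => (Z (t i)).elem x) μ μ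

/-- The array `X T t` (`1 ≤ t ≤ T`) is locally stationary with stationary approximations `S u`,
`u ∈ [0,1]`. -/
structure LocallyStationary {Ω : Type*} [MeasurableSpace Ω] (μ : Measure Ω)
    (X : ℕ → ℤ → RandomL2 Ω) (S : ℝ → ℤ → RandomL2 Ω) : Prop where
  stationary : ∀ u ∈ Set.Icc (0 : ℝ) 1, StrictlyStationary μ (S u)
  approx : ∃ (ρ : ℝ) (C : NNReal) (P : ℝ → ℕ → ℤ → Ω → ℝ), 0 < ρ ∧
    ∀ u ∈ Set.Icc (0 : ℝ) 1, ∀ (T : ℕ) (t : ℤ), 1 ≤ t → t ≤ T →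
      Measurable (P u T t) ∧ (∀ x, 0 ≤ P u T t x) ∧
      (∫⁻ x, ENNReal.ofReal (P u T t x ^ ρ) ∂μ) ≤ C ∧
      ∀ᵐ x ∂μ, ‖(X T t).elem x - (S u t).elem x‖
        ≤ (|(t : ℝ) / T - u| + 1 / T) * P u T t x

/-- The moment conditions that zero means and joint cumulants of all orders presuppose:
`Z` has norm moments of all orders, and mean zero. -/
def CenteredWithMoments {Ω : Type*} [MeasurableSpace Ω] (μ : Measure Ω)
    (Z : RandomL2 Ω) : Prop :=
  (∀ k : ℕ, Integrable (fun x => ‖Z.elem x‖ ^ k) μ) ∧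
    ∀ᵐ τ : unitInterval, ∫ x, Z.val x τ ∂μ = 0

/-- The lags `(t₁ - t_k, …, t_{k-1} - t_k)`, where `k = m + 1`. -/
def lags {m : ℕ} (t : Fin (m + 1) → ℤ) : Fin m → ℤ :=
  fun j => t j.castSucc - t (Fin.last m)

/-- The standing assumption on the array: it is locally stationary, centered, and its cumulants of
every order `k = m + 1 ≥ 2` are controlled by kernels `κ m (lags)` in `L²([0,1]^k, ℝ)` with
summable norms, independently of `T` and of rescaled time. -/
structure CumulantMixing {Ω : Type*} [MeasurableSpace Ω] (μ : Measure Ω)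
    (X : ℕ → ℤ → RandomL2 Ω) (S : ℝ → ℤ → RandomL2 Ω)
    (κ : (m : ℕ) → (Fin m → ℤ) → Lp ℝ 2 (volume : Measure (Fin (m + 1) → unitInterval))) :
    Prop where
  locallyStationary : LocallyStationary μ X S
  centered : ∀ (T : ℕ) (t : ℤ), 1 ≤ t → t ≤ T → CenteredWithMoments μ (X T t)
  centered_approx : ∀ u ∈ Set.Icc (0 : ℝ) 1, ∀ t : ℤ, CenteredWithMoments μ (S u t)
  nonneg : ∀ (m : ℕ) (s : Fin m → ℤ), 0 ≤ κ m s
  summable : ∀ m : ℕ, 1 ≤ m → ∃ ℓ : ℕ, 1 ≤ ℓ ∧ ∀ j : Fin m,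
    Summable (fun s : Fin m → ℤ => (1 + |(s j : ℝ)| ^ ℓ) * ‖κ m s‖)
  /-- `‖Cum(X_{t₁,T}, …, X_{t_{k-1},T}, X_{t_k,T} - X_{t_k}^{(t_k/T)})‖₂ ≤ ‖κ‖₂ / T` -/
  cum_array : ∀ m : ℕ, 1 ≤ m → ∀ (T : ℕ) (t : Fin (m + 1) → ℤ), (∀ i, 1 ≤ t i ∧ t i ≤ T) →
    eLpNorm (cumKernel μ (Fin.snoc (α := fun _ => Ω → unitInterval → ℝ)
        (fun j : Fin m => (X T (t j.castSucc)).val)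
        (fun x τ => (X T (t (Fin.last m))).val x τ
          - (S ((t (Fin.last m) : ℝ) / T) (t (Fin.last m))).val x τ))) 2 volume
      ≤ ENNReal.ofReal (1 / T * ‖κ m (lags t)‖)
  /-- `‖Cum(X_{t₁}^{(u₁)}, …, (X_{t_k}^{(u_k)} - X_{t_k}^{(v)}) / (u_k - v))‖₂ ≤ ‖κ‖₂` -/
  cum_quotient : ∀ m : ℕ, 1 ≤ m → ∀ (t : Fin (m + 1) → ℤ) (u : Fin (m + 1) → ℝ) (v : ℝ),
    (∀ i, u i ∈ Set.Icc (0 : ℝ) 1) → v ∈ Set.Icc (0 : ℝ) 1 → u (Fin.last m) ≠ v →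
    eLpNorm (cumKernel μ (Fin.snoc (α := fun _ => Ω → unitInterval → ℝ)
        (fun j : Fin m => (S (u j.castSucc) (t j.castSucc)).val)
        (fun x τ => ((S (u (Fin.last m)) (t (Fin.last m))).val x τ
          - (S v (t (Fin.last m))).val x τ) / (u (Fin.last m) - v)))) 2 volume
      ≤ ENNReal.ofReal ‖κ m (lags t)‖
  cum_stationary : ∀ m : ℕ, 1 ≤ m → ∀ (t : Fin (m + 1) → ℤ), ∀ u ∈ Set.Icc (0 : ℝ) 1,
    eLpNorm (cumKernel μ (fun i => (S u (t i)).val)) 2 volume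
      ≤ ENNReal.ofReal ‖κ m (lags t)‖
  /-- the derivative in rescaled time, taken in `L²([0,1]^k)`, exists and is bounded by `κ` -/
  cum_deriv : ∀ m : ℕ, 1 ≤ m → ∀ (t : Fin (m + 1) → ℤ), ∀ u ∈ Set.Icc (0 : ℝ) 1,
    ∃ D : Lp ℝ 2 (volume : Measure (Fin (m + 1) → unitInterval)),
      HasDerivWithinAt (fun w : ℝ => toL2 (cumKernel μ (fun i => (S w (t i)).val))) D
        (Set.Icc 0 1) u ∧ ‖D‖ ≤ ‖κ m (lags t)‖

/-! ### The time-varying spectrum -/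

/-- The covariance kernel `(τ, σ) ↦ E (X_h^{(u)}(τ) X_0^{(u)}(σ))`, in `L²([0,1]², ℂ)`.
By stationarity `(h, 0)` may be replaced by `(t + h, t)`. -/
def covKernel {Ω : Type*} [MeasurableSpace Ω] (μ : Measure Ω) (S : ℝ → ℤ → RandomL2 Ω)
    (u : ℝ) (h : ℤ) : Lp ℂ 2 (volume : Measure (unitInterval × unitInterval)) :=
  toL2 (fun p => ((∫ x, (S u h).val x p.1 * (S u 0).val x p.2 ∂μ : ℝ) : ℂ))

/-- The time-varying spectral density kernel `f_{u,ω}`, in `L²([0,1]², ℂ)`. -/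
def spectralKernel {Ω : Type*} [MeasurableSpace Ω] (μ : Measure Ω) (S : ℝ → ℤ → RandomL2 Ω)
    (u ω : ℝ) : Lp ℂ 2 (volume : Measure (unitInterval × unitInterval)) :=
  ∑' h : ℤ, Complex.exp (-(Complex.I * (2 * Real.pi * ω * h : ℝ))) • covKernel μ S u h

/-- The demeaned power spectrum `g_{u,ω} = f_{u,ω} - ∫₀¹ f_{v,ω} dv`. -/
def demeanedSpectrum {Ω : Type*} [MeasurableSpace Ω] (μ : Measure Ω) (S : ℝ → ℤ → RandomL2 Ω)
    (u ω : ℝ) : Lp ℂ 2 (volume : Measure (unitInterval × unitInterval)) :=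
  spectralKernel μ S u ω - ∫ v in (0 : ℝ)..1, spectralKernel μ S v ω

/-! ### The multitaper estimator and the test statistic -/

/-- The indicator `I_b` of the `b`-th block `((b-1)/B, b/B]` of rescaled time. -/
def blockIndicator (B b : ℕ) (u : ℝ) : ℝ :=
  open Classical in if ((b : ℝ) - 1) / B < u ∧ u ≤ (b : ℝ) / B then 1 else 0

/-- The `k`-th sinusoidal taper of the `b`-th block, for blocks of length `TB`. -/
def sineTaper (TB b k : ℕ) (t : ℤ) : ℝ :=
  Real.sqrt (2 / ((TB : ℝ) + 1)) *
    Real.sin (Real.pi * k * ((t : ℝ) - ((b : ℝ) - 1) * TB) / ((TB : ℝ) + 1))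

/-- The tapered local functional discrete Fourier transform. -/
def fDFT {Ω : Type*} [MeasurableSpace Ω] (X : ℕ → ℤ → RandomL2 Ω) (T B k b : ℕ) (ω : ℝ)
    (x : Ω) (τ : unitInterval) : ℂ :=
  ∑ t ∈ Finset.Icc (1 : ℤ) T,
    ((sineTaper (T / B) b k t * blockIndicator B b ((t : ℝ) / T) * (X T t).val x τ : ℝ) : ℂ) *
      Complex.exp (-(Complex.I * (2 * Real.pi * ω * t : ℝ)))

/-- The multitaper estimator of the local spectral kernel in the `b`-th block. -/
def blockSpectrum {Ω : Type*} [MeasurableSpace Ω] (X : ℕ → ℤ → RandomL2 Ω) (T B K b : ℕ)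
    (ω : ℝ) (x : Ω) (τ σ : unitInterval) : ℂ :=
  1 / (K : ℂ) * ∑ k ∈ Finset.Icc 1 K,
    fDFT X T B k b ω x τ * (starRingEnd ℂ) (fDFT X T B k b ω x σ)

/-- The multitaper estimator of the time-varying spectral kernel at rescaled time `u`. -/
def spectrumEstimator {Ω : Type*} [MeasurableSpace Ω] (X : ℕ → ℤ → RandomL2 Ω) (T B K : ℕ)
    (u ω : ℝ) (x : Ω) (τ σ : unitInterval) : ℂ :=
  ∑ b ∈ Finset.Icc 1 B, (blockIndicator B b u : ℂ) * blockSpectrum X T B K b ω x τ σ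

/-- The estimated demeaned spectrum at rescaled time `b / B`. -/
def demeanedEstimator {Ω : Type*} [MeasurableSpace Ω] (X : ℕ → ℤ → RandomL2 Ω) (T B K b : ℕ)
    (ω : ℝ) (x : Ω) (τ σ : unitInterval) : ℂ :=
  spectrumEstimator X T B K ((b : ℝ) / B) ω x τ σ -
    1 / (B : ℂ) * ∑ l ∈ Finset.Icc 1 B, spectrumEstimator X T B K ((l : ℝ) / B) ω x τ σ

/-- The statistic `Q⁰(ω₁, ω₂) = ∑_b ∫_{ω₁}^{ω₂} ∫₀¹ ∫₀¹ |ĝ_{b/B,ω}(τ, σ)|² dτ dσ dω`. -/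
def stationarityStatistic {Ω : Type*} [MeasurableSpace Ω] (X : ℕ → ℤ → RandomL2 Ω)
    (T B K : ℕ) (ω₁ ω₂ : ℝ) (x : Ω) : ℝ :=
  ∑ b ∈ Finset.Icc 1 B, ∫ ω in ω₁..ω₂, ∫ σ : unitInterval, ∫ τ : unitInterval,
    ‖demeanedEstimator X T B K b ω x τ σ‖ ^ 2

/-- The asymptotic scheme: `T, B, K → ∞`, `T / K² → ∞`, `T / (B K) → ∞`, with `T` a multiple
of `B`. -/
structure AsymptoticScheme (T B K : ℕ → ℕ) : Prop where
  dvd : ∀ n, B n ∣ T n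
  tendsto_T : Tendsto T atTop atTop
  tendsto_B : Tendsto B atTop atTop
  tendsto_K : Tendsto K atTop atTop
  tendsto_T_div_sq : Tendsto (fun n => (T n : ℝ) / (K n : ℝ) ^ 2) atTop atTop
  tendsto_T_div_mul : Tendsto (fun n => (T n : ℝ) / ((B n : ℝ) * K n)) atTop atTop

end FunctionalTimeSeries

end

noncomputable section

namespace FunctionalTimeSeries

/-! ### Joint cumulants of centered variables -/

/-! The statistic is a sum of squared `L²` norms, so testing the demeaned estimator against one
bounded function bounds it from below. Under the alternative, `g` has a nonzero integral over some
rectangle `A × A'` at some `u` and some frequency `ω₀` inside the band; a quadratic bump `φ` on a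
short interval around `ω₀` keeps the pairing with `φ ⊗ 1_A ⊗ 1_{A'}` nonzero. Let `H_b` be this
pairing for the estimator of block `b` (`blockStat`) and `F u` the one for the true spectrum
(`popStat`). Cauchy–Schwarz gives `Q⁰ ≥ ∑_b |H_b - H̄|²`, with `H̄` the mean of the `H_b`
(`sum_sq_norm_blockStat_le`). It remains to see that the right side is at least a constant times `B`
with probability tending to one; the factor `K` then forces divergence.

Smoothing in frequency turns `H_b` into a series `∑_h c_h · lagSum_h` over sample covariances, where
the `c_h` are the Fourier coefficients of `φ`. So only a law of large numbers along each block is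
needed, lag by lag. The `L¹` error at lag `h` has three sources: the array is replaced by the
stationary process at `b/B`; that process fluctuates, with variance of the order of the inverse
block length because second and fourth order cumulants are summable; and the shifted taper products
do not sum exactly to one, the defect being of order `K|h|` over the block length. All three vanish
uniformly in `b` (`eventually_integral_abs_lagSum_sub_le`). Since the bump vanishes at its
endpoints, `c_h = O(h⁻²)` is summable, and a bound uniform in `h` allows dominated convergence over
the lags (`tendsto_measure_average`).

The delicate source is the first. The variable `P` has only a moment of some order `ρ > 0`, which
gives closeness in probability but not in `L²`. For `Y = X - S` the cumulant condition controls
`E[XY]` but not `E[SY]`; the latter is handled by truncating `Y`, using the fourth moments of `S`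
(`integral_avg_array_sub_sq_le`).

Finally `F` is continuous and differs from its mean somewhere, so the Riemann sums of `|F - ∫F|`
have a positive limit, which `average_norm_sub_le` transfers to the `H_b`. Random functions enter
throughout via their averages over sets, and cumulant kernels via their integrals over boxes. -/

lemma sum_finpartition_eq {k : ℕ} (g : Finset (Finset (Fin k)) → ℝ)
    (s : Finset (Finset (Finset (Fin k))))
    (hs : ∀ P ∈ s, P.SupIndep id ∧ P.sup id = Finset.univ ∧ ∅ ∉ P)
    (hg : ∀ π : Finpartition (Finset.univ : Finset (Fin k)), π.parts ∉ s → g π.parts = 0) :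
    ∑ π : Finpartition (Finset.univ : Finset (Fin k)), g π.parts = ∑ P ∈ s, g P := by
  classical
  have hinj : Function.Injective
      (fun π : Finpartition (Finset.univ : Finset (Fin k)) => π.parts) :=
    fun a b h => Finpartition.ext h
  rw [← Finset.sum_image (f := g) (s := Finset.univ)
    (g := fun π : Finpartition (Finset.univ : Finset (Fin k)) => π.parts) (fun a _ b _ h => hinj h)]
  symm
  apply Finset.sum_subset
  · intro P hP
    obtain ⟨h1, h2, h3⟩ := hs P hP
    exact Finset.mem_image.2 ⟨⟨P, h1, h2, h3⟩, Finset.mem_univ _, rfl⟩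
  · intro P hP hPs
    obtain ⟨π, -, rfl⟩ := Finset.mem_image.1 hP
    exact hg π hPs

lemma finpartition_fin_two (π : Finpartition (Finset.univ : Finset (Fin 2)))
    (h : ∀ i, {i} ∉ π.parts) : π.parts = {Finset.univ} := by
  obtain ⟨A, hA, h0⟩ := π.exists_mem (Finset.mem_univ 0)
  have key : ∀ A : Finset (Fin 2), 0 ∈ A → (∀ i, A ≠ {i}) → A = Finset.univ := by decide
  have hAu := key A h0 (fun i hi => h i (hi ▸ hA))
  ext C
  rw [Finset.mem_singleton]
  refine ⟨fun hC => ?_, fun hC => by subst hC; subst hAu; exact hA⟩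
  by_contra hne
  have hd := π.disjoint hC hA (by rw [hAu]; exact hne)
  rw [hAu] at hd
  exact π.bot_notMem ((disjoint_top.1 hd) ▸ hC)

/-- If the block of `0` misses some `j`, then it and the block of `j` are disjoint and have at least
two elements each, so they exhaust the four indices and form one of the three pairings. -/
lemma finpartition_fin_four (π : Finpartition (Finset.univ : Finset (Fin 4)))
    (h : ∀ i, {i} ∉ π.parts) : π.parts ∈ ({{Finset.univ}, {{0, 1}, {2, 3}}, {{0, 2}, {1, 3}},
      {{0, 3}, {1, 2}}} : Finset (Finset (Finset (Fin 4)))) := by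
  obtain ⟨A, hA, h0⟩ := π.exists_mem (Finset.mem_univ 0)
  by_cases hAu : A = Finset.univ
  · have : π.parts = {Finset.univ} := by
      ext C
      rw [Finset.mem_singleton]
      refine ⟨fun hC => ?_, fun hC => by subst hC; subst hAu; exact hA⟩
      by_contra hne
      have hd := π.disjoint hC hA (by rw [hAu]; exact hne)
      rw [hAu] at hd
      exact π.bot_notMem ((disjoint_top.1 hd) ▸ hC)
    simp [this]
  · obtain ⟨j, hj⟩ : ∃ j, j ∉ A := by
      by_contra! hh
      exact hAu (Finset.eq_univ_iff_forall.2 hh)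
    obtain ⟨D, hD, hjD⟩ := π.exists_mem (Finset.mem_univ j)
    have hne : D ≠ A := by rintro rfl; exact hj hjD
    have hdis := π.disjoint hD hA hne
    have key : ∀ A D : Finset (Fin 4), (0 ∈ A ∧ A.card ≠ 1 ∧ D.card ≠ 0 ∧ D.card ≠ 1 ∧
        D ∩ A = ∅) → (A = {0, 1} ∧ D = {2, 3}) ∨ (A = {0, 2} ∧ D = {1, 3}) ∨
          (A = {0, 3} ∧ D = {1, 2}) := by decide
    have hcard : ∀ C ∈ π.parts, C.card ≠ 1 := fun C hC h1 => by
      obtain ⟨i, rfl⟩ := Finset.card_eq_one.1 h1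
      exact h i hC
    have hK := key A D ⟨h0, hcard A hA, Finset.card_ne_zero_of_mem hjD, hcard D hD,
      Finset.disjoint_iff_inter_eq_empty.1 hdis⟩
    have hun : A ∪ D = Finset.univ := by
      rcases hK with ⟨rfl, rfl⟩ | ⟨rfl, rfl⟩ | ⟨rfl, rfl⟩ <;> decide
    have hparts : π.parts = {A, D} := by
      ext C
      simp only [Finset.mem_insert, Finset.mem_singleton]
      refine ⟨fun hC => ?_, ?_⟩
      · by_contra! hne
        have h1 := π.disjoint hC hA hne.1
        have h2 := π.disjoint hC hD hne.2
        have h3 : Disjoint C (A ∪ D) := Finset.disjoint_union_right.2 ⟨h1, h2⟩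
        rw [hun] at h3
        exact π.bot_notMem ((disjoint_top.1 h3) ▸ hC)
      · rintro (rfl | rfl) <;> assumption
    rw [hparts]
    rcases hK with ⟨rfl, rfl⟩ | ⟨rfl, rfl⟩ | ⟨rfl, rfl⟩ <;> simp

variable {Ω : Type*} [MeasurableSpace Ω] {μ : Measure Ω}

/-- For centered variables a singleton block contributes a zero factor, so only partitions without
singletons survive in a joint cumulant. -/
lemma prod_integral_eq_zero {k : ℕ} {Z : Fin k → Ω → ℝ} (hZ : ∀ i, ∫ x, Z i x ∂μ = 0)
    (P : Finset (Finset (Fin k))) {i : Fin k} (hi : {i} ∈ P) :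
    ∏ A ∈ P, ∫ x, ∏ i ∈ A, Z i x ∂μ = 0 :=
  Finset.prod_eq_zero hi (by simp [hZ i])

lemma jointCumulant_two {Z : Fin 2 → Ω → ℝ} (hZ : ∀ i, ∫ x, Z i x ∂μ = 0) :
    jointCumulant μ Z = ∫ x, Z 0 x * Z 1 x ∂μ := by
  unfold jointCumulant
  rw [sum_finpartition_eq (fun P => (-1 : ℝ) ^ (P.card - 1) * ((P.card - 1).factorial : ℝ) *
      ∏ A ∈ P, ∫ x, ∏ i ∈ A, Z i x ∂μ) {{Finset.univ}} (by decide)]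
  · simp [Fin.prod_univ_two]
  · intro π hπ
    by_cases h : ∃ i, {i} ∈ π.parts
    · obtain ⟨i, hi⟩ := h
      rw [prod_integral_eq_zero hZ _ hi, mul_zero]
    · push Not at h
      exact absurd (Finset.mem_singleton.2 (finpartition_fin_two π h)) hπ

lemma jointCumulant_four {Z : Fin 4 → Ω → ℝ} (hZ : ∀ i, ∫ x, Z i x ∂μ = 0) :
    jointCumulant μ Z = (∫ x, Z 0 x * Z 1 x * Z 2 x * Z 3 x ∂μ)
      - (∫ x, Z 0 x * Z 1 x ∂μ) * (∫ x, Z 2 x * Z 3 x ∂μ)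
      - (∫ x, Z 0 x * Z 2 x ∂μ) * (∫ x, Z 1 x * Z 3 x ∂μ)
      - (∫ x, Z 0 x * Z 3 x ∂μ) * (∫ x, Z 1 x * Z 2 x ∂μ) := by
  unfold jointCumulant
  rw [sum_finpartition_eq (fun P => (-1 : ℝ) ^ (P.card - 1) * ((P.card - 1).factorial : ℝ) *
      ∏ A ∈ P, ∫ x, ∏ i ∈ A, Z i x ∂μ) {{Finset.univ}, {{0, 1}, {2, 3}}, {{0, 2}, {1, 3}},
      {{0, 3}, {1, 2}}} ?_]
  · rw [Finset.sum_insert (by decide), Finset.sum_insert (by decide), Finset.sum_insert (by decide),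
      Finset.sum_singleton, Finset.prod_singleton, Finset.prod_pair (by decide),
      Finset.prod_pair (by decide), Finset.prod_pair (by decide), Finset.card_singleton,
      Finset.card_pair (by decide), Finset.card_pair (by decide), Finset.card_pair (by decide)]
    simp only [Finset.prod_pair (show (0 : Fin 4) ≠ 1 by decide),
      Finset.prod_pair (show (0 : Fin 4) ≠ 2 by decide),
      Finset.prod_pair (show (0 : Fin 4) ≠ 3 by decide),
      Finset.prod_pair (show (1 : Fin 4) ≠ 2 by decide),
      Finset.prod_pair (show (1 : Fin 4) ≠ 3 by decide),
      Finset.prod_pair (show (2 : Fin 4) ≠ 3 by decide), Fin.prod_univ_four]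
    simp only [Nat.sub_self, pow_zero, Nat.factorial_zero, Nat.cast_one, mul_one, one_mul,
      show 2 - 1 = 1 from rfl, pow_one, Nat.factorial_one]
    ring
  · intro π hπ
    by_cases h : ∃ i, {i} ∈ π.parts
    · obtain ⟨i, hi⟩ := h
      rw [prod_integral_eq_zero hZ _ hi, mul_zero]
    · push Not at h
      exact absurd (finpartition_fin_four π h) hπ
  · intro P hP
    simp only [Finset.mem_insert, Finset.mem_singleton] at hP
    rcases hP with rfl | rfl | rfl | rfl
    · exact ⟨Finset.supIndep_singleton _ _, by decide, by decide⟩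
    all_goals
      exact ⟨(Finset.supIndep_pair (by decide)).2 (by
        simp only [id, Finset.disjoint_iff_inter_eq_empty]; decide), by decide, by decide⟩

end FunctionalTimeSeries

end

noncomputable section

namespace FunctionalTimeSeries

/-! ### Local averages of random functions -/

variable {Ω : Type*} [MeasurableSpace Ω] {μ : Measure Ω}

/-- The integral over `A` of a random function. -/
def RandomL2.avg (V : RandomL2 Ω) (A : Set unitInterval) (x : Ω) : ℝ :=
  ∫ τ in A, V.val x τ

/-- The difference quotient of two random functions. -/
def RandomL2.quot (V W : RandomL2 Ω) (c : ℝ) : RandomL2 Ω where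
  val x τ := (V.val x τ - W.val x τ) / c
  measurable_val := (V.measurable_val.sub W.measurable_val).div_const c
  memLp_val x := by
    simpa [div_eq_inv_mul] using ((V.memLp_val x).sub (W.memLp_val x)).const_mul c⁻¹

/-- The pullback of a random function to another sample space. -/
def RandomL2.comap {Ω' : Type*} [MeasurableSpace Ω'] (V : RandomL2 Ω) {f : Ω' → Ω}
    (hf : Measurable f) : RandomL2 Ω' where
  val x τ := V.val (f x) τ
  measurable_val := V.measurable_val.comp (hf.prodMap measurable_id)
  memLp_val x := V.memLp_val (f x)

lemma RandomL2.measurable_avg (V : RandomL2 Ω) (A : Set unitInterval) : Measurable (V.avg A) :=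
  (V.measurable_val.stronglyMeasurable.integral_prod_right
    (ν := volume.restrict A)).measurable

lemma RandomL2.measurable_norm_elem (V : RandomL2 Ω) : Measurable (fun x => ‖V.elem x‖) := by
  have : (fun x => ‖V.elem x‖) = fun x => ((∫⁻ τ, ‖V.val x τ‖ₑ ^ (2 : ℝ)) ^ (1 / (2 : ℝ))).toReal := by
    funext x
    rw [RandomL2.elem, Lp.norm_toLp, eLpNorm_eq_lintegral_rpow_enorm_toReal (by simp) (by simp)]
    simp
  rw [this]
  have h2 : Measurable (fun p : Ω × unitInterval => ‖V.val p.1 p.2‖ₑ ^ (2 : ℝ)) :=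
    (V.measurable_val.enorm).pow_const _
  exact (h2.lintegral_prod_right'.pow_const _).ennreal_toReal

lemma RandomL2.integrable_val (V : RandomL2 Ω) (x : Ω) : Integrable (V.val x) volume :=
  (V.memLp_val x).integrable (by norm_num)

lemma RandomL2.integral_abs_val_le (V : RandomL2 Ω) (x : Ω) :
    ∫ τ, |V.val x τ| ≤ ‖V.elem x‖ := by
  have h1 : ∫ τ, |V.val x τ| = (eLpNorm (V.val x) 1 volume).toReal := by
    rw [eLpNorm_one_eq_lintegral_enorm, ← integral_norm_eq_lintegral_enorm
      (V.integrable_val x).aestronglyMeasurable]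
    simp [Real.norm_eq_abs]
  rw [h1, RandomL2.elem, Lp.norm_toLp]
  exact ENNReal.toReal_mono (V.memLp_val x).eLpNorm_ne_top
    (eLpNorm_le_eLpNorm_of_exponent_le (by norm_num) (V.memLp_val x).1)

lemma RandomL2.abs_avg_le (V : RandomL2 Ω) (A : Set unitInterval) (x : Ω) :
    |V.avg A x| ≤ ‖V.elem x‖ := by
  refine (abs_integral_le_integral_abs).trans ((setIntegral_le_integral
    (V.integrable_val x).abs (ae_of_all _ fun _ => abs_nonneg _)).trans (V.integral_abs_val_le x))

lemma RandomL2.avg_quot (V W : RandomL2 Ω) (c : ℝ) (A : Set unitInterval) (x : Ω) :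
    (V.quot W c).avg A x = (V.avg A x - W.avg A x) / c := by
  unfold RandomL2.avg RandomL2.quot
  rw [integral_div, integral_sub (V.integrable_val x).integrableOn
    (W.integrable_val x).integrableOn]

lemma RandomL2.elem_quot (V W : RandomL2 Ω) (c : ℝ) (x : Ω) :
    (V.quot W c).elem x = c⁻¹ • (V.elem x - W.elem x) := by
  unfold RandomL2.elem
  rw [← MemLp.toLp_sub, ← MemLp.toLp_const_smul]
  congr 1
  funext τ
  simp [RandomL2.quot, div_eq_inv_mul]

/-- All moments of the norm are finite. -/
def HasMoments (μ : Measure Ω) (V : RandomL2 Ω) : Prop :=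
  ∀ k : ℕ, Integrable (fun x => ‖V.elem x‖ ^ k) μ

lemma HasMoments.memLp_norm {V : RandomL2 Ω} (hV : HasMoments μ V) {k : ℕ} (hk : k ≠ 0) :
    MemLp (fun x => ‖V.elem x‖) k μ := by
  refine (integrable_norm_rpow_iff V.measurable_norm_elem.aestronglyMeasurable (by simpa using hk)
    (by simp)).1 ?_
  simpa using hV k

lemma HasMoments.memLp_avg {V : RandomL2 Ω} (hV : HasMoments μ V) {k : ℕ} (hk : k ≠ 0)
    (A : Set unitInterval) : MemLp (V.avg A) k μ :=
  (hV.memLp_norm hk).mono (V.measurable_avg A).aestronglyMeasurable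
    (ae_of_all _ fun x => by
      rw [Real.norm_eq_abs, Real.norm_of_nonneg (norm_nonneg _)]; exact V.abs_avg_le A x)

lemma HasMoments.quot {V W : RandomL2 Ω} (hV : HasMoments μ V) (hW : HasMoments μ W) (c : ℝ) :
    HasMoments μ (V.quot W c) := by
  intro k
  rcases eq_or_ne k 0 with rfl | hk
  · simpa using hV 0
  have h : MemLp (fun x => ‖(V.quot W c).elem x‖) k μ := by
    refine (((hV.memLp_norm hk).add (hW.memLp_norm hk)).const_mul |c⁻¹|).mono
      (V.quot W c).measurable_norm_elem.aestronglyMeasurable (ae_of_all _ fun x => ?_)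
    rw [RandomL2.elem_quot, norm_norm, norm_smul, Real.norm_eq_abs]
    refine le_trans ?_ (le_abs_self _)
    simp only [Pi.add_apply]
    gcongr
    exact norm_sub_le _ _
  have h2 := (integrable_norm_rpow_iff h.1 (by simpa using hk) (by simp)).2 h
  simpa using h2

lemma HasMoments.comap {Ω' : Type*} [MeasurableSpace Ω'] {μ' : Measure Ω'} {V : RandomL2 Ω}
    (hV : HasMoments μ V) {f : Ω' → Ω} (hf : MeasurePreserving f μ' μ) :
    HasMoments μ' (V.comap hf.measurable) :=
  fun k => hf.integrable_comp_of_integrable (hV k)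

/-- The moment kernel `(τ₁, …, τ_k) ↦ E (Z₁(τ₁) ⋯ Z_k(τ_k))`. -/
def momentKernel {k : ℕ} (μ : Measure Ω) (Z : Fin k → RandomL2 Ω) (τ : Fin k → unitInterval) : ℝ :=
  ∫ x, ∏ i, (Z i).val x (τ i) ∂μ

lemma ae_centered_pi {k : ℕ} {Z : Fin k → RandomL2 Ω} (h0 : ∀ i, ∀ᵐ τ, ∫ x, (Z i).val x τ ∂μ = 0) :
    ∀ᵐ τ : Fin k → unitInterval, ∀ i, ∫ x, (Z i).val x (τ i) ∂μ = 0 := by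
  rw [ae_all_iff]
  intro i
  exact (Measure.quasiMeasurePreserving_eval (fun _ : Fin k => (volume : Measure unitInterval))
    i).tendsto_ae (h0 i)

lemma cumKernel_two_ae {Z : Fin 2 → RandomL2 Ω} (h0 : ∀ i, ∀ᵐ τ, ∫ x, (Z i).val x τ ∂μ = 0) :
    cumKernel μ (fun i => (Z i).val) =ᵐ[volume] momentKernel μ Z := by
  filter_upwards [ae_centered_pi h0] with τ hτ
  unfold cumKernel momentKernel
  rw [jointCumulant_two hτ]
  simp [Fin.prod_univ_two]

/-! ### Integrals of cumulant kernels over boxes -/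

section Fubini

variable [IsProbabilityMeasure μ] {k : ℕ}

/-- Hölder's inequality with `k` equal exponents, each factor having a finite `k`-th moment. -/
lemma integrable_prod_norm_elem {Z : Fin k → RandomL2 Ω} (hZ : ∀ i, HasMoments μ (Z i)) :
    Integrable (fun x => ∏ i, ‖(Z i).elem x‖) μ := by
  rcases eq_or_ne k 0 with rfl | hk
  · simp
  have h := MemLp.prod' (s := Finset.univ) (p := fun _ => (k : ENNReal))
    (fun i _ => (hZ i).memLp_norm hk)
  rw [← memLp_one_iff_integrable]
  convert! h
  simp [ENNReal.mul_inv_cancel (show (k : ENNReal) ≠ 0 by simpa using hk) (by simp)]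

lemma measurable_prod_val (Z : Fin k → RandomL2 Ω) :
    Measurable (fun p : Ω × (Fin k → unitInterval) => ∏ i, (Z i).val p.1 (p.2 i)) := by
  refine Finset.measurable_prod _ fun i _ => ?_
  exact (Z i).measurable_val.comp (measurable_fst.prodMk ((measurable_pi_apply i).comp measurable_snd))

lemma integrable_prod_val {Z : Fin k → RandomL2 Ω} (hZ : ∀ i, HasMoments μ (Z i)) :
    Integrable (fun p : Ω × (Fin k → unitInterval) => ∏ i, (Z i).val p.1 (p.2 i))
      (μ.prod volume) := by
  rw [integrable_prod_iff (measurable_prod_val Z).aestronglyMeasurable]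
  refine ⟨ae_of_all _ fun x => Integrable.fintype_prod fun i => (Z i).integrable_val x, ?_⟩
  refine (integrable_prod_norm_elem hZ).mono
    (measurable_prod_val Z).norm.stronglyMeasurable.integral_prod_right.aestronglyMeasurable
    (ae_of_all _ fun x => ?_)
  simp only [norm_prod]
  rw [integral_fintype_prod_volume_eq_prod (fun i τ => ‖(Z i).val x τ‖), norm_prod]
  refine Finset.prod_le_prod (fun i _ => norm_nonneg _) fun i _ => ?_
  rw [Real.norm_of_nonneg (integral_nonneg fun _ => norm_nonneg _), norm_norm]
  exact (Z i).integral_abs_val_le x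

lemma integrable_momentKernel {Z : Fin k → RandomL2 Ω} (hZ : ∀ i, HasMoments μ (Z i)) :
    Integrable (momentKernel μ Z) volume :=
  (integrable_prod_val hZ).integral_prod_right

lemma setIntegral_momentKernel {Z : Fin k → RandomL2 Ω} (hZ : ∀ i, HasMoments μ (Z i))
    (A : Fin k → Set unitInterval) :
    ∫ τ in Set.univ.pi A, momentKernel μ Z τ = ∫ x, ∏ i, (Z i).avg (A i) x ∂μ := by
  unfold momentKernel RandomL2.avg
  have hI := integrable_prod_val hZ
  rw [integral_integral_swap]
  · refine integral_congr_ae (ae_of_all _ fun x => ?_)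
    simp only
    rw [volume_pi, Measure.restrict_pi_pi, integral_fintype_prod_eq_prod]
  · have h2 : Integrable (fun p : Ω × (Fin k → unitInterval) => ∏ i, (Z i).val p.1 (p.2 i))
      (μ.prod (volume.restrict (Set.univ.pi A))) := by
      refine hI.mono_measure ?_
      exact Measure.prod_mono le_rfl Measure.restrict_le_self
    exact h2.swap

/-- On a probability space the `L¹` norm is at most the `L²` norm. The bound is known for the
cumulant kernel `f`, integrability for its version `g` built from moment kernels. -/
lemma abs_setIntegral_le_of_eLpNorm_two {α : Type*} [MeasurableSpace α] {ν : Measure α}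
    [IsProbabilityMeasure ν] {f g : α → ℝ} (hfg : f =ᵐ[ν] g) (hg : Integrable g ν) {c : ℝ}
    (hc : 0 ≤ c) (hf : eLpNorm f 2 ν ≤ ENNReal.ofReal c) (s : Set α) :
    |∫ y in s, g y ∂ν| ≤ c := by
  refine abs_integral_le_integral_abs.trans ((setIntegral_le_integral hg.abs
    (ae_of_all _ fun _ => abs_nonneg _)).trans ?_)
  have h1 : ∫ y, |g y| ∂ν = (eLpNorm g 1 ν).toReal := by
    rw [eLpNorm_one_eq_lintegral_enorm, ← integral_norm_eq_lintegral_enorm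
      hg.aestronglyMeasurable]
    simp [Real.norm_eq_abs]
  rw [h1]
  refine ENNReal.toReal_le_of_le_ofReal hc (le_trans ?_ hf)
  rw [eLpNorm_congr_ae hfg]
  exact eLpNorm_le_eLpNorm_of_exponent_le (by norm_num) hg.1

lemma abs_integral_avg_two_le {Z : Fin 2 → RandomL2 Ω} (hZ : ∀ i, HasMoments μ (Z i))
    (h0 : ∀ i, ∀ᵐ τ, ∫ x, (Z i).val x τ ∂μ = 0) {c : ℝ} (hc : 0 ≤ c)
    (hle : eLpNorm (cumKernel μ (fun i => (Z i).val)) 2 volume ≤ ENNReal.ofReal c)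
    (A : Fin 2 → Set unitInterval) :
    |∫ x, (Z 0).avg (A 0) x * (Z 1).avg (A 1) x ∂μ| ≤ c := by
  have h := abs_setIntegral_le_of_eLpNorm_two (cumKernel_two_ae h0) (integrable_momentKernel hZ)
    hc hle (Set.univ.pi A)
  rw [setIntegral_momentKernel hZ] at h
  simpa [Fin.prod_univ_two] using h

/-- Two independent copies: the coordinates in `s` are drawn from the first sample point. -/
def splitCopy (Z : Fin k → RandomL2 Ω) (s : Finset (Fin k)) : Fin k → RandomL2 (Ω × Ω) :=
  fun i => if i ∈ s then (Z i).comap measurable_fst else (Z i).comap measurable_snd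

lemma HasMoments.splitCopy {Z : Fin k → RandomL2 Ω} (hZ : ∀ i, HasMoments μ (Z i))
    (s : Finset (Fin k)) (i : Fin k) : HasMoments (μ.prod μ) (splitCopy Z s i) := by
  unfold FunctionalTimeSeries.splitCopy
  split_ifs
  · exact (hZ i).comap measurePreserving_fst
  · exact (hZ i).comap measurePreserving_snd

/-- A product of two expectations is a single expectation over two independent copies of the sample
space. Each pairing term thus becomes a moment kernel, and the same Fubini lemma integrates all four
terms over a box. -/
lemma cumKernel_four_ae {Z : Fin 4 → RandomL2 Ω} (h0 : ∀ i, ∀ᵐ τ, ∫ x, (Z i).val x τ ∂μ = 0) :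
    cumKernel μ (fun i => (Z i).val) =ᵐ[volume] fun τ => momentKernel μ Z τ -
      momentKernel (μ.prod μ) (splitCopy Z {0, 1}) τ -
      momentKernel (μ.prod μ) (splitCopy Z {0, 2}) τ -
      momentKernel (μ.prod μ) (splitCopy Z {0, 3}) τ := by
  filter_upwards [ae_centered_pi h0] with τ hτ
  unfold cumKernel momentKernel
  rw [jointCumulant_four hτ]
  rw [← integral_prod_mul, ← integral_prod_mul, ← integral_prod_mul]
  simp only [Fin.prod_univ_four, splitCopy, RandomL2.comap]
  congr 1
  · congr 1
    · congr 1
      refine integral_congr_ae (ae_of_all _ fun x => ?_)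
      simp
      ring
    · refine integral_congr_ae (ae_of_all _ fun x => ?_)
      simp
      ring
  · refine integral_congr_ae (ae_of_all _ fun x => ?_)
    simp
    ring

lemma abs_cum_avg_four_le {Z : Fin 4 → RandomL2 Ω} (hZ : ∀ i, HasMoments μ (Z i))
    (h0 : ∀ i, ∀ᵐ τ, ∫ x, (Z i).val x τ ∂μ = 0) {c : ℝ} (hc : 0 ≤ c)
    (hle : eLpNorm (cumKernel μ (fun i => (Z i).val)) 2 volume ≤ ENNReal.ofReal c)
    (A : Fin 4 → Set unitInterval) :
    |(∫ x, (Z 0).avg (A 0) x * (Z 1).avg (A 1) x * (Z 2).avg (A 2) x * (Z 3).avg (A 3) x ∂μ)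
      - (∫ x, (Z 0).avg (A 0) x * (Z 1).avg (A 1) x ∂μ) *
          (∫ x, (Z 2).avg (A 2) x * (Z 3).avg (A 3) x ∂μ)
      - (∫ x, (Z 0).avg (A 0) x * (Z 2).avg (A 2) x ∂μ) *
          (∫ x, (Z 1).avg (A 1) x * (Z 3).avg (A 3) x ∂μ)
      - (∫ x, (Z 0).avg (A 0) x * (Z 3).avg (A 3) x ∂μ) *
          (∫ x, (Z 1).avg (A 1) x * (Z 2).avg (A 2) x ∂μ)| ≤ c := by
  have i0 := integrable_momentKernel hZ
  have i1 := fun s => integrable_momentKernel (fun i => HasMoments.splitCopy hZ s i)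
  have h := abs_setIntegral_le_of_eLpNorm_two (cumKernel_four_ae h0)
    (((i0.sub (i1 {0, 1})).sub (i1 {0, 2})).sub (i1 {0, 3})) hc hle (Set.univ.pi A)
  have i2 : Integrable (fun τ => momentKernel μ Z τ
    - momentKernel (μ.prod μ) (splitCopy Z {0, 1}) τ) volume := i0.sub (i1 _)
  have i3 : Integrable (fun τ => momentKernel μ Z τ
    - momentKernel (μ.prod μ) (splitCopy Z {0, 1}) τ
    - momentKernel (μ.prod μ) (splitCopy Z {0, 2}) τ) volume := i2.sub (i1 _)
  rw [integral_sub i3.integrableOn (i1 _).integrableOn,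
    integral_sub i2.integrableOn (i1 _).integrableOn,
    integral_sub i0.integrableOn (i1 _).integrableOn, setIntegral_momentKernel hZ,
    setIntegral_momentKernel (fun i => HasMoments.splitCopy hZ _ i),
    setIntegral_momentKernel (fun i => HasMoments.splitCopy hZ _ i),
    setIntegral_momentKernel (fun i => HasMoments.splitCopy hZ _ i)] at h
  rw [← integral_prod_mul, ← integral_prod_mul, ← integral_prod_mul]
  simp only [Fin.prod_univ_four, splitCopy] at h
  convert h using 2
  congr 1
  · congr 1
    · congr 1
      refine integral_congr_ae (ae_of_all _ fun x => ?_)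
      simp [RandomL2.comap, RandomL2.avg]
      ring
    · refine integral_congr_ae (ae_of_all _ fun x => ?_)
      simp [RandomL2.comap, RandomL2.avg]
      ring
  · refine integral_congr_ae (ae_of_all _ fun x => ?_)
    simp [RandomL2.comap, RandomL2.avg]
    ring

end Fubini

end FunctionalTimeSeries

end

noncomputable section

namespace FunctionalTimeSeries

/-! ### Averages of a locally stationary array -/

variable {Ω : Type*} [MeasurableSpace Ω] {μ : Measure Ω}

lemma HasMoments.integrable_uncurry [IsProbabilityMeasure μ] {V : RandomL2 Ω}
    (hV : HasMoments μ V) : Integrable (Function.uncurry V.val) (μ.prod volume) := by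
  rw [integrable_prod_iff V.measurable_val.aestronglyMeasurable]
  refine ⟨ae_of_all _ fun x => V.integrable_val x, ?_⟩
  have h1 : Integrable (fun x => ‖V.elem x‖) μ := by simpa using hV 1
  refine h1.mono V.measurable_val.norm.stronglyMeasurable.integral_prod_right.aestronglyMeasurable
    (ae_of_all _ fun x => ?_)
  rw [Real.norm_of_nonneg (integral_nonneg fun _ => norm_nonneg _), norm_norm]
  exact V.integral_abs_val_le x

/-- By Fubini both functions are integrable in the sample point for almost every `τ`, so the two
means may be subtracted. The case `c = 1` provides plain differences such as `X - S`. -/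
lemma CenteredWithMoments.quot [IsProbabilityMeasure μ] {V W : RandomL2 Ω}
    (hV : CenteredWithMoments μ V) (hW : CenteredWithMoments μ W) (c : ℝ) :
    CenteredWithMoments μ (V.quot W c) := by
  refine ⟨HasMoments.quot hV.1 hW.1 c, ?_⟩
  filter_upwards [hV.2, hW.2, (HasMoments.integrable_uncurry hV.1).prod_left_ae,
    (HasMoments.integrable_uncurry hW.1).prod_left_ae] with τ h1 h2 h3 h4
  simp only [RandomL2.quot]
  rw [integral_div, integral_sub (f := fun a => V.val a τ) (g := fun a => W.val a τ) h3 h4, h1, h2]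
  simp

lemma CenteredWithMoments.hasMoments {V : RandomL2 Ω} (hV : CenteredWithMoments μ V) :
    HasMoments μ V := hV.1

section Moments

variable {V W : RandomL2 Ω}

lemma HasMoments.integrable_avg_mul (hV : HasMoments μ V) (hW : HasMoments μ W)
    (A A' : Set unitInterval) : Integrable (fun x => V.avg A x * W.avg A' x) μ :=
  MemLp.integrable_mul (p := 2) (q := 2) (hV.memLp_avg (k := 2) two_ne_zero A)
    (hW.memLp_avg (k := 2) two_ne_zero A')

lemma HasMoments.integrable_avg_sq (hV : HasMoments μ V) (A : Set unitInterval) :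
    Integrable (fun x => V.avg A x ^ 2) μ := by
  simpa [sq] using hV.integrable_avg_mul hV A A

lemma HasMoments.integrable_avg_sub_sq (hV : HasMoments μ V) (hW : HasMoments μ W)
    (A : Set unitInterval) :
    Integrable (fun x => (V.avg A x - W.avg A x) ^ 2) μ := by
  simpa [RandomL2.avg_quot] using (hV.quot hW 1).integrable_avg_sq A

lemma integrable_avg_four [IsProbabilityMeasure μ] {Z : Fin 4 → RandomL2 Ω} (hZ : ∀ i, HasMoments μ (Z i))
    (A : Fin 4 → Set unitInterval) :
    Integrable (fun x => (Z 0).avg (A 0) x * (Z 1).avg (A 1) x * (Z 2).avg (A 2) x *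
      (Z 3).avg (A 3) x) μ := by
  have := (integrable_prod_norm_elem hZ)
  refine this.mono ((((Z 0).measurable_avg _).mul ((Z 1).measurable_avg _)).mul
    ((Z 2).measurable_avg _) |>.mul ((Z 3).measurable_avg _)).aestronglyMeasurable
    (ae_of_all _ fun x => ?_)
  rw [norm_prod, Fin.prod_univ_four]
  simp only [norm_mul, Real.norm_eq_abs, abs_norm]
  gcongr <;> exact RandomL2.abs_avg_le _ _ _

lemma HasMoments.integrable_avg_pow_four [IsProbabilityMeasure μ] (hV : HasMoments μ V)
    (A : Set unitInterval) : Integrable (fun x => V.avg A x ^ 4) μ := by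
  have := integrable_avg_four (Z := fun _ => V) (fun _ => hV) (fun _ => A)
  refine this.congr (ae_of_all _ fun x => ?_)
  ring

end Moments

variable [IsProbabilityMeasure μ] {X : ℕ → ℤ → RandomL2 Ω} {S : ℝ → ℤ → RandomL2 Ω}
  {κ : (m : ℕ) → (Fin m → ℤ) → Lp ℝ 2 (volume : Measure (Fin (m + 1) → unitInterval))}

/-- The bound on second order cumulants at lag `h`. -/
def covBound (κ : (m : ℕ) → (Fin m → ℤ) → Lp ℝ 2 (volume : Measure (Fin (m + 1) → unitInterval)))
    (h : ℤ) : ℝ := ‖κ 1 (fun _ => h)‖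

lemma covBound_nonneg (h : ℤ) : 0 ≤ covBound κ h := norm_nonneg _

lemma lags_pair (s t : ℤ) : lags ![s, t] = fun _ => s - t := by
  funext j
  fin_cases j
  rfl

lemma lags_four (a b c d : ℤ) : lags ![a, b, c, d] = ![a - d, b - d, c - d] := by
  funext j
  fin_cases j <;> rfl

/-! ### Moment bounds from the cumulant conditions of orders two and four -/

namespace CumulantMixing

lemma abs_cov_le (hX : CumulantMixing μ X S κ) {u : ℝ} (hu : u ∈ Set.Icc (0 : ℝ) 1) (s t : ℤ)
    (A A' : Set unitInterval) :
    |∫ x, (S u s).avg A x * (S u t).avg A' x ∂μ| ≤ covBound κ (s - t) := by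
  have h := hX.cum_stationary 1 le_rfl ![s, t] u hu
  rw [lags_pair] at h
  exact abs_integral_avg_two_le (Z := fun i => S u (![s, t] i))
    (fun i => (hX.centered_approx u hu _).1) (fun i => (hX.centered_approx u hu _).2)
    (norm_nonneg _) h ![A, A']

lemma abs_cov_quot_le (hX : CumulantMixing μ X S κ) {u w v : ℝ} (hu : u ∈ Set.Icc (0 : ℝ) 1)
    (hw : w ∈ Set.Icc (0 : ℝ) 1) (hv : v ∈ Set.Icc (0 : ℝ) 1) (s t : ℤ)
    (A A' : Set unitInterval) :
    |∫ x, (S u s).avg A x * ((S w t).avg A' x - (S v t).avg A' x) ∂μ| ≤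
      |w - v| * covBound κ (s - t) := by
  rcases eq_or_ne w v with rfl | hne
  · simp
  have h := hX.cum_quotient 1 le_rfl ![s, t] ![u, w] v
    (fun i => by fin_cases i <;> assumption) hv hne
  rw [lags_pair] at h
  have h2 := abs_integral_avg_two_le (Z := ![S u s, (S w t).quot (S v t) (w - v)]) (μ := μ)
    (fun i => by
      fin_cases i
      · exact (hX.centered_approx u hu s).1
      · exact ((hX.centered_approx w hw t).quot (hX.centered_approx v hv t) _).1)
    (fun i => by
      fin_cases i
      · exact (hX.centered_approx u hu s).2
      · exact ((hX.centered_approx w hw t).quot (hX.centered_approx v hv t) _).2)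
    (norm_nonneg _) (c := covBound κ (s - t)) (by
      unfold covBound
      convert h using 3
      funext i
      fin_cases i <;> rfl) ![A, A']
  simp only [Matrix.cons_val_zero, Matrix.cons_val_one, RandomL2.avg_quot] at h2
  have h3 : ∀ x, (S u s).avg A x * ((S w t).avg A' x - (S v t).avg A' x) = (w - v) *
      ((S u s).avg A x * (((S w t).avg A' x - (S v t).avg A' x) / (w - v))) := fun x => by
    have := sub_ne_zero.2 hne
    field_simp
  simp_rw [h3]
  rw [integral_const_mul, abs_mul]
  gcongr

lemma abs_cov_array_le (hX : CumulantMixing μ X S κ) {T : ℕ} {s t : ℤ} (hs : 1 ≤ s ∧ s ≤ T)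
    (ht : 1 ≤ t ∧ t ≤ T) (A A' : Set unitInterval) :
    |∫ x, (X T s).avg A x * ((X T t).avg A' x - (S ((t : ℝ) / T) t).avg A' x) ∂μ| ≤
      1 / T * covBound κ (s - t) := by
  have hu : (t : ℝ) / T ∈ Set.Icc (0 : ℝ) 1 := by
    have h1 : (1 : ℝ) ≤ t := by exact_mod_cast ht.1
    have h2 : (t : ℝ) ≤ T := by exact_mod_cast ht.2
    exact ⟨by positivity, div_le_one_of_le₀ h2 (by positivity)⟩
  have h := hX.cum_array 1 le_rfl T ![s, t] (fun i => by fin_cases i <;> assumption)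
  rw [lags_pair] at h
  have h2 := abs_integral_avg_two_le (Z := ![X T s, (X T t).quot (S ((t : ℝ) / T) t) 1]) (μ := μ)
    (fun i => by
      fin_cases i
      · exact (hX.centered T s hs.1 hs.2).1
      · exact ((hX.centered T t ht.1 ht.2).quot (hX.centered_approx _ hu t) _).1)
    (fun i => by
      fin_cases i
      · exact (hX.centered T s hs.1 hs.2).2
      · exact ((hX.centered T t ht.1 ht.2).quot (hX.centered_approx _ hu t) _).2)
    (c := 1 / T * covBound κ (s - t)) (mul_nonneg (by positivity) (norm_nonneg _)) (by
      unfold covBound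
      convert h using 3
      funext i
      fin_cases i
      · rfl
      · funext x τ
        simp [RandomL2.quot, Fin.snoc]) ![A, A']
  simpa [RandomL2.avg_quot] using h2

lemma integral_avg_sq_le (hX : CumulantMixing μ X S κ) {u : ℝ} (hu : u ∈ Set.Icc (0 : ℝ) 1)
    (t : ℤ) (A : Set unitInterval) : ∫ x, (S u t).avg A x ^ 2 ∂μ ≤ covBound κ 0 := by
  have := (le_abs_self _).trans (hX.abs_cov_le hu t t A A)
  simpa [sq] using this

/-- Write `(a - b)² = a(a - b) - b(a - b)`: each term is a covariance with one increment, which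
costs `|u - v|`. The conditions bound one increment per cumulant, hence the first power of `|u -
v|`. -/
lemma integral_avg_sub_sq_le (hX : CumulantMixing μ X S κ) {u v : ℝ}
    (hu : u ∈ Set.Icc (0 : ℝ) 1) (hv : v ∈ Set.Icc (0 : ℝ) 1) (t : ℤ) (A : Set unitInterval) :
    ∫ x, ((S u t).avg A x - (S v t).avg A x) ^ 2 ∂μ ≤ 2 * |u - v| * covBound κ 0 := by
  have h1 := (le_abs_self _).trans (hX.abs_cov_quot_le hu hu hv t t A A)
  have h2 := (neg_abs_le _).trans' (neg_le_neg (hX.abs_cov_quot_le hv hu hv t t A A))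
  have mu := (hX.centered_approx u hu t).hasMoments
  have mv := (hX.centered_approx v hv t).hasMoments
  have i1 : Integrable (fun x => (S u t).avg A x * ((S u t).avg A x - (S v t).avg A x)) μ := by
    simpa [RandomL2.avg_quot] using mu.integrable_avg_mul (mu.quot mv 1) A A
  have i2 : Integrable (fun x => (S v t).avg A x * ((S u t).avg A x - (S v t).avg A x)) μ := by
    simpa [RandomL2.avg_quot] using mv.integrable_avg_mul (mu.quot mv 1) A A
  have : ∫ x, ((S u t).avg A x - (S v t).avg A x) ^ 2 ∂μ =
      (∫ x, (S u t).avg A x * ((S u t).avg A x - (S v t).avg A x) ∂μ) -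
      ∫ x, (S v t).avg A x * ((S u t).avg A x - (S v t).avg A x) ∂μ := by
    rw [← integral_sub i1 i2]
    congr 1
    funext x
    ring
  rw [this]
  simp only [sub_self] at h1 h2
  linarith

/-- For centered variables the covariance of two products is the fourth cumulant plus the two
pairings that link one product to the other. -/
lemma abs_cov_mul_le (hX : CumulantMixing μ X S κ) {u : ℝ} (hu : u ∈ Set.Icc (0 : ℝ) 1)
    (a b c d : ℤ) (A A' : Set unitInterval) :
    |(∫ x, ((S u a).avg A x * (S u b).avg A' x) * ((S u c).avg A x * (S u d).avg A' x) ∂μ)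
      - (∫ x, (S u a).avg A x * (S u b).avg A' x ∂μ) *
          (∫ x, (S u c).avg A x * (S u d).avg A' x ∂μ)| ≤
      ‖κ 3 ![a - d, b - d, c - d]‖ + covBound κ (a - c) * covBound κ (b - d) +
        covBound κ (a - d) * covBound κ (b - c) := by
  have h := hX.cum_stationary 3 (by norm_num) ![a, b, c, d] u hu
  rw [lags_four] at h
  have h4 := abs_cum_avg_four_le (Z := fun i => S u (![a, b, c, d] i)) (μ := μ)
    (fun i => (hX.centered_approx u hu _).1) (fun i => (hX.centered_approx u hu _).2)
    (norm_nonneg _) h ![A, A', A, A']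
  simp only [Matrix.cons_val] at h4
  have e2 := hX.abs_cov_le hu a c A A
  have e3 := hX.abs_cov_le hu b d A' A'
  have e4 := hX.abs_cov_le hu a d A A'
  have e5 := hX.abs_cov_le hu b c A' A
  have p1 := mul_le_mul e2 e3 (abs_nonneg _) (covBound_nonneg _)
  have p2 := mul_le_mul e4 e5 (abs_nonneg _) (covBound_nonneg _)
  rw [← abs_mul] at p1 p2
  simp only [← mul_assoc]
  rw [abs_le] at h4 p1 p2 ⊢
  constructor <;> linarith [h4.1, h4.2, p1.1, p1.2, p2.1, p2.2]

lemma integral_avg_pow_four_le (hX : CumulantMixing μ X S κ) {u : ℝ}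
    (hu : u ∈ Set.Icc (0 : ℝ) 1) (t : ℤ) (A : Set unitInterval) :
    ∫ x, (S u t).avg A x ^ 4 ∂μ ≤ ‖κ 3 ![0, 0, 0]‖ + 3 * covBound κ 0 ^ 2 := by
  have h := (le_abs_self _).trans (hX.abs_cov_mul_le hu t t t t A A)
  have h2 := hX.abs_cov_le hu t t A A
  simp only [sub_self] at h h2
  have e : ∀ x, (S u t).avg A x ^ 4 =
      ((S u t).avg A x * (S u t).avg A x) * ((S u t).avg A x * (S u t).avg A x) := fun x => by ring
  simp_rw [e]
  have h3 := mul_le_mul h2 h2 (abs_nonneg _) (covBound_nonneg _)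
  rw [← abs_mul] at h3
  have := le_abs_self ((∫ x, (S u t).avg A x * (S u t).avg A x ∂μ) *
    ∫ x, (S u t).avg A x * (S u t).avg A x ∂μ)
  nlinarith

end CumulantMixing

end FunctionalTimeSeries

end

noncomputable section

namespace FunctionalTimeSeries

/-! ### Replacing the array by its stationary approximations -/

variable {Ω : Type*} [MeasurableSpace Ω] {μ : Measure Ω}
  {X : ℕ → ℤ → RandomL2 Ω} {S : ℝ → ℤ → RandomL2 Ω}
  {κ : (m : ℕ) → (Fin m → ℤ) → Lp ℝ 2 (volume : Measure (Fin (m + 1) → unitInterval))}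

lemma div_mem_Icc {T : ℕ} {t : ℤ} (ht : 1 ≤ t ∧ t ≤ T) : (t : ℝ) / T ∈ Set.Icc (0 : ℝ) 1 := by
  have h1 : (1 : ℝ) ≤ t := by exact_mod_cast ht.1
  have h2 : (t : ℝ) ≤ T := by exact_mod_cast ht.2
  exact ⟨by positivity, div_le_one_of_le₀ h2 (by positivity)⟩

/-- If `|y| ≤ η`, the product is at most `η|s|`. Otherwise it is at most `s²/2 + y²/2`, and `s²/2 ≤
θs⁴/4 + 1/(4θ)`. After integration the `y²/2` can be absorbed by a full `y²`; what is left involves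
moments of `s` and the probability that `|y| > η`. -/
lemma neg_mul_le_of_threshold (s y : ℝ) {η θ : ℝ} (hη : 0 < η) (hθ : 0 < θ) :
    -(s * y) ≤ η * (1 + s ^ 2) / 2 + y ^ 2 / 2 + θ * s ^ 4 / 4 +
      (if η < |y| then 1 else 0) / (4 * θ) := by
  have h1 : -(s * y) ≤ |s| * |y| := by rw [← abs_mul]; exact neg_le_abs _
  have hs : |s| ^ 2 = s ^ 2 := sq_abs s
  have hy : |y| ^ 2 = y ^ 2 := sq_abs y
  split_ifs with h
  · have h2 : |s| * |y| ≤ s ^ 2 / 2 + y ^ 2 / 2 := by nlinarith [sq_nonneg (|s| - |y|)]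
    have h3 : s ^ 2 / 2 ≤ θ * s ^ 4 / 4 + 1 / (4 * θ) := by
      have : θ * s ^ 4 / 4 + 1 / (4 * θ) - s ^ 2 / 2 = (θ * s ^ 2 - 1) ^ 2 / (4 * θ) := by
        field_simp
        ring
      have h4 : 0 ≤ (θ * s ^ 2 - 1) ^ 2 / (4 * θ) := by positivity
      linarith
    have : 0 ≤ η * (1 + s ^ 2) / 2 := by positivity
    linarith
  · push Not at h
    have h2 : |s| * |y| ≤ |s| * η := by gcongr
    have h3 : |s| * η ≤ η * (1 + s ^ 2) / 2 := by nlinarith [sq_nonneg (|s| - 1)]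
    have : 0 ≤ y ^ 2 / 2 + θ * s ^ 4 / 4 + 0 / (4 * θ) := by positivity
    linarith

namespace CumulantMixing

/-- Averages of the array are close in probability to those of its approximations. -/
lemma eventually_measure_avg_sub_le (hX : CumulantMixing μ X S κ) (A : Set unitInterval)
    {η ε : ℝ} (hη : 0 < η) (hε : 0 < ε) : ∀ᶠ T : ℕ in atTop, ∀ t : ℤ, 1 ≤ t ∧ t ≤ T →
      μ.real {x | η < |(X T t).avg A x - (S ((t : ℝ) / T) t).avg A x|} ≤ ε := by
  obtain ⟨ρ, C, P, hρ, hP⟩ := hX.locallyStationary.approx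
  have hlim : Tendsto (fun T : ℕ => (C : ℝ) / ((T : ℝ) * η) ^ ρ) atTop (𝓝 0) := by
    refine tendsto_const_nhds.div_atTop ((tendsto_rpow_atTop hρ).comp ?_)
    exact tendsto_natCast_atTop_atTop.atTop_mul_const hη
  filter_upwards [hlim.eventually (ge_mem_nhds hε), eventually_gt_atTop 0] with T hT hT0 t ht
  refine le_trans ?_ hT
  have hT0' : (0 : ℝ) < T := by exact_mod_cast hT0
  obtain ⟨hPm, hP0, hPC, hPa⟩ := hP _ (div_mem_Icc ht) T t ht.1 ht.2
  set p := P ((t : ℝ) / T) T t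
  have hpos : 0 < ((T : ℝ) * η) ^ ρ := Real.rpow_pos_of_pos (by positivity) _
  have hsub : μ {x | η < |(X T t).avg A x - (S ((t : ℝ) / T) t).avg A x|} ≤
      μ {x | ENNReal.ofReal (((T : ℝ) * η) ^ ρ) ≤ ENNReal.ofReal (p x ^ ρ)} := by
    refine measure_mono_ae ?_
    filter_upwards [hPa] with x hx hx2
    have h1 : |(X T t).avg A x - (S ((t : ℝ) / T) t).avg A x| ≤
        ‖(X T t).elem x - (S ((t : ℝ) / T) t).elem x‖ := by
      have := ((X T t).quot (S ((t : ℝ) / T) t) 1).abs_avg_le A x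
      simpa [RandomL2.avg_quot, RandomL2.elem_quot] using this
    -- At `u = t/T` the distance `|t/T - u|` vanishes and only the factor `1/T` remains in the
    -- approximation bound.
    have h2 : η < 1 / T * p x := by
      have : η < |(X T t).avg A x - (S ((t : ℝ) / T) t).avg A x| := hx2
      have h3 := this.trans_le (h1.trans hx)
      simpa using h3
    have h3 : (T : ℝ) * η ≤ p x := by
      rw [one_div, inv_mul_eq_div, lt_div_iff₀ hT0'] at h2
      linarith
    show ENNReal.ofReal _ ≤ ENNReal.ofReal _
    gcongr
  -- Markov's inequality is applied to `p ^ ρ`, since `ρ` may be small and no other moment of `p` is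
  -- available.
  have hmark := mul_meas_ge_le_lintegral₀ (μ := μ)
    (f := fun x => ENNReal.ofReal (p x ^ ρ)) (hPm.pow_const ρ).ennreal_ofReal.aemeasurable
    (ENNReal.ofReal (((T : ℝ) * η) ^ ρ))
  have h5 : ENNReal.ofReal (((T : ℝ) * η) ^ ρ) *
      μ {x | η < |(X T t).avg A x - (S ((t : ℝ) / T) t).avg A x|} ≤ C :=
    (mul_le_mul_right hsub _).trans (hmark.trans hPC)
  rw [le_div_iff₀ hpos, mul_comm]
  have h6 := ENNReal.toReal_mono ENNReal.coe_ne_top h5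
  rwa [ENNReal.toReal_mul, ENNReal.toReal_ofReal hpos.le, ENNReal.coe_toReal] at h6

/-- With `y = x - s`, write `y² = xy - sy`. The mean of `xy` is `O(1/T)` by the cumulant condition
on the array, and `-sy` is bounded by `neg_mul_le_of_threshold`. Moving its `y²/2` to the left
doubles all other constants. -/
lemma integral_avg_array_sub_sq_le [IsProbabilityMeasure μ]
    (hX : CumulantMixing μ X S κ) (A : Set unitInterval)
    {η θ : ℝ} (hη : 0 < η) (hθ : 0 < θ) {T : ℕ} {t : ℤ} (ht : 1 ≤ t ∧ t ≤ T) :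
    ∫ x, ((X T t).avg A x - (S ((t : ℝ) / T) t).avg A x) ^ 2 ∂μ ≤
      2 * (1 / T * covBound κ 0) + η * (1 + covBound κ 0) +
        θ * (‖κ 3 ![0, 0, 0]‖ + 3 * covBound κ 0 ^ 2) / 2 +
        μ.real {x | η < |(X T t).avg A x - (S ((t : ℝ) / T) t).avg A x|} / (2 * θ) := by
  have hu := div_mem_Icc ht
  set s := (S ((t : ℝ) / T) t) with hs
  have mx := (hX.centered T t ht.1 ht.2).hasMoments
  have ms : HasMoments μ s := (hX.centered_approx _ hu t).hasMoments
  have my := mx.quot ms 1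
  have hy : ∀ x, ((X T t).quot s 1).avg A x = (X T t).avg A x - s.avg A x := fun x => by
    rw [RandomL2.avg_quot, div_one]
  have h1 := (le_abs_self _).trans (hX.abs_cov_array_le ht ht A A)
  rw [← hs, sub_self] at h1
  have h2 := hX.integral_avg_sq_le hu t A
  have h4 := hX.integral_avg_pow_four_le hu t A
  rw [← hs] at h2 h4
  have iy := mx.integrable_avg_sub_sq ms A
  have ixy := mx.integrable_avg_mul my A A
  simp only [hy] at ixy
  have hmeas : MeasurableSet {x | η < |(X T t).avg A x - s.avg A x|} :=
    measurableSet_lt measurable_const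
      (((X T t).measurable_avg A).sub (s.measurable_avg A)).abs
  set E := {x | η < |(X T t).avg A x - s.avg A x|} with hE
  have iE : Integrable (E.indicator (fun _ => (1 : ℝ))) μ :=
    (integrable_const 1).indicator hmeas
  have is1 : Integrable (fun x => η * (1 + s.avg A x ^ 2) / 2) μ :=
    (((integrable_const 1).add (ms.integrable_avg_sq A)).const_mul η).div_const 2
  have is4 : Integrable (fun x => θ * s.avg A x ^ 4 / 4) μ :=
    ((ms.integrable_avg_pow_four A).const_mul θ).div_const 4
  have key : ∫ x, ((X T t).avg A x - s.avg A x) ^ 2 ∂μ ≤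
      ∫ x, ((X T t).avg A x * ((X T t).avg A x - s.avg A x) + η * (1 + s.avg A x ^ 2) / 2 +
        ((X T t).avg A x - s.avg A x) ^ 2 / 2 + θ * s.avg A x ^ 4 / 4 +
        E.indicator (fun _ => (1 : ℝ)) x / (4 * θ)) ∂μ := by
    refine integral_mono iy ((((ixy.add is1).add (iy.div_const 2)).add is4).add
      (iE.div_const _)) fun x => ?_
    have := neg_mul_le_of_threshold (s.avg A x) ((X T t).avg A x - s.avg A x) hη hθ
    have e : E.indicator (fun _ => (1 : ℝ)) x =
        if η < |(X T t).avg A x - s.avg A x| then 1 else 0 := by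
      rw [hE, Set.indicator_apply]
      rfl
    simp only [e]
    nlinarith
  rw [integral_add (f := fun x => (X T t).avg A x * ((X T t).avg A x - s.avg A x) +
      η * (1 + s.avg A x ^ 2) / 2 + ((X T t).avg A x - s.avg A x) ^ 2 / 2 + θ * s.avg A x ^ 4 / 4)
      (((ixy.add is1).add (iy.div_const 2)).add is4) (iE.div_const _),
    integral_add (f := fun x => (X T t).avg A x * ((X T t).avg A x - s.avg A x) +
      η * (1 + s.avg A x ^ 2) / 2 + ((X T t).avg A x - s.avg A x) ^ 2 / 2)
      ((ixy.add is1).add (iy.div_const 2)) is4,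
    integral_add (f := fun x => (X T t).avg A x * ((X T t).avg A x - s.avg A x) +
      η * (1 + s.avg A x ^ 2) / 2) (ixy.add is1) (iy.div_const 2),
    integral_add ixy is1, integral_div, integral_const_mul, integral_div, integral_div,
    integral_const_mul, integral_div, integral_add (integrable_const 1) (ms.integrable_avg_sq A),
    integral_indicator_const _ hmeas] at key
  simp only [integral_const, probReal_univ, smul_eq_mul, mul_one] at key
  have hη2 : η * (1 + ∫ x, s.avg A x ^ 2 ∂μ) ≤ η * (1 + covBound κ 0) := by gcongr
  have hθ2 : θ * (∫ x, s.avg A x ^ 4 ∂μ) ≤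
      θ * (‖κ 3 ![0, 0, 0]‖ + 3 * covBound κ 0 ^ 2) := by gcongr
  have hE2 : μ.real E / (2 * θ) = 2 * (μ.real E / (4 * θ)) := by field_simp; ring
  rw [hE2]
  linarith

lemma eventually_integral_avg_array_sub_sq_le [IsProbabilityMeasure μ]
    (hX : CumulantMixing μ X S κ)
    (A : Set unitInterval) {ε : ℝ} (hε : 0 < ε) : ∀ᶠ T : ℕ in atTop, ∀ t : ℤ, 1 ≤ t ∧ t ≤ T →
      ∫ x, ((X T t).avg A x - (S ((t : ℝ) / T) t).avg A x) ^ 2 ∂μ ≤ ε := by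
  have h0 : 0 ≤ covBound κ 0 := covBound_nonneg 0
  set M := ‖κ 3 ![0, 0, 0]‖ + 3 * covBound κ 0 ^ 2 with hM
  have hM0 : 0 ≤ M := by positivity
  -- `η` and `θ` make their two terms at most `ε/4` each. Once they are fixed, large `T` brings the
  -- cumulant term and the probability term below `ε/4` each.
  set η := ε / 4 / (1 + covBound κ 0) with hη
  set θ := ε / 2 / (1 + M) with hθ
  have hη0 : 0 < η := by positivity
  have hθ0 : 0 < θ := by positivity
  have hlim : Tendsto (fun T : ℕ => 2 * (1 / (T : ℝ) * covBound κ 0)) atTop (𝓝 0) := by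
    have := (tendsto_one_div_atTop_nhds_zero_nat (𝕜 := ℝ)).mul_const (covBound κ 0)
    simpa using this.const_mul 2
  filter_upwards [hX.eventually_measure_avg_sub_le A hη0 (ε := ε / 4 * (2 * θ)) (by positivity),
    hlim.eventually (ge_mem_nhds (show (0 : ℝ) < ε / 4 by positivity))] with T h1 h2 t ht
  refine (hX.integral_avg_array_sub_sq_le A hη0 hθ0 ht).trans ?_
  have h3 : η * (1 + covBound κ 0) = ε / 4 := by rw [hη]; field_simp
  have h4 : θ * M / 2 ≤ ε / 4 := by
    rw [hθ, div_mul_eq_mul_div, div_div, div_le_iff₀ (by positivity)]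
    nlinarith
  have h5 := div_le_div_of_nonneg_right (h1 t ht) (show 0 ≤ 2 * θ by positivity)
  rw [mul_div_assoc, div_self (by positivity), mul_one] at h5
  linarith

/-- Pass through the approximation at `t/T`: the array is close to it for large `T`, and moving from
`t/T` to `u` costs a multiple of `|t/T - u|`. -/
lemma eventually_integral_avg_array_sub_approx_sq_le [IsProbabilityMeasure μ]
    (hX : CumulantMixing μ X S κ)
    (A : Set unitInterval) {ε : ℝ} (hε : 0 < ε) : ∃ δ > 0, ∀ᶠ T : ℕ in atTop, ∀ t : ℤ,
      1 ≤ t ∧ t ≤ T → ∀ u ∈ Set.Icc (0 : ℝ) 1, |(t : ℝ) / T - u| ≤ δ →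
        ∫ x, ((X T t).avg A x - (S u t).avg A x) ^ 2 ∂μ ≤ ε := by
  have h0 : 0 ≤ covBound κ 0 := covBound_nonneg 0
  refine ⟨ε / 8 / (1 + covBound κ 0), by positivity, ?_⟩
  filter_upwards [hX.eventually_integral_avg_array_sub_sq_le A (ε := ε / 4) (by positivity)] with
    T hT t ht u hu htu
  have h1 := hT t ht
  have h2 := hX.integral_avg_sub_sq_le (div_mem_Icc ht) hu t A
  have mx := (hX.centered T t ht.1 ht.2).hasMoments
  have ms := (hX.centered_approx _ (div_mem_Icc ht) t).hasMoments
  have mu := (hX.centered_approx _ hu t).hasMoments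
  have h3 : ∫ x, ((X T t).avg A x - (S u t).avg A x) ^ 2 ∂μ ≤
      ∫ x, (2 * ((X T t).avg A x - (S ((t : ℝ) / T) t).avg A x) ^ 2 +
        2 * ((S ((t : ℝ) / T) t).avg A x - (S u t).avg A x) ^ 2) ∂μ := by
    refine integral_mono (mx.integrable_avg_sub_sq mu A)
      (((mx.integrable_avg_sub_sq ms A).const_mul 2).add
        ((ms.integrable_avg_sub_sq mu A).const_mul 2)) fun x => ?_
    simp only
    nlinarith [sq_nonneg (((X T t).avg A x - (S ((t : ℝ) / T) t).avg A x) -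
      ((S ((t : ℝ) / T) t).avg A x - (S u t).avg A x))]
  rw [integral_add ((mx.integrable_avg_sub_sq ms A).const_mul 2)
    ((ms.integrable_avg_sub_sq mu A).const_mul 2), integral_const_mul, integral_const_mul] at h3
  have h4 : |(t : ℝ) / T - u| * covBound κ 0 ≤ ε / 8 := by
    have := mul_le_mul_of_nonneg_right htu h0
    refine this.trans ?_
    rw [div_mul_eq_mul_div, div_le_iff₀ (by positivity)]
    nlinarith
  linarith

lemma exists_integral_avg_array_sq_le [IsProbabilityMeasure μ]
    (hX : CumulantMixing μ X S κ) (A : Set unitInterval) :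
    ∀ᶠ T : ℕ in atTop, ∀ t : ℤ, 1 ≤ t ∧ t ≤ T →
      ∫ x, (X T t).avg A x ^ 2 ∂μ ≤ 2 + 2 * covBound κ 0 := by
  filter_upwards [hX.eventually_integral_avg_array_sub_sq_le A one_pos] with T hT t ht
  have h1 := hT t ht
  have h2 := hX.integral_avg_sq_le (div_mem_Icc ht) t A
  have mx := (hX.centered T t ht.1 ht.2).hasMoments
  have ms := (hX.centered_approx _ (div_mem_Icc ht) t).hasMoments
  have h3 : ∫ x, (X T t).avg A x ^ 2 ∂μ ≤
      ∫ x, (2 * ((X T t).avg A x - (S ((t : ℝ) / T) t).avg A x) ^ 2 +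
        2 * (S ((t : ℝ) / T) t).avg A x ^ 2) ∂μ := by
    refine integral_mono (mx.integrable_avg_sq A)
      (((mx.integrable_avg_sub_sq ms A).const_mul 2).add
        ((ms.integrable_avg_sq A).const_mul 2)) fun x => ?_
    simp only
    nlinarith [sq_nonneg (((X T t).avg A x - (S ((t : ℝ) / T) t).avg A x) -
      (S ((t : ℝ) / T) t).avg A x)]
  rw [integral_add ((mx.integrable_avg_sub_sq ms A).const_mul 2)
    ((ms.integrable_avg_sq A).const_mul 2), integral_const_mul, integral_const_mul] at h3
  linarith

end CumulantMixing

lemma integral_abs_mul_le_of_sq {f g : Ω → ℝ} (hf : Integrable (fun x => f x ^ 2) μ)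
    (hg : Integrable (fun x => g x ^ 2) μ) {M : ℝ} (h1 : ∫ x, f x ^ 2 ∂μ ≤ M)
    (h2 : ∫ x, g x ^ 2 ∂μ ≤ M) : ∫ x, |f x * g x| ∂μ ≤ M := by
  have : ∫ x, |f x * g x| ∂μ ≤ ∫ x, (f x ^ 2 / 2 + g x ^ 2 / 2) ∂μ := by
    refine integral_mono_of_nonneg (ae_of_all _ fun _ => abs_nonneg _)
      ((hf.div_const 2).add (hg.div_const 2)) (ae_of_all _ fun x => ?_)
    simp only
    rw [abs_mul]
    nlinarith [sq_nonneg (|f x| - |g x|), sq_abs (f x), sq_abs (g x)]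
  rw [integral_add (hf.div_const 2) (hg.div_const 2), integral_div, integral_div] at this
  linarith

/-- Expand `ab - cd = (a - c)(b - d) + (a - c)d + (b - d)c` and apply Young's inequality with weight
`l`. A small `l` makes the bounded terms `c²`, `d²` harmless, and the large constant `1/l` falls on
differences that are later made small. -/
lemma abs_mul_sub_mul_le (a b c d : ℝ) {l : ℝ} (hl : 0 < l) :
    |a * b - c * d| ≤ (1 + 1 / l) / 2 * (a - c) ^ 2 + (1 + 1 / l) / 2 * (b - d) ^ 2 +
      l / 2 * c ^ 2 + l / 2 * d ^ 2 := by
  have key : ∀ p q : ℝ, |p * q| ≤ 1 / l / 2 * p ^ 2 + l / 2 * q ^ 2 := fun p q => by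
    rw [abs_mul]
    have h : 0 ≤ (|p| - l * |q|) ^ 2 / (2 * l) := by positivity
    have e : (|p| - l * |q|) ^ 2 / (2 * l) =
        1 / l / 2 * |p| ^ 2 + l / 2 * |q| ^ 2 - |p| * |q| := by
      field_simp
      ring
    rw [e, sq_abs, sq_abs] at h
    linarith
  have h1 := key (a - c) d
  have h2 := key (b - d) c
  have h3 : |(a - c) * (b - d)| ≤ (a - c) ^ 2 / 2 + (b - d) ^ 2 / 2 := by
    rw [abs_mul]
    nlinarith [sq_nonneg (|a - c| - |b - d|), sq_abs (a - c), sq_abs (b - d)]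
  have e : a * b - c * d = (a - c) * (b - d) + (a - c) * d + (b - d) * c := by ring
  rw [e]
  refine (abs_add_three _ _ _).trans ?_
  linarith

namespace CumulantMixing

lemma eventually_integral_abs_avg_mul_sub_le [IsProbabilityMeasure μ]
    (hX : CumulantMixing μ X S κ)
    (A A' : Set unitInterval) {ε : ℝ} (hε : 0 < ε) : ∃ δ > 0, ∀ᶠ T : ℕ in atTop, ∀ s t : ℤ,
      1 ≤ s ∧ s ≤ T → 1 ≤ t ∧ t ≤ T → ∀ u ∈ Set.Icc (0 : ℝ) 1,
      |(s : ℝ) / T - u| ≤ δ → |(t : ℝ) / T - u| ≤ δ →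
        ∫ x, |(X T s).avg A x * (X T t).avg A' x - (S u s).avg A x * (S u t).avg A' x| ∂μ ≤ ε := by
  have h0 : 0 ≤ covBound κ 0 := covBound_nonneg 0
  set l := ε / 2 / (1 + covBound κ 0) with hl
  have hl0 : 0 < l := by positivity
  set ε' := ε / 2 / (1 + 1 / l) with hε'
  have hε'0 : 0 < ε' := by positivity
  obtain ⟨δ₁, hδ₁, H₁⟩ := hX.eventually_integral_avg_array_sub_approx_sq_le A hε'0
  obtain ⟨δ₂, hδ₂, H₂⟩ := hX.eventually_integral_avg_array_sub_approx_sq_le A' hε'0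
  refine ⟨min δ₁ δ₂, lt_min hδ₁ hδ₂, ?_⟩
  filter_upwards [H₁, H₂] with T h1 h2 s t hs ht u hu hsu htu
  have g1 := h1 s hs u hu (hsu.trans (min_le_left _ _))
  have g2 := h2 t ht u hu (htu.trans (min_le_right _ _))
  have g3 := hX.integral_avg_sq_le hu s A
  have g4 := hX.integral_avg_sq_le hu t A'
  have i1 := ((hX.centered T s hs.1 hs.2).hasMoments.integrable_avg_sub_sq
    (hX.centered_approx _ hu s).hasMoments A).const_mul ((1 + 1 / l) / 2)
  have i2 := ((hX.centered T t ht.1 ht.2).hasMoments.integrable_avg_sub_sq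
    (hX.centered_approx _ hu t).hasMoments A').const_mul ((1 + 1 / l) / 2)
  have i3 := ((hX.centered_approx _ hu s).hasMoments.integrable_avg_sq A).const_mul (l / 2)
  have i4 := ((hX.centered_approx _ hu t).hasMoments.integrable_avg_sq A').const_mul (l / 2)
  have h3 := integral_mono_of_nonneg (ae_of_all _ fun _ => abs_nonneg _)
    (((i1.add i2).add i3).add i4) (ae_of_all _ fun x => abs_mul_sub_mul_le
      ((X T s).avg A x) ((X T t).avg A' x) ((S u s).avg A x) ((S u t).avg A' x) hl0)
  refine h3.trans ?_
  rw [integral_add' ((i1.add i2).add i3) i4, integral_add' (i1.add i2) i3, integral_add' i1 i2,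
    integral_const_mul, integral_const_mul, integral_const_mul, integral_const_mul]
  have k1 : (1 + 1 / l) * ε' = ε / 2 := by rw [hε']; field_simp
  have k2 : l * covBound κ 0 ≤ ε / 2 := by
    rw [hl, div_mul_eq_mul_div, div_le_iff₀ (by positivity)]
    nlinarith
  have k3 : (1 + 1 / l) / 2 * ∫ x, ((X T s).avg A x - (S u s).avg A x) ^ 2 ∂μ ≤
      (1 + 1 / l) / 2 * ε' := by gcongr
  have k4 : (1 + 1 / l) / 2 * ∫ x, ((X T t).avg A' x - (S u t).avg A' x) ^ 2 ∂μ ≤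
      (1 + 1 / l) / 2 * ε' := by gcongr
  have k5 : l / 2 * ∫ x, (S u s).avg A x ^ 2 ∂μ ≤ l / 2 * covBound κ 0 := by gcongr
  have k6 : l / 2 * ∫ x, (S u t).avg A' x ^ 2 ∂μ ≤ l / 2 * covBound κ 0 := by gcongr
  linarith

lemma eventually_integral_abs_avg_mul_le [IsProbabilityMeasure μ]
    (hX : CumulantMixing μ X S κ)
    (A A' : Set unitInterval) : ∀ᶠ T : ℕ in atTop, ∀ s t : ℤ, 1 ≤ s ∧ s ≤ T → 1 ≤ t ∧ t ≤ T →
      ∫ x, |(X T s).avg A x * (X T t).avg A' x| ∂μ ≤ 2 + 2 * covBound κ 0 := by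
  filter_upwards [hX.exists_integral_avg_array_sq_le A, hX.exists_integral_avg_array_sq_le A'] with
    T h1 h2 s t hs ht
  exact integral_abs_mul_le_of_sq ((hX.centered T s hs.1 hs.2).hasMoments.integrable_avg_sq A)
    ((hX.centered T t ht.1 ht.2).hasMoments.integrable_avg_sq A') (h1 s hs) (h2 t ht)

end CumulantMixing

end FunctionalTimeSeries

end

noncomputable section

namespace FunctionalTimeSeries

/-! ### Sine tapers -/

/-- The `k`-th sinusoidal taper of length `n`, in the local coordinate of its block. -/
def localTaper (n k : ℕ) (j : ℤ) : ℝ :=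
  Real.sqrt (2 / ((n : ℝ) + 1)) * Real.sin (Real.pi * k * j / ((n : ℝ) + 1))

lemma sineTaper_eq (n b k : ℕ) (t : ℤ) :
    sineTaper n b k t = localTaper n k (t - ((b : ℤ) - 1) * n) := by
  unfold sineTaper localTaper
  push_cast
  rfl

lemma abs_localTaper_le (n k : ℕ) (j : ℤ) : |localTaper n k j| ≤ Real.sqrt (2 / ((n : ℝ) + 1)) := by
  unfold localTaper
  rw [abs_mul, abs_of_nonneg (Real.sqrt_nonneg _)]
  exact mul_le_of_le_one_right (Real.sqrt_nonneg _) (Real.abs_sin_le_one _)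

lemma abs_localTaper_mul_le (n k l : ℕ) (i j : ℤ) :
    |localTaper n k i * localTaper n l j| ≤ 2 / ((n : ℝ) + 1) := by
  rw [abs_mul]
  have := mul_le_mul (abs_localTaper_le n k i) (abs_localTaper_le n l j) (abs_nonneg _)
    (Real.sqrt_nonneg _)
  rwa [Real.mul_self_sqrt (by positivity)] at this

lemma abs_sin_sub_sin_le (x y : ℝ) : |Real.sin x - Real.sin y| ≤ |x - y| := by
  rw [Real.sin_sub_sin, abs_mul, abs_mul, abs_two]
  have h1 := Real.abs_sin_le_abs (x := (x - y) / 2)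
  have h2 := Real.abs_cos_le_one ((x + y) / 2)
  rw [abs_div, abs_two] at h1
  nlinarith [abs_nonneg (Real.sin ((x - y) / 2)), abs_nonneg (Real.cos ((x + y) / 2))]

lemma abs_localTaper_sub_le (n k : ℕ) (j h : ℤ) :
    |localTaper n k (j + h) - localTaper n k j| ≤
      Real.sqrt (2 / ((n : ℝ) + 1)) * (Real.pi * k * |(h : ℝ)| / ((n : ℝ) + 1)) := by
  unfold localTaper
  rw [← mul_sub, abs_mul, abs_of_nonneg (Real.sqrt_nonneg _)]
  gcongr
  refine (abs_sin_sub_sin_le _ _).trans (le_of_eq ?_)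
  rw [← sub_div, abs_div, abs_of_pos (show (0 : ℝ) < (n : ℝ) + 1 by positivity)]
  congr 1
  push_cast
  rw [show Real.pi * k * ((j : ℝ) + h) - Real.pi * k * j = Real.pi * k * h by ring, abs_mul,
    abs_of_nonneg (show 0 ≤ Real.pi * k by positivity)]

/-- The sum telescopes: `2 sin θ cos(2θm) = sin((2m + 1)θ) - sin((2m - 1)θ)`. -/
lemma two_mul_sin_mul_sum_cos (θ : ℝ) (n : ℕ) :
    2 * Real.sin θ * ∑ j ∈ Finset.range n, Real.cos (2 * θ * ((j : ℝ) + 1)) =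
      Real.sin ((2 * n + 1) * θ) - Real.sin θ := by
  induction n with
  | zero => simp
  | succ m ih =>
    rw [Finset.sum_range_succ, mul_add, ih]
    have e1 : (2 * ((m + 1 : ℕ) : ℝ) + 1) * θ = 2 * θ * ((m : ℝ) + 1) + θ := by push_cast; ring
    have e2 : (2 * (m : ℝ) + 1) * θ = 2 * θ * ((m : ℝ) + 1) - θ := by ring
    rw [e1, e2, Real.sin_add, Real.sin_sub]
    ring

/-- Half-angle formula: with `θ = πk/(n + 1)` one has `(2n + 1)θ = 2πk - θ`, so the cosines sum to
`-1` and the total is `(n + 1)/(n + 1)`. The range `1 ≤ k ≤ n` places `θ` in `(0, π)`, where `sin θ`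
may be cancelled. -/
lemma sum_localTaper_sq {n k : ℕ} (hk : 1 ≤ k) (hkn : k ≤ n) :
    ∑ j ∈ Finset.range n, localTaper n k ((j : ℤ) + 1) ^ 2 = 1 := by
  set θ := Real.pi * k / ((n : ℝ) + 1) with hθ
  have hn : (0 : ℝ) < (n : ℝ) + 1 := by positivity
  have hk' : (1 : ℝ) ≤ k := by exact_mod_cast hk
  have hkn' : (k : ℝ) ≤ n := by exact_mod_cast hkn
  have hsin : 0 < Real.sin θ := by
    apply Real.sin_pos_of_pos_of_lt_pi
    · positivity
    · rw [hθ, div_lt_iff₀ hn]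
      nlinarith [Real.pi_pos]
  have hterm : ∀ j : ℕ, localTaper n k ((j : ℤ) + 1) ^ 2 =
      1 / ((n : ℝ) + 1) * (1 - Real.cos (2 * θ * ((j : ℝ) + 1))) := fun j => by
    unfold localTaper
    rw [mul_pow, Real.sq_sqrt (by positivity)]
    have e : Real.pi * k * (((j : ℤ) + 1 : ℤ) : ℝ) / ((n : ℝ) + 1) = θ * ((j : ℝ) + 1) := by
      rw [hθ]
      push_cast
      ring
    rw [e, show 2 * θ * ((j : ℝ) + 1) = 2 * (θ * ((j : ℝ) + 1)) by ring, Real.cos_two_mul,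
      Real.cos_sq']
    ring
  simp_rw [hterm]
  rw [← Finset.mul_sum, Finset.sum_sub_distrib]
  have hs := two_mul_sin_mul_sum_cos θ n
  have e3 : (2 * (n : ℝ) + 1) * θ = (k : ℕ) * (2 * Real.pi) - θ := by
    rw [hθ]
    field_simp
    ring
  rw [e3, Real.sin_nat_mul_two_pi_sub] at hs
  have hc : ∑ j ∈ Finset.range n, Real.cos (2 * θ * ((j : ℝ) + 1)) = -1 := by
    have : 2 * Real.sin θ ≠ 0 := by positivity
    apply mul_left_cancel₀ this
    linarith
  rw [hc]
  simp only [Finset.sum_const, Finset.card_range, nsmul_eq_mul, mul_one, sub_neg_eq_add]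
  field_simp

/-! ### Blocks and weights -/

/-- The integer times of the `b`-th block of length `n`. -/
def block (n b : ℕ) : Finset ℤ := Finset.Ioc (((b : ℤ) - 1) * n) (b * n)

lemma card_block (n b : ℕ) : (block n b).card = n := by
  rw [block, Int.card_Ioc]
  have : (b : ℤ) * n - ((b : ℤ) - 1) * n = n := by ring
  rw [this]
  simp

lemma block_subset {n b B : ℕ} (hb : b ∈ Finset.Icc 1 B) :
    block n b ⊆ Finset.Icc (1 : ℤ) ((B * n : ℕ) : ℤ) := by
  intro t ht
  rw [block, Finset.mem_Ioc] at ht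
  rw [Finset.mem_Icc] at hb ⊢
  have h1 : (1 : ℤ) ≤ b := by exact_mod_cast hb.1
  have h2 : (b : ℤ) ≤ B := by exact_mod_cast hb.2
  have hn : (0 : ℤ) ≤ n := by positivity
  push_cast
  constructor
  · nlinarith [mul_nonneg (sub_nonneg.2 h1) hn]
  · nlinarith [mul_nonneg (sub_nonneg.2 h2) hn]

lemma blockIndicator_div {n b B : ℕ} (hB : 0 < B) (hn : 0 < n) (t : ℤ) :
    blockIndicator B b ((t : ℝ) / ((B * n : ℕ) : ℝ)) = if t ∈ block n b then 1 else 0 := by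
  unfold blockIndicator block
  have hB' : (0 : ℝ) < B := by exact_mod_cast hB
  have hn' : (0 : ℝ) < n := by exact_mod_cast hn
  have e1 : ((b : ℝ) - 1) / B < (t : ℝ) / ((B * n : ℕ) : ℝ) ↔ ((b : ℤ) - 1) * n < t := by
    push_cast
    rw [div_lt_div_iff₀ hB' (by positivity)]
    have : ((b : ℝ) - 1) * (B * n) < t * B ↔ ((b : ℝ) - 1) * n < t := by
      rw [show ((b : ℝ) - 1) * (B * n) = ((b : ℝ) - 1) * n * B by ring]
      exact mul_lt_mul_iff_left₀ hB'
    rw [this]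
    exact_mod_cast Iff.rfl
  have e2 : (t : ℝ) / ((B * n : ℕ) : ℝ) ≤ (b : ℝ) / B ↔ t ≤ (b : ℤ) * n := by
    push_cast
    rw [div_le_div_iff₀ (by positivity) hB']
    have : (t : ℝ) * B ≤ b * (B * n) ↔ (t : ℝ) ≤ b * n := by
      rw [show (b : ℝ) * (B * n) = b * n * B by ring]
      exact mul_le_mul_iff_left₀ hB'
    rw [this]
    exact_mod_cast Iff.rfl
  simp only [e1, e2, Finset.mem_Ioc]

/-- The weight of the pair of times `(s, t)` in the estimator of the `b`-th block. -/
def pairWeight (T B K b : ℕ) (s t : ℤ) : ℝ :=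
  1 / (K : ℝ) * ∑ k ∈ Finset.Icc 1 K,
    (sineTaper (T / B) b k s * blockIndicator B b ((s : ℝ) / T)) *
      (sineTaper (T / B) b k t * blockIndicator B b ((t : ℝ) / T))

section Weights

variable {n b B K : ℕ}

lemma pairWeight_eq (hB : 0 < B) (hn : 0 < n) (s t : ℤ) :
    pairWeight (B * n) B K b s t = if s ∈ block n b ∧ t ∈ block n b then
      1 / (K : ℝ) * ∑ k ∈ Finset.Icc 1 K, localTaper n k (s - ((b : ℤ) - 1) * n) *
        localTaper n k (t - ((b : ℤ) - 1) * n) else 0 := by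
  unfold pairWeight
  rw [Nat.mul_div_cancel_left _ hB, blockIndicator_div hB hn, blockIndicator_div hB hn]
  simp_rw [sineTaper_eq]
  by_cases h1 : s ∈ block n b <;> by_cases h2 : t ∈ block n b <;> simp [h1, h2]

lemma abs_average_le {K : ℕ} {f : ℕ → ℝ} {c : ℝ} (hc : 0 ≤ c)
    (hf : ∀ k ∈ Finset.Icc 1 K, |f k| ≤ c) :
    |1 / (K : ℝ) * ∑ k ∈ Finset.Icc 1 K, f k| ≤ c := by
  rcases Nat.eq_zero_or_pos K with rfl | hK
  · simpa using hc
  have hK' : (0 : ℝ) < K := by exact_mod_cast hK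
  rw [abs_mul, abs_of_pos (by positivity), one_div, inv_mul_le_iff₀ hK']
  refine (Finset.abs_sum_le_sum_abs _ _).trans ((Finset.sum_le_sum hf).trans ?_)
  simp

lemma abs_pairWeight_le (hB : 0 < B) (hn : 0 < n) (s t : ℤ) :
    |pairWeight (B * n) B K b s t| ≤ 2 / ((n : ℝ) + 1) := by
  rw [pairWeight_eq hB hn]
  split_ifs
  · exact abs_average_le (by positivity) fun k _ => abs_localTaper_mul_le _ _ _ _ _
  · rw [abs_zero]
    positivity

lemma pairWeight_eq_zero_left (hB : 0 < B) (hn : 0 < n) {s : ℤ} (t : ℤ) (hs : s ∉ block n b) :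
    pairWeight (B * n) B K b s t = 0 := by
  rw [pairWeight_eq hB hn, if_neg fun h => hs h.1]

lemma pairWeight_eq_zero_right (hB : 0 < B) (hn : 0 < n) (s : ℤ) {t : ℤ} (ht : t ∉ block n b) :
    pairWeight (B * n) B K b s t = 0 := by
  rw [pairWeight_eq hB hn, if_neg fun h => ht h.2]

lemma sum_block_localTaper_sq {k : ℕ} (hk : 1 ≤ k) (hkn : k ≤ n) :
    ∑ t ∈ block n b, localTaper n k (t - ((b : ℤ) - 1) * n) ^ 2 = 1 := by
  rw [← sum_localTaper_sq hk hkn]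
  symm
  refine Finset.sum_bij (fun (j : ℕ) _ => ((b : ℤ) - 1) * n + (j + 1)) ?_ ?_ ?_ ?_
  · intro j hj
    rw [Finset.mem_range] at hj
    rw [block, Finset.mem_Ioc]
    have : (b : ℤ) * n = ((b : ℤ) - 1) * n + n := by ring
    omega
  · intro i _ j _ h
    simpa using h
  · intro t ht
    rw [block, Finset.mem_Ioc] at ht
    have : (b : ℤ) * n = ((b : ℤ) - 1) * n + n := by ring
    refine ⟨(t - ((b : ℤ) - 1) * n - 1).toNat, ?_, ?_⟩
    · rw [Finset.mem_range]
      omega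
    · omega
  · intro j _
    congr 2
    ring

lemma card_block_filter_le (h : ℤ) :
    (((block n b).filter fun t => t + h ∉ block n b).card : ℝ) ≤ 2 * |(h : ℝ)| := by
  have hsub : (block n b).filter (fun t => t + h ∉ block n b) ⊆
      Finset.Ioc (((b : ℤ) - 1) * n) (((b : ℤ) - 1) * n + |h|) ∪
        Finset.Ioc ((b : ℤ) * n - |h|) (b * n) := by
    intro t ht
    simp only [block, Finset.mem_filter, Finset.mem_Ioc, Finset.mem_union, not_and_or, not_lt,
      not_le] at ht ⊢
    have := neg_abs_le h
    have := le_abs_self h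
    omega
  have hc := (Finset.card_le_card hsub).trans (Finset.card_union_le _ _)
  rw [Int.card_Ioc, Int.card_Ioc] at hc
  have h2 : ((((b : ℤ) - 1) * n + |h| - ((b : ℤ) - 1) * n).toNat +
      ((b : ℤ) * n - ((b : ℤ) * n - |h|)).toNat : ℤ) = 2 * |h| := by
    rw [show ((b : ℤ) - 1) * n + |h| - ((b : ℤ) - 1) * n = |h| by ring,
      show (b : ℤ) * n - ((b : ℤ) * n - |h|) = |h| by ring, Int.toNat_of_nonneg (abs_nonneg h)]
    ring
  have h3 : (((block n b).filter fun t => t + h ∉ block n b).card : ℤ) ≤ 2 * |h| := by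
    rw [← h2]
    exact_mod_cast hc
  exact_mod_cast h3

/-- Compare with the unit energy `∑ v(t)² = 1`. Replacing `v(t + h)` by `v(t)` costs the Lipschitz
bound of the sine, which gives the `2πk`; the at most `2|h|` times that the shift moves out of the
block cost `2/(n + 1)` each, which gives the `4`. -/
lemma abs_sum_localTaper_shift_sub_one_le {k : ℕ} (hk : 1 ≤ k) (hkn : k ≤ n) (h : ℤ) :
    |∑ t ∈ block n b, (if t + h ∈ block n b then localTaper n k (t + h - ((b : ℤ) - 1) * n) *
      localTaper n k (t - ((b : ℤ) - 1) * n) else 0) - 1| ≤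
      (4 + 2 * Real.pi * k) * |(h : ℝ)| / ((n : ℝ) + 1) := by
  set v : ℤ → ℝ := fun t => localTaper n k (t - ((b : ℤ) - 1) * n) with hv
  have e1 : ∑ t ∈ block n b, (if t + h ∈ block n b then v (t + h) * v t else 0) - 1 =
      ∑ t ∈ block n b, (if t + h ∈ block n b then (v (t + h) - v t) * v t else 0) -
      ∑ t ∈ (block n b).filter (fun t => t + h ∉ block n b), v t * v t := by
    rw [Finset.sum_filter, ← sum_block_localTaper_sq (b := b) hk hkn, ← Finset.sum_sub_distrib,
      ← Finset.sum_sub_distrib]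
    refine Finset.sum_congr rfl fun t _ => ?_
    by_cases ht : t + h ∈ block n b
    · simp only [ht, if_true, not_true_eq_false, if_false, hv]
      ring
    · simp only [ht, if_false, not_false_eq_true, if_true, hv]
      ring
  rw [e1]
  have hn : (0 : ℝ) < (n : ℝ) + 1 := by positivity
  have b1 : |∑ t ∈ block n b, (if t + h ∈ block n b then (v (t + h) - v t) * v t else 0)| ≤
      n * (2 / ((n : ℝ) + 1) * (Real.pi * k * |(h : ℝ)| / ((n : ℝ) + 1))) := by
    refine (Finset.abs_sum_le_sum_abs _ _).trans ?_
    refine (Finset.sum_le_card_nsmul _ _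
      (2 / ((n : ℝ) + 1) * (Real.pi * k * |(h : ℝ)| / ((n : ℝ) + 1))) fun t _ => ?_).trans ?_
    · split_ifs
      · rw [abs_mul, ← Real.mul_self_sqrt (show 0 ≤ 2 / ((n : ℝ) + 1) by positivity),
          mul_right_comm]
        have h1 := abs_localTaper_sub_le n k (t - ((b : ℤ) - 1) * n) h
        rw [show t - ((b : ℤ) - 1) * n + h = t + h - ((b : ℤ) - 1) * n by ring] at h1
        exact mul_le_mul h1 (abs_localTaper_le n k _) (abs_nonneg _) (by positivity)
      · rw [abs_zero]
        positivity
    · rw [card_block, nsmul_eq_mul]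
  have b2 : |∑ t ∈ (block n b).filter (fun t => t + h ∉ block n b), v t * v t| ≤
      2 * |(h : ℝ)| * (2 / ((n : ℝ) + 1)) := by
    refine (Finset.abs_sum_le_sum_abs _ _).trans ((Finset.sum_le_card_nsmul _ _
      (2 / ((n : ℝ) + 1)) fun t _ => abs_localTaper_mul_le n k k _ _).trans ?_)
    rw [nsmul_eq_mul]
    have := card_block_filter_le (n := n) (b := b) h
    gcongr
  refine (abs_sub _ _).trans ((add_le_add b1 b2).trans ?_)
  have b3 : (n : ℝ) * (2 / ((n : ℝ) + 1) * (Real.pi * k * |(h : ℝ)| / ((n : ℝ) + 1))) ≤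
      2 * (Real.pi * k * |(h : ℝ)| / ((n : ℝ) + 1)) := by
    have : (n : ℝ) * (2 / ((n : ℝ) + 1)) ≤ 2 := by
      rw [mul_div_assoc', div_le_iff₀ hn]
      linarith
    rw [← mul_assoc]
    gcongr
  refine (add_le_add b3 le_rfl).trans (le_of_eq ?_)
  field_simp
  ring

lemma sum_pairWeight_eq (hB : 0 < B) (hn : 0 < n) (h : ℤ) :
    ∑ t ∈ block n b, pairWeight (B * n) B K b (t + h) t = 1 / (K : ℝ) * ∑ k ∈ Finset.Icc 1 K,
      ∑ t ∈ block n b, (if t + h ∈ block n b then localTaper n k (t + h - ((b : ℤ) - 1) * n) *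
      localTaper n k (t - ((b : ℤ) - 1) * n) else 0) := by
  rw [Finset.sum_comm, Finset.mul_sum]
  refine Finset.sum_congr rfl fun t ht => ?_
  rw [pairWeight_eq hB hn]
  by_cases h1 : t + h ∈ block n b <;> simp [h1, ht]

lemma abs_sum_pairWeight_sub_one_le (hB : 0 < B) (hn : 0 < n) (hK : 0 < K) (hKn : K ≤ n) (h : ℤ) :
    |∑ t ∈ block n b, pairWeight (B * n) B K b (t + h) t - 1| ≤
      (4 + 2 * Real.pi * K) * |(h : ℝ)| / ((n : ℝ) + 1) := by
  have hK' : (K : ℝ) ≠ 0 := by positivity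
  have e : ∑ t ∈ block n b, pairWeight (B * n) B K b (t + h) t - 1 =
      1 / (K : ℝ) * ∑ k ∈ Finset.Icc 1 K, (∑ t ∈ block n b, (if t + h ∈ block n b then
        localTaper n k (t + h - ((b : ℤ) - 1) * n) *
          localTaper n k (t - ((b : ℤ) - 1) * n) else 0) - 1) := by
    rw [sum_pairWeight_eq hB hn, Finset.sum_sub_distrib, mul_sub]
    simp [hK']
  rw [e]
  refine abs_average_le (by positivity) fun k hk => ?_
  rw [Finset.mem_Icc] at hk
  refine (abs_sum_localTaper_shift_sub_one_le hk.1 (hk.2.trans hKn) h).trans ?_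
  have : (k : ℝ) ≤ K := by exact_mod_cast hk.2
  gcongr

end Weights

end FunctionalTimeSeries

end

noncomputable section

namespace FunctionalTimeSeries

/-! ### Local laws of large numbers -/

lemma integrable_sq_sum_mul {Ω : Type*} [MeasurableSpace Ω] {μ : Measure Ω} (J : Finset ℤ)
    (q : ℤ → ℝ) (D : ℤ → Ω → ℝ) (hD : ∀ s ∈ J, ∀ t ∈ J, Integrable (fun x => D s x * D t x) μ) :
    Integrable (fun x => (∑ t ∈ J, q t * D t x) ^ 2) μ ∧
    ∫ x, (∑ t ∈ J, q t * D t x) ^ 2 ∂μ =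
      ∑ s ∈ J, ∑ t ∈ J, q s * q t * ∫ x, D s x * D t x ∂μ := by
  have e : ∀ x, (∑ t ∈ J, q t * D t x) ^ 2 =
      ∑ s ∈ J, ∑ t ∈ J, q s * q t * (D s x * D t x) := fun x => by
    rw [sq, Finset.sum_mul_sum]
    exact Finset.sum_congr rfl fun s _ => Finset.sum_congr rfl fun t _ => by ring
  simp_rw [e]
  refine ⟨integrable_finsetSum _ fun s hs => integrable_finsetSum _ fun t ht =>
    (hD s hs t ht).const_mul _, ?_⟩
  rw [integral_finsetSum _ fun s hs => integrable_finsetSum _ fun t ht =>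
    (hD s hs t ht).const_mul _]
  refine Finset.sum_congr rfl fun s hs => ?_
  rw [integral_finsetSum _ fun t ht => (hD s hs t ht).const_mul _]
  exact Finset.sum_congr rfl fun t ht => integral_const_mul _ _

lemma sum_sum_le_of_summable {ψ : ℤ → ℝ} (hψ : Summable ψ) (hψ0 : ∀ r, 0 ≤ ψ r) (J : Finset ℤ) :
    ∑ s ∈ J, ∑ t ∈ J, ψ (s - t) ≤ J.card * ∑' r, ψ r := by
  rw [← nsmul_eq_mul]
  refine Finset.sum_le_card_nsmul _ _ _ fun s _ => ?_
  have h1 : Summable fun t => ψ (s - t) := (Equiv.subLeft s).summable_iff.2 hψ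
  refine (h1.sum_le_tsum J fun t _ => hψ0 _).trans (le_of_eq ?_)
  exact (Equiv.subLeft s).tsum_eq ψ

variable {Ω : Type*} [MeasurableSpace Ω] {μ : Measure Ω}
  {X : ℕ → ℤ → RandomL2 Ω} {S : ℝ → ℤ → RandomL2 Ω}
  {κ : (m : ℕ) → (Fin m → ℤ) → Lp ℝ 2 (volume : Measure (Fin (m + 1) → unitInterval))}

/-- The covariance at lag `h` of the averages over `A` and `A'`. -/
def avgCov (μ : Measure Ω) (S : ℝ → ℤ → RandomL2 Ω) (A A' : Set unitInterval) (u : ℝ) (h : ℤ) : ℝ :=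
  ∫ x, (S u h).avg A x * (S u 0).avg A' x ∂μ

lemma RandomL2.avg_eq_inner (V : RandomL2 Ω) {A : Set unitInterval} (hA : MeasurableSet A) (x : Ω) :
    V.avg A x = inner ℝ (indicatorConstLp 2 hA (measure_ne_top volume A) (1 : ℝ)) (V.elem x) := by
  rw [L2.inner_indicatorConstLp_one]
  refine setIntegral_congr_ae hA ?_
  filter_upwards [(V.memLp_val x).coeFn_toLp] with τ hτ _
  exact hτ.symm

namespace CumulantMixing

/-- An average over `A` is the inner product with an indicator, hence a Borel function of the `L²`
element, so invariance of the joint laws in `L²` applies. -/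
lemma integral_avg_mul_eq_avgCov (hX : CumulantMixing μ X S κ) {u : ℝ}
    (hu : u ∈ Set.Icc (0 : ℝ) 1) {A A' : Set unitInterval} (hA : MeasurableSet A)
    (hA' : MeasurableSet A') (t h : ℤ) :
    ∫ x, (S u (t + h)).avg A x * (S u t).avg A' x ∂μ = avgCov μ S A A' u h := by
  let _ : MeasurableSpace (Lp ℝ 2 (volume : Measure unitInterval)) := borel _
  have _ : BorelSpace (Lp ℝ 2 (volume : Measure unitInterval)) := ⟨rfl⟩
  have hst := hX.locallyStationary.stationary u hu 2 ![h, 0] t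
  set a := indicatorConstLp 2 hA (measure_ne_top volume A) (1 : ℝ)
  set a' := indicatorConstLp 2 hA' (measure_ne_top volume A') (1 : ℝ)
  have hg : Measurable (fun f : Fin 2 → Lp ℝ 2 (volume : Measure unitInterval) =>
      inner ℝ a (f 0) * inner ℝ a' (f 1)) := by
    have h1 : Measurable (fun f : Lp ℝ 2 (volume : Measure unitInterval) => inner ℝ a f) :=
      (continuous_const.inner continuous_id).measurable
    have h2 : Measurable (fun f : Lp ℝ 2 (volume : Measure unitInterval) => inner ℝ a' f) :=
      (continuous_const.inner continuous_id).measurable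
    exact (h1.comp (measurable_pi_apply 0)).mul (h2.comp (measurable_pi_apply 1))
  have h3 := (hst.comp hg).integral_eq
  simp only [Function.comp_def, Matrix.cons_val_zero, Matrix.cons_val_one] at h3
  unfold avgCov
  simp_rw [RandomL2.avg_eq_inner _ hA, RandomL2.avg_eq_inner _ hA']
  rw [zero_add, add_comm h t] at h3
  exact h3

lemma summable_norm (hX : CumulantMixing μ X S κ) {m : ℕ} (hm : 1 ≤ m) :
    Summable fun s : Fin m → ℤ => ‖κ m s‖ := by
  obtain ⟨ℓ, -, h⟩ := hX.summable m hm
  refine (h ⟨0, hm⟩).of_nonneg_of_le (fun s => norm_nonneg _) fun s => ?_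
  refine le_mul_of_one_le_left (norm_nonneg _) ?_
  have : 0 ≤ |(s ⟨0, hm⟩ : ℝ)| ^ ℓ := by positivity
  linarith

lemma summable_covBound (hX : CumulantMixing μ X S κ) : Summable (covBound κ) :=
  (hX.summable_norm le_rfl).comp_injective (i := fun h : ℤ => fun _ : Fin 1 => h)
    fun _ _ hab => congrFun hab 0

/-- A summable bound, in the lag `r`, on the covariances of lagged products. -/
def productBound
    (κ : (m : ℕ) → (Fin m → ℤ) → Lp ℝ 2 (volume : Measure (Fin (m + 1) → unitInterval)))
    (h r : ℤ) : ℝ :=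
  ‖κ 3 ![r + h, r, h]‖ + covBound κ r * covBound κ r + covBound κ (r + h) * covBound κ (r - h)

lemma productBound_nonneg (h r : ℤ) : 0 ≤ productBound κ h r := by
  unfold productBound
  have h1 := covBound_nonneg (κ := κ) r
  have h2 := covBound_nonneg (κ := κ) (r + h)
  have h3 := covBound_nonneg (κ := κ) (r - h)
  positivity

/-- The fourth order norms form a subfamily of a summable family, as `r ↦ (r + h, r, h)` is
injective. In the product terms one factor is summable and the other bounded. -/
lemma summable_productBound (hX : CumulantMixing μ X S κ) (h : ℤ) :
    Summable (productBound κ h) := by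
  have hc := hX.summable_covBound
  have hle : ∀ r, covBound κ r ≤ ∑' r, covBound κ r := fun r =>
    hc.le_tsum r fun j _ => covBound_nonneg j
  have hmul : ∀ f : ℤ → ℤ, Function.Injective f → ∀ g : ℤ → ℤ,
      Summable fun r => covBound κ (f r) * covBound κ (g r) := fun f hf g => by
    refine ((hc.comp_injective hf).mul_right (∑' r, covBound κ r)).of_nonneg_of_le
      (fun r => mul_nonneg (covBound_nonneg _) (covBound_nonneg _)) fun r => ?_
    exact mul_le_mul_of_nonneg_left (hle _) (covBound_nonneg _)
  refine (Summable.add ?_ (hmul id Function.injective_id id)).add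
    (hmul (fun r => r + h) (add_left_injective h) fun r => r - h)
  refine (hX.summable_norm (m := 3) (by norm_num)).comp_injective
    (i := fun r : ℤ => ![r + h, r, h]) fun _ _ hab => ?_
  simpa using congrFun hab 1

variable [IsProbabilityMeasure μ]

/-- By stationarity both lag-`h` products have mean `avgCov`, so this is the covariance bound
`abs_cov_mul_le` at the times `s + h, s, t + h, t`. -/
lemma abs_integral_centered_mul_le (hX : CumulantMixing μ X S κ) {u : ℝ}
    (hu : u ∈ Set.Icc (0 : ℝ) 1) {A A' : Set unitInterval} (hA : MeasurableSet A)
    (hA' : MeasurableSet A') (h s t : ℤ) :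
    Integrable (fun x => ((S u (s + h)).avg A x * (S u s).avg A' x - avgCov μ S A A' u h) *
      ((S u (t + h)).avg A x * (S u t).avg A' x - avgCov μ S A A' u h)) μ ∧
    |∫ x, ((S u (s + h)).avg A x * (S u s).avg A' x - avgCov μ S A A' u h) *
      ((S u (t + h)).avg A x * (S u t).avg A' x - avgCov μ S A A' u h) ∂μ| ≤
      productBound κ h (s - t) := by
  have hm := fun t => (hX.centered_approx u hu t).hasMoments
  have i1 := (hm (s + h)).integrable_avg_mul (hm s) A A'
  have i2 := (hm (t + h)).integrable_avg_mul (hm t) A A'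
  have i4 : Integrable (fun x => ((S u (s + h)).avg A x * (S u s).avg A' x) *
      ((S u (t + h)).avg A x * (S u t).avg A' x)) μ := by
    have := integrable_avg_four (Z := ![S u (s + h), S u s, S u (t + h), S u t]) (μ := μ)
      (fun i => by fin_cases i <;> exact hm _) ![A, A', A, A']
    refine this.congr (ae_of_all _ fun x => ?_)
    simp [mul_assoc]
  set c := avgCov μ S A A' u h with hc
  have e : ∀ x, ((S u (s + h)).avg A x * (S u s).avg A' x - c) *
      ((S u (t + h)).avg A x * (S u t).avg A' x - c) =
      ((S u (s + h)).avg A x * (S u s).avg A' x) * ((S u (t + h)).avg A x * (S u t).avg A' x) -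
        c * ((S u (s + h)).avg A x * (S u s).avg A' x) -
        c * ((S u (t + h)).avg A x * (S u t).avg A' x) + c * c := fun x => by ring
  simp_rw [e]
  have j2 := i4.sub (i1.const_mul c)
  have j3 := j2.sub (i2.const_mul c)
  refine ⟨j3.add (integrable_const _), ?_⟩
  have hcov := hX.abs_cov_mul_le hu (s + h) s (t + h) t A A'
  rw [integral_add (f := fun x => ((S u (s + h)).avg A x * (S u s).avg A' x) *
      ((S u (t + h)).avg A x * (S u t).avg A' x) -
        c * ((S u (s + h)).avg A x * (S u s).avg A' x) -
        c * ((S u (t + h)).avg A x * (S u t).avg A' x)) j3 (integrable_const _),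
    integral_sub (f := fun x => ((S u (s + h)).avg A x * (S u s).avg A' x) *
      ((S u (t + h)).avg A x * (S u t).avg A' x) -
        c * ((S u (s + h)).avg A x * (S u s).avg A' x)) j2 (i2.const_mul c),
    integral_sub i4 (i1.const_mul c), integral_const_mul, integral_const_mul,
    hX.integral_avg_mul_eq_avgCov hu hA hA', hX.integral_avg_mul_eq_avgCov hu hA hA', ← hc]
  rw [hX.integral_avg_mul_eq_avgCov hu hA hA', hX.integral_avg_mul_eq_avgCov hu hA hA', ← hc] at hcov
  simp only [integral_const, probReal_univ, smul_eq_mul, one_mul]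
  unfold productBound
  rw [show s + h - t = s - t + h by ring, show t + h - t = h by ring,
    show s + h - (t + h) = s - t by ring, show s - (t + h) = s - t - h by ring] at hcov
  convert hcov using 2
  ring

/-- Covariances are summable in `s - t`, so the second moment is at most `m²` times the number of
terms times a constant; `|y| ≤ ε/2 + y²/(2ε)` passes to `L¹`. For block weights, `m = 2/(n + 1)`
with `n` terms makes the second moment `O(1/n)`. -/
lemma integral_abs_weighted_sum_le (hX : CumulantMixing μ X S κ) {u : ℝ}
    (hu : u ∈ Set.Icc (0 : ℝ) 1) {A A' : Set unitInterval} (hA : MeasurableSet A)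
    (hA' : MeasurableSet A') (h : ℤ) (J : Finset ℤ) {q : ℤ → ℝ} {m : ℝ}
    (hq : ∀ t, |q t| ≤ m) {ε : ℝ} (hε : 0 < ε) :
    ∫ x, |∑ t ∈ J, q t * ((S u (t + h)).avg A x * (S u t).avg A' x - avgCov μ S A A' u h)| ∂μ ≤
      ε / 2 + m ^ 2 * (J.card * ∑' r, productBound κ h r) / (2 * ε) := by
  obtain ⟨i1, e1⟩ := integrable_sq_sum_mul (μ := μ) J q
    (fun t x => (S u (t + h)).avg A x * (S u t).avg A' x - avgCov μ S A A' u h)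
    (fun s _ t _ => (hX.abs_integral_centered_mul_le hu hA hA' h s t).1)
  have hm : 0 ≤ m := (abs_nonneg _).trans (hq 0)
  have h2 : ∫ x, (∑ t ∈ J, q t * ((S u (t + h)).avg A x * (S u t).avg A' x -
      avgCov μ S A A' u h)) ^ 2 ∂μ ≤ m ^ 2 * (J.card * ∑' r, productBound κ h r) := by
    rw [e1]
    refine le_trans ?_ (mul_le_mul_of_nonneg_left (sum_sum_le_of_summable
      (hX.summable_productBound h) (productBound_nonneg h) J) (sq_nonneg m))
    rw [Finset.mul_sum]
    refine Finset.sum_le_sum fun s _ => ?_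
    rw [Finset.mul_sum]
    refine Finset.sum_le_sum fun t _ => ?_
    refine (le_abs_self _).trans ?_
    rw [abs_mul, abs_mul, sq]
    exact mul_le_mul (mul_le_mul (hq s) (hq t) (abs_nonneg _) hm)
      (hX.abs_integral_centered_mul_le hu hA hA' h s t).2 (abs_nonneg _) (by positivity)
  have h3 := integral_mono_of_nonneg (μ := μ) (ae_of_all _ fun _ => abs_nonneg _)
    ((integrable_const (ε / 2)).add (i1.div_const (2 * ε))) (ae_of_all _ fun x => (by
      have : ∀ y : ℝ, |y| ≤ ε / 2 + y ^ 2 / (2 * ε) := fun y => by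
        have e : ε / 2 + y ^ 2 / (2 * ε) - |y| = (|y| - ε) ^ 2 / (2 * ε) := by
          rw [← sq_abs y]
          field_simp
          ring
        have : 0 ≤ (|y| - ε) ^ 2 / (2 * ε) := by positivity
        linarith
      exact this _ : |∑ t ∈ J, q t * ((S u (t + h)).avg A x * (S u t).avg A' x -
        avgCov μ S A A' u h)| ≤ _))
  refine h3.trans ?_
  rw [integral_add' (integrable_const _) (i1.div_const _)]
  simp only [integral_const, probReal_univ, smul_eq_mul, one_mul, integral_div]
  gcongr

end CumulantMixing

end FunctionalTimeSeries

end

noncomputable section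

namespace FunctionalTimeSeries

/-! ### The estimated covariances in a block -/

variable {Ω : Type*} [MeasurableSpace Ω] {μ : Measure Ω}
  {X : ℕ → ℤ → RandomL2 Ω} {S : ℝ → ℤ → RandomL2 Ω}
  {κ : (m : ℕ) → (Fin m → ℤ) → Lp ℝ 2 (volume : Measure (Fin (m + 1) → unitInterval))}

/-- The estimated covariance at lag `h` in the `b`-th block. -/
def lagSum (X : ℕ → ℤ → RandomL2 Ω) (A A' : Set unitInterval) (T B K b : ℕ) (h : ℤ) (x : Ω) : ℝ :=
  ∑ t ∈ Finset.Icc (1 : ℤ) T,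
    pairWeight T B K b (t + h) t * ((X T (t + h)).avg A x * (X T t).avg A' x)

lemma lagSum_eq_sum_block {n b B : ℕ} (K : ℕ) (hn : 0 < n) (hb : b ∈ Finset.Icc 1 B)
    (A A' : Set unitInterval) (h : ℤ) (x : Ω) :
    lagSum X A A' (B * n) B K b h x = ∑ t ∈ block n b, pairWeight (B * n) B K b (t + h) t *
      ((X (B * n) (t + h)).avg A x * (X (B * n) t).avg A' x) := by
  have hB : 0 < B := by
    rw [Finset.mem_Icc] at hb
    omega
  symm
  refine Finset.sum_subset (block_subset hb) fun t _ ht => ?_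
  rw [pairWeight_eq_zero_right hB hn _ ht, zero_mul]

lemma abs_div_sub_div_le {n b B : ℕ} (hB : 0 < B) (hn : 0 < n) {t : ℤ} (ht : t ∈ block n b) :
    |(t : ℝ) / ((B * n : ℕ) : ℝ) - b / B| ≤ 1 / B := by
  rw [block, Finset.mem_Ioc] at ht
  have hB' : (0 : ℝ) < B := by exact_mod_cast hB
  have hn' : (0 : ℝ) < n := by exact_mod_cast hn
  have h1 : ((b : ℝ) - 1) * n < t := by exact_mod_cast ht.1
  have h2 : (t : ℝ) ≤ b * n := by exact_mod_cast ht.2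
  have e : (t : ℝ) / ((B * n : ℕ) : ℝ) - b / B = ((t : ℝ) - b * n) / (B * n) := by
    push_cast
    field_simp
  rw [e, abs_div, abs_of_pos (show (0 : ℝ) < B * n by positivity), div_le_div_iff₀ (by positivity)
    hB', abs_of_nonpos (by linarith)]
  nlinarith

lemma div_mem_Icc_of_mem {b B : ℕ} (hb : b ∈ Finset.Icc 1 B) :
    (b : ℝ) / B ∈ Set.Icc (0 : ℝ) 1 := by
  rw [Finset.mem_Icc] at hb
  have h2 : (b : ℝ) ≤ B := by exact_mod_cast hb.2
  exact ⟨by positivity, div_le_one_of_le₀ h2 (by positivity)⟩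

lemma sum_block_le {n b : ℕ} {q f : ℤ → ℝ} {c : ℝ} (hc : 0 ≤ c)
    (hq : ∀ t, |q t| ≤ 2 / ((n : ℝ) + 1)) (hf0 : ∀ t, 0 ≤ f t)
    (hf : ∀ t ∈ block n b, q t ≠ 0 → f t ≤ c) : ∑ t ∈ block n b, |q t| * f t ≤ 2 * c := by
  have h1 : ∀ t ∈ block n b, |q t| * f t ≤ 2 / ((n : ℝ) + 1) * c := fun t ht => by
    by_cases h0 : q t = 0
    · rw [h0, abs_zero, zero_mul]
      positivity
    · exact mul_le_mul (hq t) (hf t ht h0) (hf0 t) (by positivity)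
  refine (Finset.sum_le_card_nsmul _ _ _ h1).trans ?_
  rw [card_block, nsmul_eq_mul, ← mul_assoc]
  refine mul_le_mul_of_nonneg_right ?_ hc
  rw [mul_div_assoc', div_le_iff₀ (by positivity)]
  linarith

lemma integral_abs_sum_le {ι : Type*} (J : Finset ι) (q : ι → ℝ) {f : ι → Ω → ℝ}
    (hf : ∀ i ∈ J, Integrable (f i) μ) :
    ∫ x, |∑ i ∈ J, q i * f i x| ∂μ ≤ ∑ i ∈ J, |q i| * ∫ x, |f i x| ∂μ := by
  have h := integral_mono_of_nonneg (μ := μ) (f := fun x => |∑ i ∈ J, q i * f i x|)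
    (g := fun x => ∑ i ∈ J, |q i| * |f i x|) (ae_of_all _ fun _ => abs_nonneg _)
    (integrable_finsetSum _ fun i hi => (hf i hi).abs.const_mul _) (ae_of_all _ fun x => by
      refine (Finset.abs_sum_le_sum_abs _ _).trans (le_of_eq ?_)
      simp only [abs_mul])
  rw [integral_finsetSum _ fun i hi => (hf i hi).abs.const_mul _] at h
  simpa only [integral_const_mul] using h

namespace CumulantMixing

variable [IsProbabilityMeasure μ]

lemma integrable_lagSum (hX : CumulantMixing μ X S κ) (A A' : Set unitInterval) {n b B : ℕ}
    (K : ℕ) (hn : 0 < n) (hb : b ∈ Finset.Icc 1 B) (h : ℤ) :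
    Integrable (lagSum X A A' (B * n) B K b h) μ := by
  have hB : 0 < B := by
    rw [Finset.mem_Icc] at hb
    omega
  unfold lagSum
  refine integrable_finsetSum _ fun t ht => ?_
  by_cases hth : t + h ∈ block n b
  · have h1 := Finset.mem_Icc.1 (block_subset hb hth)
    have h2 := Finset.mem_Icc.1 ht
    exact ((hX.centered _ _ h1.1 h1.2).hasMoments.integrable_avg_mul
      (hX.centered _ _ h2.1 h2.2).hasMoments A A').const_mul _
  · simp [pairWeight_eq_zero_left hB hn t hth]

lemma abs_avgCov_le (hX : CumulantMixing μ X S κ) {u : ℝ} (hu : u ∈ Set.Icc (0 : ℝ) 1)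
    (A A' : Set unitInterval) (h : ℤ) : |avgCov μ S A A' u h| ≤ covBound κ h := by
  simpa [avgCov] using hX.abs_cov_le hu h 0 A A'

/-- No smallness is claimed here: the point is uniformity in the lag, which supplies the dominating
constant for the series over `h`. -/
lemma eventually_integral_abs_lagSum_sub_le_const (hX : CumulantMixing μ X S κ)
    (A A' : Set unitInterval) : ∃ C : ℝ, ∀ᶠ T : ℕ in atTop, ∀ (n b B K : ℕ) (h : ℤ), T = B * n →
      0 < n → b ∈ Finset.Icc 1 B →
      ∫ x, |lagSum X A A' T B K b h x - avgCov μ S A A' (b / B) h| ∂μ ≤ C := by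
  refine ⟨2 * (2 + 2 * covBound κ 0) + ∑' r, covBound κ r, ?_⟩
  filter_upwards [hX.eventually_integral_abs_avg_mul_le A A'] with T hT n b B K h hTn hn hb
  subst hTn
  have hB : 0 < B := by
    rw [Finset.mem_Icc] at hb
    omega
  have hI : Integrable (lagSum X A A' (B * n) B K b h) μ := hX.integrable_lagSum A A' K hn hb h
  have h1 : ∫ x, |lagSum X A A' (B * n) B K b h x| ∂μ ≤ 2 * (2 + 2 * covBound κ 0) := by
    simp_rw [lagSum_eq_sum_block K hn hb]
    have hJ : ∑ t ∈ block n b, |pairWeight (B * n) B K b (t + h) t| *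
        ∫ x, |(X (B * n) (t + h)).avg A x * (X (B * n) t).avg A' x| ∂μ ≤
          2 * (2 + 2 * covBound κ 0) := by
      refine sum_block_le (by linarith [covBound_nonneg (κ := κ) 0])
        (fun t => abs_pairWeight_le hB hn _ _)
        (fun t => integral_nonneg fun _ => abs_nonneg _) fun t ht hq => ?_
      have hth : t + h ∈ block n b := by
        by_contra hcon
        exact hq (pairWeight_eq_zero_left hB hn t hcon)
      exact hT _ _ (Finset.mem_Icc.1 (block_subset hb hth)) (Finset.mem_Icc.1 (block_subset hb ht))
    refine le_trans ?_ hJ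
    -- Terms with `t + h` outside the block have weight zero and are dropped before integrating,
    -- because moments of the array are assumed only at times between `1` and `T`.
    have e : ∀ x, ∑ t ∈ block n b, pairWeight (B * n) B K b (t + h) t *
        ((X (B * n) (t + h)).avg A x * (X (B * n) t).avg A' x) =
        ∑ t ∈ (block n b).filter (fun t => t + h ∈ block n b), pairWeight (B * n) B K b (t + h) t *
        ((X (B * n) (t + h)).avg A x * (X (B * n) t).avg A' x) := fun x => by
      refine (Finset.sum_filter_of_ne fun t _ hne => ?_).symm
      by_contra hcon
      exact hne (by rw [pairWeight_eq_zero_left hB hn t hcon, zero_mul])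
    simp_rw [e]
    refine (integral_abs_sum_le _ _ fun t ht => ?_).trans
      (Finset.sum_le_sum_of_subset_of_nonneg (Finset.filter_subset _ _) fun t _ _ =>
        mul_nonneg (abs_nonneg _) (integral_nonneg fun _ => abs_nonneg _))
    rw [Finset.mem_filter] at ht
    have h1 := Finset.mem_Icc.1 (block_subset hb ht.2)
    have h2 := Finset.mem_Icc.1 (block_subset hb ht.1)
    exact (hX.centered _ _ h1.1 h1.2).hasMoments.integrable_avg_mul
      (hX.centered _ _ h2.1 h2.2).hasMoments A A'
  have h2 : |avgCov μ S A A' (b / B) h| ≤ ∑' r, covBound κ r :=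
    (hX.abs_avgCov_le (div_mem_Icc_of_mem hb) A A' h).trans
      (hX.summable_covBound.le_tsum h fun j _ => covBound_nonneg j)
  have h3 := integral_mono_of_nonneg (μ := μ)
    (f := fun x => |lagSum X A A' (B * n) B K b h x - avgCov μ S A A' (b / B) h|)
    (ae_of_all _ fun _ => abs_nonneg _)
    (hI.abs.add (integrable_const |avgCov μ S A A' (b / B) h|))
    (ae_of_all _ fun x => abs_sub _ _)
  refine h3.trans ?_
  rw [integral_add' hI.abs (integrable_const _)]
  simp only [integral_const, probReal_univ, smul_eq_mul, one_mul]
  exact add_le_add h1 h2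

/-- The three summands are: the replacement of the array by the stationary process at `b/B`,
possible because the rescaled times of the block lie within `1/B ≤ δ` of it; the fluctuation of that
process over the block; and the deviation of the total weight from one. -/
lemma integral_abs_lagSum_sub_le (hX : CumulantMixing μ X S κ) {A A' : Set unitInterval}
    (hA : MeasurableSet A) (hA' : MeasurableSet A') (h : ℤ) {ε : ℝ} (hε : 0 < ε) :
    ∃ δ > 0, ∀ᶠ T : ℕ in atTop, ∀ (n b B K : ℕ), T = B * n → 0 < n → b ∈ Finset.Icc 1 B → 0 < K →
      K ≤ n → 1 / (B : ℝ) ≤ δ →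
      ∫ x, |lagSum X A A' T B K b h x - avgCov μ S A A' (b / B) h| ∂μ ≤
        2 * ε + (ε / 2 + (2 / ((n : ℝ) + 1)) ^ 2 * (n * ∑' r, productBound κ h r) / (2 * ε)) +
          (4 + 2 * Real.pi * K) * |(h : ℝ)| / ((n : ℝ) + 1) * covBound κ h := by
  obtain ⟨δ, hδ, H⟩ := hX.eventually_integral_abs_avg_mul_sub_le A A' hε
  refine ⟨δ, hδ, ?_⟩
  filter_upwards [H] with T hT n b B K hTn hn hb hK hKn hBδ
  subst hTn
  have hB : 0 < B := by
    rw [Finset.mem_Icc] at hb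
    omega
  have hu := div_mem_Icc_of_mem hb
  set u : ℝ := (b : ℝ) / B with hu_def
  set q : ℤ → ℝ := fun t => pairWeight (B * n) B K b (t + h) t with hq
  have hqb : ∀ t, |q t| ≤ 2 / ((n : ℝ) + 1) := fun t => abs_pairWeight_le hB hn _ _
  have hq0 : ∀ t, q t ≠ 0 → t + h ∈ block n b := fun t hne => by
    by_contra hcon
    exact hne (pairWeight_eq_zero_left hB hn t hcon)
  have hmX : ∀ t ∈ block n b, HasMoments μ (X (B * n) t) := fun t ht =>
    (hX.centered _ _ (Finset.mem_Icc.1 (block_subset hb ht)).1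
      (Finset.mem_Icc.1 (block_subset hb ht)).2).hasMoments
  have hmS : ∀ t, HasMoments μ (S u t) := fun t => (hX.centered_approx u hu t).hasMoments
  set J' := (block n b).filter (fun t => t + h ∈ block n b) with hJ'
  set D : ℤ → Ω → ℝ := fun t x => (X (B * n) (t + h)).avg A x * (X (B * n) t).avg A' x -
    (S u (t + h)).avg A x * (S u t).avg A' x with hD
  have iS : ∀ t, Integrable (fun x => (S u (t + h)).avg A x * (S u t).avg A' x) μ := fun t =>
    (hmS (t + h)).integrable_avg_mul (hmS t) A A'
  have iD : ∀ t ∈ J', Integrable (D t) μ := fun t ht => by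
    rw [hJ', Finset.mem_filter] at ht
    exact ((hmX _ ht.2).integrable_avg_mul (hmX _ ht.1) A A').sub (iS t)
  have e : ∀ x, lagSum X A A' (B * n) B K b h x - avgCov μ S A A' u h =
      ∑ t ∈ J', q t * D t x +
      ∑ t ∈ block n b, q t * ((S u (t + h)).avg A x * (S u t).avg A' x - avgCov μ S A A' u h) +
      (∑ t ∈ block n b, q t - 1) * avgCov μ S A A' u h := fun x => by
    rw [lagSum_eq_sum_block K hn hb, hJ', Finset.sum_filter_of_ne (fun t _ hne => hq0 t
      (left_ne_zero_of_mul hne)), sub_mul, Finset.sum_mul, ← add_sub_assoc,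
      ← Finset.sum_add_distrib, ← Finset.sum_add_distrib, one_mul]
    congr 1
    refine Finset.sum_congr rfl fun t _ => ?_
    simp only [hD, hq]
    ring
  have i1 : Integrable (fun x => ∑ t ∈ J', q t * D t x) μ :=
    integrable_finsetSum _ fun t ht => (iD t ht).const_mul _
  have i2 : Integrable (fun x => ∑ t ∈ block n b,
      q t * ((S u (t + h)).avg A x * (S u t).avg A' x - avgCov μ S A A' u h)) μ :=
    integrable_finsetSum _ fun t _ => ((iS t).sub (integrable_const _)).const_mul _
  simp_rw [e]
  have h3 := integral_mono_of_nonneg (μ := μ) (ae_of_all _ fun _ => abs_nonneg _)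
    ((i1.abs.add i2.abs).add (integrable_const
      |(∑ t ∈ block n b, q t - 1) * avgCov μ S A A' u h|))
    (ae_of_all _ fun x => abs_add_three _ _ _)
  refine h3.trans ?_
  rw [integral_add' (i1.abs.add i2.abs) (integrable_const _), integral_add' i1.abs i2.abs]
  simp only [integral_const, probReal_univ, smul_eq_mul, one_mul]
  refine add_le_add (add_le_add ?_ ?_) ?_
  · refine (integral_abs_sum_le _ _ iD).trans ((Finset.sum_le_sum_of_subset_of_nonneg
      (Finset.filter_subset _ _) fun t _ _ =>
        mul_nonneg (abs_nonneg _) (integral_nonneg fun _ => abs_nonneg _)).trans ?_)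
    refine sum_block_le hε.le hqb (fun t => integral_nonneg fun _ => abs_nonneg _) fun t ht hne => ?_
    have hth := hq0 t hne
    exact hT _ _ (Finset.mem_Icc.1 (block_subset hb hth)) (Finset.mem_Icc.1 (block_subset hb ht))
      u hu ((abs_div_sub_div_le hB hn hth).trans hBδ) ((abs_div_sub_div_le hB hn ht).trans hBδ)
  · have := hX.integral_abs_weighted_sum_le hu hA hA' h (block n b) hqb hε
    rwa [card_block] at this
  · rw [abs_mul]
    exact mul_le_mul (abs_sum_pairWeight_sub_one_le hB hn hK hKn h) (hX.abs_avgCov_le hu A A' h)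
      (abs_nonneg _) (by positivity)

end CumulantMixing

/-! ### The asymptotic scheme -/

section Scheme

variable {T B K : ℕ → ℕ}

lemma AsymptoticScheme.eq_mul (hs : AsymptoticScheme T B K) (n : ℕ) : T n = B n * (T n / B n) :=
  (Nat.mul_div_cancel' (hs.dvd n)).symm

/-- Since `T/B` is the block length, `T/(BK) → ∞` says that blocks are long compared with the number
of tapers. Hence eventually `K` is at most the block length, and the taper shift error vanishes. -/
lemma AsymptoticScheme.tendsto_blockLength_div (hs : AsymptoticScheme T B K) :
    Tendsto (fun n => ((T n / B n : ℕ) : ℝ) / K n) atTop atTop := by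
  refine hs.tendsto_T_div_mul.congr' ?_
  filter_upwards [hs.tendsto_B.eventually_gt_atTop 0] with n hn
  rw [Nat.cast_div (hs.dvd n) (by positivity), div_div]

lemma AsymptoticScheme.eventually_le_blockLength (hs : AsymptoticScheme T B K) (c : ℝ) :
    ∀ᶠ n in atTop, c * K n ≤ ((T n / B n : ℕ) : ℝ) := by
  filter_upwards [hs.tendsto_blockLength_div.eventually_ge_atTop c,
    hs.tendsto_K.eventually_gt_atTop 0] with n h1 h2
  rwa [le_div_iff₀ (by exact_mod_cast h2)] at h1

lemma AsymptoticScheme.tendsto_blockLength (hs : AsymptoticScheme T B K) :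
    Tendsto (fun n => ((T n / B n : ℕ) : ℝ)) atTop atTop := by
  rw [tendsto_atTop]
  intro c
  filter_upwards [hs.eventually_le_blockLength |c|, hs.tendsto_K.eventually_ge_atTop 1] with n h1 h2
  refine le_trans ((le_abs_self c).trans (le_mul_of_one_le_right (abs_nonneg c) ?_)) h1
  exact_mod_cast h2

lemma AsymptoticScheme.tendsto_K_div (hs : AsymptoticScheme T B K) :
    Tendsto (fun n => (K n : ℝ) / (((T n / B n : ℕ) : ℝ) + 1)) atTop (𝓝 0) := by
  have h := hs.tendsto_blockLength_div.inv_tendsto_atTop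
  refine squeeze_zero' (Eventually.of_forall fun n => by positivity) ?_ h
  filter_upwards [hs.tendsto_blockLength.eventually_gt_atTop 0] with n hn
  rw [Pi.inv_apply, inv_div]
  gcongr
  linarith

end Scheme

variable {T B K : ℕ → ℕ}

lemma CumulantMixing.eventually_integral_abs_lagSum_sub_le [IsProbabilityMeasure μ]
    (hX : CumulantMixing μ X S κ)
    (hs : AsymptoticScheme T B K) {A A' : Set unitInterval}
    (hA : MeasurableSet A) (hA' : MeasurableSet A') (h : ℤ) {ε : ℝ} (hε : 0 < ε) :
    ∀ᶠ n in atTop, ∀ b ∈ Finset.Icc 1 (B n),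
      ∫ x, |lagSum X A A' (T n) (B n) (K n) b h x - avgCov μ S A A' (b / B n) h| ∂μ ≤ ε := by
  -- With `ε/6` the three-term bound is at most `2ε/6 + (ε/12 + ε/6) + ε/6`, once the limits `l1`
  -- and `l2` have come below `ε/6`.
  obtain ⟨δ, hδ, H⟩ := hX.integral_abs_lagSum_sub_le hA hA' h (ε := ε / 6) (by positivity)
  set R := ∑' r, productBound κ h r
  have l1 : Tendsto (fun n => (2 / (((T n / B n : ℕ) : ℝ) + 1)) ^ 2 *
      (((T n / B n : ℕ) : ℝ) * R) / (2 * (ε / 6))) atTop (𝓝 0) := by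
    have hR : 0 ≤ R := tsum_nonneg fun r => productBound_nonneg h r
    have g : Tendsto (fun n => 4 * R / (2 * (ε / 6)) * (((T n / B n : ℕ) : ℝ))⁻¹) atTop (𝓝 0) := by
      simpa using hs.tendsto_blockLength.inv_tendsto_atTop.const_mul (4 * R / (2 * (ε / 6)))
    refine squeeze_zero' (Eventually.of_forall fun n => by positivity) ?_ g
    filter_upwards [hs.tendsto_blockLength.eventually_gt_atTop 0] with n hn
    set N := ((T n / B n : ℕ) : ℝ)
    have h1 : (2 / (N + 1)) ^ 2 * N ≤ 4 * N⁻¹ := by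
      rw [div_pow, div_mul_eq_mul_div, div_le_iff₀ (by positivity)]
      have : (N + 1) ^ 2 ≥ N ^ 2 := by nlinarith
      have h2 : 4 * N⁻¹ * N ^ 2 = 4 * N := by field_simp
      have h3 : 4 * N⁻¹ * N ^ 2 ≤ 4 * N⁻¹ * (N + 1) ^ 2 := by gcongr
      nlinarith
    calc (2 / (N + 1)) ^ 2 * (N * R) / (2 * (ε / 6))
        = ((2 / (N + 1)) ^ 2 * N) * (R / (2 * (ε / 6))) := by ring
      _ ≤ (4 * N⁻¹) * (R / (2 * (ε / 6))) := by gcongr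
      _ = _ := by ring
  have l2 : Tendsto (fun n => (4 + 2 * Real.pi * K n) * |(h : ℝ)| /
      (((T n / B n : ℕ) : ℝ) + 1) * covBound κ h) atTop (𝓝 0) := by
    have g1 : Tendsto (fun n => 4 * (((T n / B n : ℕ) : ℝ) + 1)⁻¹) atTop (𝓝 0) := by
      have := (tendsto_atTop_add_const_right _ (1 : ℝ) hs.tendsto_blockLength).inv_tendsto_atTop
      simpa using this.const_mul 4
    have g2 := hs.tendsto_K_div.const_mul (2 * Real.pi)
    have g := ((g1.add g2).mul_const (|(h : ℝ)|)).mul_const (covBound κ h)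
    simp only [mul_zero, add_zero, zero_mul] at g
    refine g.congr fun n => ?_
    ring
  filter_upwards [hs.tendsto_T.eventually H, hs.eventually_le_blockLength 1,
    hs.tendsto_blockLength.eventually_gt_atTop 0, hs.tendsto_K.eventually_gt_atTop 0,
    l1.eventually (ge_mem_nhds (show (0 : ℝ) < ε / 6 by positivity)),
    l2.eventually (ge_mem_nhds (show (0 : ℝ) < ε / 6 by positivity)),
    ((tendsto_one_div_atTop_nhds_zero_nat (𝕜 := ℝ)).comp hs.tendsto_B).eventually
      (ge_mem_nhds hδ)] with n h1 h2 h3 h4 h5 h6 h7 b hb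
  rw [one_mul] at h2
  refine (h1 (T n / B n) b (B n) (K n) (hs.eq_mul n) (by exact_mod_cast h3) hb h4
    (by exact_mod_cast h2) h7).trans ?_
  linarith

lemma CumulantMixing.eventually_integral_abs_lagSum_sub_le_bound [IsProbabilityMeasure μ]
    (hX : CumulantMixing μ X S κ) (hs : AsymptoticScheme T B K) (A A' : Set unitInterval) :
    ∃ C : ℝ, ∀ᶠ n in atTop, ∀ b ∈ Finset.Icc 1 (B n), ∀ h : ℤ,
      ∫ x, |lagSum X A A' (T n) (B n) (K n) b h x - avgCov μ S A A' (b / B n) h| ∂μ ≤ C := by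
  obtain ⟨C, hC⟩ := hX.eventually_integral_abs_lagSum_sub_le_const A A'
  refine ⟨C, ?_⟩
  filter_upwards [hs.tendsto_T.eventually hC, hs.tendsto_blockLength.eventually_gt_atTop 0] with
    n h1 h2 b hb h
  exact h1 _ b (B n) (K n) h (hs.eq_mul n) (by exact_mod_cast h2) hb

end FunctionalTimeSeries

end

noncomputable section

namespace FunctionalTimeSeries

/-! ### Smoothed estimators of the spectrum in a block -/

variable {Ω : Type*} [MeasurableSpace Ω] {μ : Measure Ω}
  {X : ℕ → ℤ → RandomL2 Ω} {S : ℝ → ℤ → RandomL2 Ω}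
  {κ : (m : ℕ) → (Fin m → ℤ) → Lp ℝ 2 (volume : Measure (Fin (m + 1) → unitInterval))}

/-- The spectral estimator of the `b`-th block, integrated over frequency against a function with
Fourier coefficients `c` and over the rectangle `A × A'`. -/
def blockStat (X : ℕ → ℤ → RandomL2 Ω) (c : ℤ → ℂ) (A A' : Set unitInterval) (T B K b : ℕ)
    (x : Ω) : ℂ :=
  ∑ s ∈ Finset.Icc (1 : ℤ) T, ∑ t ∈ Finset.Icc (1 : ℤ) T,
    (pairWeight T B K b s t : ℂ) * c (s - t) * ((X T s).avg A x * (X T t).avg A' x : ℝ)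

/-- The population counterpart of `blockStat` at rescaled time `u`. -/
def popStat (μ : Measure Ω) (S : ℝ → ℤ → RandomL2 Ω) (c : ℤ → ℂ) (A A' : Set unitInterval)
    (u : ℝ) : ℂ :=
  ∑' h : ℤ, c h * (avgCov μ S A A' u h : ℂ)

lemma measurable_blockStat (c : ℤ → ℂ) (A A' : Set unitInterval) (T B K b : ℕ) :
    Measurable (blockStat X c A A' T B K b) := by
  unfold blockStat
  refine Finset.measurable_fun_sum _ fun s _ => Finset.measurable_fun_sum _ fun t _ => ?_
  refine measurable_const.mul (Complex.measurable_ofReal.comp ?_)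
  exact ((X T s).measurable_avg A).mul ((X T t).measurable_avg A')

/-- Substitute `s = t + h`. The weights vanish for `s` outside the block, so letting `h` range over
all integers adds only zero terms. -/
lemma hasSum_blockStat {n b B : ℕ} (K : ℕ) (hn : 0 < n) (hb : b ∈ Finset.Icc 1 B) (c : ℤ → ℂ)
    (A A' : Set unitInterval) (x : Ω) :
    HasSum (fun h : ℤ => c h * (lagSum X A A' (B * n) B K b h x : ℂ))
      (blockStat X c A A' (B * n) B K b x) := by
  have hB : 0 < B := by
    rw [Finset.mem_Icc] at hb
    omega
  unfold blockStat lagSum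
  rw [Finset.sum_comm]
  have key : ∀ t ∈ Finset.Icc (1 : ℤ) ((B * n : ℕ) : ℤ), HasSum (fun h : ℤ =>
      (pairWeight (B * n) B K b (t + h) t : ℂ) * c h *
        ((X (B * n) (t + h)).avg A x * (X (B * n) t).avg A' x : ℝ))
      (∑ s ∈ Finset.Icc (1 : ℤ) ((B * n : ℕ) : ℤ), (pairWeight (B * n) B K b s t : ℂ) * c (s - t) *
        ((X (B * n) s).avg A x * (X (B * n) t).avg A' x : ℝ)) := fun t _ => by
    have h1 : HasSum (fun s : ℤ => (pairWeight (B * n) B K b s t : ℂ) * c (s - t) *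
        ((X (B * n) s).avg A x * (X (B * n) t).avg A' x : ℝ))
        (∑ s ∈ Finset.Icc (1 : ℤ) ((B * n : ℕ) : ℤ), (pairWeight (B * n) B K b s t : ℂ) *
          c (s - t) * ((X (B * n) s).avg A x * (X (B * n) t).avg A' x : ℝ)) := by
      refine hasSum_sum_of_ne_finset_zero fun s hs => ?_
      rw [pairWeight_eq_zero_left hB hn t fun hs' => hs (block_subset hb hs')]
      simp
    refine ((Equiv.addLeft t).hasSum_iff.2 h1).congr_fun ?_
    intro h
    simp
  refine (hasSum_sum key).congr_fun fun h => ?_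
  rw [Complex.ofReal_sum, Finset.mul_sum]
  refine Finset.sum_congr rfl fun t _ => ?_
  push_cast
  ring

namespace CumulantMixing

lemma summable_mul_avgCov (hX : CumulantMixing μ X S κ) [IsProbabilityMeasure μ] {u : ℝ}
    (hu : u ∈ Set.Icc (0 : ℝ) 1) (A A' : Set unitInterval) {c : ℤ → ℂ}
    (hc : Summable fun h => ‖c h‖) :
    Summable fun h : ℤ => c h * (avgCov μ S A A' u h : ℂ) := by
  refine Summable.of_norm ((hc.mul_right (∑' r, covBound κ r)).of_nonneg_of_le
    (fun h => norm_nonneg _) fun h => ?_)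
  rw [norm_mul, Complex.norm_real, Real.norm_eq_abs]
  gcongr
  exact (hX.abs_avgCov_le hu A A' h).trans
    (hX.summable_covBound.le_tsum h fun j _ => covBound_nonneg j)

variable {T B K : ℕ → ℕ}

/-- Triangle inequality over the lags, then Tonelli; the lower integral avoids any integrability
question for the series. The constant `C` only ensures that the right-hand series converges, as a
divergent `tsum` would be zero. -/
lemma lintegral_average_le (hX : CumulantMixing μ X S κ) [IsProbabilityMeasure μ]
    (A A' : Set unitInterval) {c : ℤ → ℂ} (hc : Summable fun h => ‖c h‖) {n B K : ℕ} (hn : 0 < n)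
    {C : ℝ} (hC : ∀ b ∈ Finset.Icc 1 B, ∀ h : ℤ,
      ∫ x, |lagSum X A A' (B * n) B K b h x - avgCov μ S A A' (b / B) h| ∂μ ≤ C) :
    ∫⁻ x, ENNReal.ofReal (1 / (B : ℝ) * ∑ b ∈ Finset.Icc 1 B,
      ‖blockStat X c A A' (B * n) B K b x - popStat μ S c A A' (b / B)‖) ∂μ ≤
    ENNReal.ofReal (∑' h : ℤ, ‖c h‖ * (1 / (B : ℝ) * ∑ b ∈ Finset.Icc 1 B,
      ∫ x, |lagSum X A A' (B * n) B K b h x - avgCov μ S A A' (b / B) h| ∂μ)) := by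
  set D : ℕ → ℤ → Ω → ℝ := fun b h x =>
    lagSum X A A' (B * n) B K b h x - avgCov μ S A A' (b / B) h with hD
  have hsum : ∀ b ∈ Finset.Icc 1 B, ∀ x, HasSum (fun h => c h * (D b h x : ℂ))
      (blockStat X c A A' (B * n) B K b x - popStat μ S c A A' (b / B)) := fun b hb x => by
    refine ((hasSum_blockStat K hn hb c A A' x).sub
      (hX.summable_mul_avgCov (div_mem_Icc_of_mem hb) A A' hc).hasSum).congr_fun fun h => ?_
    simp only [hD]
    push_cast
    ring
  have hsn : ∀ b ∈ Finset.Icc 1 B, ∀ x, Summable fun h => ‖c h‖ * |D b h x| := fun b hb x => by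
    have := (hsum b hb x).summable.norm
    simpa only [norm_mul, Complex.norm_real, Real.norm_eq_abs] using this
  have hiD : ∀ b ∈ Finset.Icc 1 B, ∀ h, Integrable (D b h) μ := fun b hb h =>
    (hX.integrable_lagSum A A' K hn hb h).sub (integrable_const _)
  have hsumm : ∀ x, HasSum (fun h => ‖c h‖ * (1 / (B : ℝ) * ∑ b ∈ Finset.Icc 1 B, |D b h x|))
      (1 / (B : ℝ) * ∑ b ∈ Finset.Icc 1 B, ∑' h, ‖c h‖ * |D b h x|) := fun x => by
    refine ((hasSum_sum fun b hb => (hsn b hb x).hasSum).mul_left (1 / (B : ℝ))).congr_fun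
      fun h => ?_
    rw [← Finset.mul_sum]
    ring
  have hpt : ∀ x, ENNReal.ofReal (1 / (B : ℝ) * ∑ b ∈ Finset.Icc 1 B,
      ‖blockStat X c A A' (B * n) B K b x - popStat μ S c A A' (b / B)‖) ≤
      ∑' h : ℤ, ENNReal.ofReal (‖c h‖ * (1 / (B : ℝ) * ∑ b ∈ Finset.Icc 1 B, |D b h x|)) :=
    fun x => by
      rw [← ENNReal.ofReal_tsum_of_nonneg (fun h => by positivity) (hsumm x).summable,
        (hsumm x).tsum_eq]
      gcongr with b hb
      rw [← (hsum b hb x).tsum_eq]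
      refine (norm_tsum_le_tsum_norm (hsum b hb x).summable.norm).trans (le_of_eq ?_)
      simp only [norm_mul, Complex.norm_real, Real.norm_eq_abs]
  refine (lintegral_mono hpt).trans ?_
  have hiS : ∀ h, Integrable (fun x => ‖c h‖ * (1 / (B : ℝ) * ∑ b ∈ Finset.Icc 1 B, |D b h x|)) μ :=
    fun h => ((integrable_finsetSum _ fun b hb => (hiD b hb h).abs).const_mul _).const_mul _
  rw [lintegral_tsum fun h => (hiS h).1.aemeasurable.ennreal_ofReal]
  have hint : ∀ h, ∫ x, ‖c h‖ * (1 / (B : ℝ) * ∑ b ∈ Finset.Icc 1 B, |D b h x|) ∂μ =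
      ‖c h‖ * (1 / (B : ℝ) * ∑ b ∈ Finset.Icc 1 B, ∫ x, |D b h x| ∂μ) := fun h => by
    rw [integral_const_mul, integral_const_mul, integral_finsetSum _ fun b hb => (hiD b hb h).abs]
  have he : ∀ h, ∫⁻ x, ENNReal.ofReal (‖c h‖ * (1 / (B : ℝ) *
      ∑ b ∈ Finset.Icc 1 B, |D b h x|)) ∂μ = ENNReal.ofReal (‖c h‖ * (1 / (B : ℝ) *
        ∑ b ∈ Finset.Icc 1 B, ∫ x, |D b h x| ∂μ)) := fun h => by
    rw [← hint, ofReal_integral_eq_lintegral_ofReal (hiS h) (ae_of_all _ fun x => by positivity)]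
  simp_rw [he]
  have hnn : ∀ h, 0 ≤ ‖c h‖ * (1 / (B : ℝ) * ∑ b ∈ Finset.Icc 1 B, ∫ x, |D b h x| ∂μ) := fun h =>
    mul_nonneg (norm_nonneg _) (mul_nonneg (by positivity)
      (Finset.sum_nonneg fun b _ => integral_nonneg fun _ => abs_nonneg _))
  rw [ENNReal.ofReal_tsum_of_nonneg hnn]
  refine (hc.mul_right (1 / (B : ℝ) * ∑ b ∈ Finset.Icc 1 B, C)).of_nonneg_of_le hnn fun h => ?_
  gcongr with b hb
  exact hC b hb h

lemma average_le_of_forall_le {B : ℕ} {f : ℕ → ℝ} {c : ℝ} (hc : 0 ≤ c)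
    (hf : ∀ b ∈ Finset.Icc 1 B, f b ≤ c) : 1 / (B : ℝ) * ∑ b ∈ Finset.Icc 1 B, f b ≤ c := by
  rcases Nat.eq_zero_or_pos B with rfl | hB
  · simpa using hc
  rw [one_div, inv_mul_le_iff₀ (by exact_mod_cast hB)]
  refine (Finset.sum_le_sum hf).trans ?_
  simp

/-- For each lag the block-averaged `L¹` error tends to zero, and `‖c h‖ * |C|` dominates it
summably. So the series of errors tends to zero, and Markov's inequality concludes. -/
lemma tendsto_measure_average (hX : CumulantMixing μ X S κ) [IsProbabilityMeasure μ]
    (hs : AsymptoticScheme T B K) {A A' : Set unitInterval}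
    (hA : MeasurableSet A) (hA' : MeasurableSet A') {c : ℤ → ℂ} (hc : Summable fun h => ‖c h‖)
    {ε : ℝ} (hε : 0 < ε) :
    Tendsto (fun n => μ {x | ε ≤ 1 / (B n : ℝ) * ∑ b ∈ Finset.Icc 1 (B n),
      ‖blockStat X c A A' (T n) (B n) (K n) b x - popStat μ S c A A' (b / B n)‖}) atTop (𝓝 0) := by
  obtain ⟨C, hC⟩ := hX.eventually_integral_abs_lagSum_sub_le_bound hs A A'
  set e : ℕ → ℤ → ℝ := fun n h => 1 / (B n : ℝ) * ∑ b ∈ Finset.Icc 1 (B n),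
    ∫ x, |lagSum X A A' (T n) (B n) (K n) b h x - avgCov μ S A A' (b / B n) h| ∂μ with he
  have he0 : ∀ n h, 0 ≤ e n h := fun n h => mul_nonneg (by positivity)
    (Finset.sum_nonneg fun b _ => integral_nonneg fun _ => abs_nonneg _)
  have hlim : ∀ h, Tendsto (fun n => ‖c h‖ * e n h) atTop (𝓝 0) := fun h => by
    have : Tendsto (fun n => e n h) atTop (𝓝 0) := by
      rw [Metric.tendsto_nhds]
      intro δ hδ
      filter_upwards [hX.eventually_integral_abs_lagSum_sub_le hs hA hA' h (half_pos hδ)] with n hn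
      rw [Real.dist_eq, sub_zero, abs_of_nonneg (he0 n h)]
      exact (average_le_of_forall_le (half_pos hδ).le hn).trans_lt (half_lt_self hδ)
    simpa using this.const_mul ‖c h‖
  have htsum : Tendsto (fun n => ∑' h, ‖c h‖ * e n h) atTop (𝓝 0) := by
    have := tendsto_tsum_of_dominated_convergence (f := fun n h => ‖c h‖ * e n h) (𝓕 := atTop)
      (g := fun _ => 0) (hc.mul_right |C|) hlim (by
        filter_upwards [hC] with n hn h
        rw [Real.norm_of_nonneg (mul_nonneg (norm_nonneg _) (he0 n h))]
        gcongr
        exact average_le_of_forall_le (abs_nonneg C) fun b hb => (hn b hb h).trans (le_abs_self C))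
    simpa using this
  have h2 : Tendsto (fun n => ENNReal.ofReal (∑' h, ‖c h‖ * e n h) / ENNReal.ofReal ε) atTop
      (𝓝 0) := by
    have := ENNReal.Tendsto.div_const (ENNReal.tendsto_ofReal htsum)
      (b := ENNReal.ofReal ε) (Or.inr (by simpa using hε))
    simpa using this
  refine tendsto_of_tendsto_of_tendsto_of_le_of_le' tendsto_const_nhds h2
    (Eventually.of_forall fun _ => zero_le) ?_
  filter_upwards [hC, hs.tendsto_blockLength.eventually_gt_atTop 0] with n hn hn0
  have hn0' : 0 < T n / B n := by exact_mod_cast hn0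
  have hT := hs.eq_mul n
  set N := T n / B n with hN
  simp only [he]
  rw [hT] at hn ⊢
  have hle := hX.lintegral_average_le A A' hc hn0' hn
  refine le_trans ?_ (ENNReal.div_le_div_right hle _)
  have hmeas : Measurable (fun x => 1 / (B n : ℝ) * ∑ b ∈ Finset.Icc 1 (B n),
      ‖blockStat X c A A' (B n * N) (B n) (K n) b x - popStat μ S c A A' (b / B n)‖) :=
    (Finset.measurable_fun_sum _ fun b _ =>
      ((measurable_blockStat c A A' _ _ _ b).sub_const _).norm).const_mul _
  refine le_trans (measure_mono ?_) (meas_ge_le_lintegral_div hmeas.ennreal_ofReal.aemeasurable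
    (by simpa using hε) ENNReal.ofReal_ne_top)
  intro x hx
  exact ENNReal.ofReal_le_ofReal hx

end CumulantMixing

end FunctionalTimeSeries

end

noncomputable section

namespace FunctionalTimeSeries

/-! ### A lower bound for the test statistic -/

/-- Cauchy–Schwarz on a space of mass at most one: with `a` the integral of `‖G‖`, integrate `2a‖G‖
≤ a² + ‖G‖²`. -/
lemma sq_norm_integral_le {α : Type*} [MeasurableSpace α] {ν : Measure α} [IsFiniteMeasure ν]
    (hν : ν.real Set.univ ≤ 1) {ψ G : α → ℂ} (hψ : ∀ᵐ y ∂ν, ‖ψ y‖ ≤ 1)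
    (hG : MemLp G 2 ν) : ‖∫ y, ψ y * G y ∂ν‖ ^ 2 ≤ ∫ y, ‖G y‖ ^ 2 ∂ν := by
  have i2 : Integrable (fun y => ‖G y‖ ^ 2) ν := (memLp_two_iff_integrable_sq_norm hG.1).1 hG
  have i1 : Integrable (fun y => ‖G y‖) ν := (hG.integrable (by norm_num)).norm
  set a := ∫ y, ‖G y‖ ∂ν with ha
  have ha0 : 0 ≤ a := integral_nonneg fun _ => norm_nonneg _
  have h1 : ‖∫ y, ψ y * G y ∂ν‖ ≤ a := by
    refine norm_integral_le_of_norm_le i1 ?_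
    filter_upwards [hψ] with y hy
    rw [norm_mul]
    exact mul_le_of_le_one_left (norm_nonneg _) hy
  have h2 : ∫ y, 2 * a * ‖G y‖ ∂ν ≤ ∫ y, (a ^ 2 + ‖G y‖ ^ 2) ∂ν :=
    integral_mono (i1.const_mul _) ((integrable_const _).add i2) fun y => by
      simp only
      nlinarith [sq_nonneg (a - ‖G y‖)]
  rw [integral_const_mul, integral_add (integrable_const _) i2, integral_const, ← ha,
    smul_eq_mul] at h2
  have h3 : ν.real Set.univ * a ^ 2 ≤ a ^ 2 := mul_le_of_le_one_left (sq_nonneg _) hν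
  have h4 : ‖∫ y, ψ y * G y ∂ν‖ ^ 2 ≤ a ^ 2 := by gcongr
  nlinarith

lemma memLp_two_separable {ν : Measure ℝ} [IsFiniteMeasure ν] {p : ℝ → ℂ}
    (hp : MemLp p 2 ν) {f g : unitInterval → ℝ} (hf : MemLp f 2 volume) (hg : MemLp g 2 volume) :
    MemLp (fun z : ℝ × unitInterval × unitInterval => p z.1 * ((g z.2.1 * f z.2.2 : ℝ) : ℂ)) 2
      (ν.prod (volume.prod volume)) := by
  have hm : AEStronglyMeasurable (fun z : unitInterval × unitInterval => g z.1 * f z.2)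
      (volume.prod volume) := (hg.integrable (by norm_num)).mul_prod (hf.integrable (by norm_num)) |>.1
  have hmeas : AEStronglyMeasurable
      (fun z : ℝ × unitInterval × unitInterval => p z.1 * ((g z.2.1 * f z.2.2 : ℝ) : ℂ))
      (ν.prod (volume.prod volume)) :=
    (hp.1.comp_fst).mul
      (Complex.continuous_ofReal.comp_aestronglyMeasurable hm.comp_snd)
  rw [memLp_two_iff_integrable_sq_norm hmeas]
  have h1 := (memLp_two_iff_integrable_sq_norm hp.1).1 hp
  have h2 := (memLp_two_iff_integrable_sq hf.1).1 hf
  have h3 := (memLp_two_iff_integrable_sq hg.1).1 hg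
  refine (h1.mul_prod (h3.mul_prod h2)).congr (ae_of_all _ fun z => ?_)
  simp only [norm_mul, Complex.norm_real, Real.norm_eq_abs, mul_pow, sq_abs]

/-- The test function `φ ⊗ 1_{A'} ⊗ 1_A` is bounded by one on a space of mass `β - α ≤ 1`, and
shrinking the band to `[α, β]` lowers the integral of a square. Sums of separable terms suffice,
because the demeaned estimator has this form. -/
lemma sq_norm_sum_le_integral {ι : Type*} (J : Finset ι) {p : ι → ℝ → ℂ}
    (hp : ∀ i, Continuous (p i)) {f g : ι → unitInterval → ℝ} (hf : ∀ i, MemLp (f i) 2 volume)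
    (hg : ∀ i, MemLp (g i) 2 volume) {A A' : Set unitInterval} (hA : MeasurableSet A)
    (hA' : MeasurableSet A') {φ : ℝ → ℝ} (hφ : Continuous φ) {α β ω₁ ω₂ : ℝ} (h1 : ω₁ ≤ α)
    (hαβ : α ≤ β) (h2 : β ≤ ω₂) (hlen : β - α ≤ 1) (hφ1 : ∀ ω ∈ Set.Icc α β, |φ ω| ≤ 1) :
    ‖∑ i ∈ J, (∫ ω in α..β, (φ ω : ℂ) * p i ω) *
      (((∫ τ in A, f i τ) * (∫ σ in A', g i σ) : ℝ) : ℂ)‖ ^ 2 ≤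
      ∫ ω in ω₁..ω₂, ∫ σ, ∫ τ, ‖∑ i ∈ J, p i ω * ((g i σ * f i τ : ℝ) : ℂ)‖ ^ 2 := by
  have hpL : ∀ i (a b : ℝ), MemLp (p i) 2 (volume.restrict (Set.Ioc a b)) := fun i a b => by
    obtain ⟨C, hC⟩ := isCompact_Icc.exists_bound_of_continuousOn (s := Set.Icc a b)
      (hp i).continuousOn
    refine MemLp.of_bound (hp i).aestronglyMeasurable C ?_
    filter_upwards [ae_restrict_mem measurableSet_Ioc] with ω hω
    exact hC ω (Set.Ioc_subset_Icc_self hω)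
  set G : ℝ × unitInterval × unitInterval → ℂ :=
    fun z => ∑ i ∈ J, p i z.1 * ((g i z.2.1 * f i z.2.2 : ℝ) : ℂ) with hG
  have hGL : ∀ a b : ℝ, MemLp G 2 ((volume.restrict (Set.Ioc a b)).prod (volume.prod volume)) :=
    fun a b => memLp_finsetSum _ fun i _ => memLp_two_separable (hpL i a b) (hf i) (hg i)
  have hG2 : ∀ a b : ℝ, Integrable (fun z => ‖G z‖ ^ 2)
      ((volume.restrict (Set.Ioc a b)).prod (volume.prod volume)) := fun a b =>
    (memLp_two_iff_integrable_sq_norm (hGL a b).1).1 (hGL a b)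
  -- iterated integrals
  have hiter : ∀ ω, ∫ σ, ∫ τ, ‖∑ i ∈ J, p i ω * ((g i σ * f i τ : ℝ) : ℂ)‖ ^ 2 =
      ∫ y : unitInterval × unitInterval, ‖G (ω, y)‖ ^ 2 ∂(volume.prod volume) := fun ω => by
    rw [integral_prod]
    have hGω : MemLp (fun y : unitInterval × unitInterval => G (ω, y)) 2 (volume.prod volume) := by
      refine memLp_finsetSum _ fun i _ => MemLp.const_mul ?_ (p i ω)
      have hm : AEStronglyMeasurable (fun z : unitInterval × unitInterval => g i z.1 * f i z.2)
          (volume.prod volume) :=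
        ((hg i).integrable (by norm_num)).mul_prod ((hf i).integrable (by norm_num)) |>.1
      have hm2 := Complex.continuous_ofReal.comp_aestronglyMeasurable hm
      refine (memLp_two_iff_integrable_sq_norm hm2).2 ?_
      have h2 := (memLp_two_iff_integrable_sq (hf i).1).1 (hf i)
      have h3 := (memLp_two_iff_integrable_sq (hg i).1).1 (hg i)
      refine (h3.mul_prod h2).congr (ae_of_all _ fun z => ?_)
      simp only [norm_mul, Complex.norm_real, Real.norm_eq_abs, mul_pow, sq_abs]
    exact (memLp_two_iff_integrable_sq_norm hGω.1).1 hGω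
  simp_rw [hiter]
  rw [intervalIntegral.integral_of_le (h1.trans (hαβ.trans h2))]
  have hmono : ∫ ω in Set.Ioc α β, ∫ y, ‖G (ω, y)‖ ^ 2 ∂(volume.prod volume) ≤
      ∫ ω in Set.Ioc ω₁ ω₂, ∫ y, ‖G (ω, y)‖ ^ 2 ∂(volume.prod volume) :=
    setIntegral_mono_set (hG2 ω₁ ω₂).integral_prod_left
      (ae_of_all _ fun ω => integral_nonneg fun _ => sq_nonneg _)
      (Set.Ioc_subset_Ioc h1 h2).eventuallyLE
  refine le_trans ?_ hmono
  rw [← integral_prod _ (hG2 α β)]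
  set ν := (volume.restrict (Set.Ioc α β)).prod
    ((volume : Measure unitInterval).prod (volume : Measure unitInterval)) with hν
  have hν1 : ν.real Set.univ ≤ 1 := by
    rw [hν, Measure.real, ← Set.univ_prod_univ, Measure.prod_prod]
    simp [hαβ, hlen]
  set ψ : ℝ × unitInterval × unitInterval → ℂ := fun z =>
    (φ z.1 : ℂ) * (A'.indicator (fun _ => (1 : ℂ)) z.2.1 * A.indicator (fun _ => (1 : ℂ)) z.2.2)
    with hψ
  have hind : ∀ (s : Set unitInterval) y, ‖s.indicator (fun _ => (1 : ℂ)) y‖ ≤ 1 := fun s y => by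
    by_cases h : y ∈ s <;> simp [h]
  have hψ1 : ∀ᵐ z ∂ν, ‖ψ z‖ ≤ 1 := by
    have h0 : ∀ᵐ z ∂ν, z.1 ∈ Set.Ioc α β :=
      Measure.quasiMeasurePreserving_fst.ae (ae_restrict_mem measurableSet_Ioc)
    filter_upwards [h0] with z hz
    simp only [hψ, norm_mul, Complex.norm_real, Real.norm_eq_abs]
    exact mul_le_one₀ (hφ1 _ (Set.Ioc_subset_Icc_self hz)) (by positivity)
      (mul_le_one₀ (hind _ _) (norm_nonneg _) (hind _ _))
  have hkey := sq_norm_integral_le hν1 hψ1 (hGL α β)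
  refine le_trans (le_of_eq ?_) hkey
  congr 2
  have e : ∀ z, ψ z * G z = ∑ i ∈ J, ((φ z.1 : ℂ) * p i z.1) *
      ((A'.indicator (fun σ => (g i σ : ℂ)) z.2.1) * (A.indicator (fun τ => (f i τ : ℂ)) z.2.2)) :=
    fun z => by
      simp only [hψ, hG, Finset.mul_sum]
      refine Finset.sum_congr rfl fun i _ => ?_
      by_cases ha : z.2.2 ∈ A <;> by_cases hb : z.2.1 ∈ A' <;> simp [ha, hb]
      ring
  rw [integral_congr_ae (ae_of_all _ e)]
  have iφ : ∀ i, Integrable (fun ω => (φ ω : ℂ) * p i ω) (volume.restrict (Set.Ioc α β)) :=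
    fun i => (((Complex.continuous_ofReal.comp hφ).mul (hp i)).integrableOn_Icc).mono_set
      Set.Ioc_subset_Icc_self
  have iF : ∀ i, Integrable (A.indicator (fun τ => (f i τ : ℂ))) volume := fun i =>
    (((hf i).integrable (by norm_num)).ofReal).indicator hA
  have iG : ∀ i, Integrable (A'.indicator (fun σ => (g i σ : ℂ))) volume := fun i =>
    (((hg i).integrable (by norm_num)).ofReal).indicator hA'
  rw [integral_finsetSum _ fun i _ => (iφ i).mul_prod ((iG i).mul_prod (iF i))]
  refine Finset.sum_congr rfl fun i _ => ?_
  rw [integral_prod_mul (fun ω => (φ ω : ℂ) * p i ω)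
    (fun y : unitInterval × unitInterval => (A'.indicator (fun σ => (g i σ : ℂ)) y.1) *
      (A.indicator (fun τ => (f i τ : ℂ)) y.2)), integral_prod_mul, integral_indicator hA,
    integral_indicator hA', intervalIntegral.integral_of_le hαβ, integral_complex_ofReal,
    integral_complex_ofReal]
  push_cast
  ring

/-- The complex exponential `e^{-2πiωh}`. -/
def phase (ω : ℝ) (h : ℤ) : ℂ := Complex.exp (-(Complex.I * (2 * Real.pi * ω * h : ℝ)))

lemma norm_phase (ω : ℝ) (h : ℤ) : ‖phase ω h‖ = 1 := by
  unfold phase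
  rw [Complex.norm_exp]
  simp

lemma continuous_phase (h : ℤ) : Continuous fun ω => phase ω h := by
  unfold phase
  fun_prop

lemma phase_mul_conj (ω : ℝ) (s t : ℤ) :
    phase ω s * (starRingEnd ℂ) (phase ω t) = phase ω (s - t) := by
  unfold phase
  rw [← Complex.exp_conj, ← Complex.exp_add]
  congr 1
  simp only [map_neg, map_mul, Complex.conj_I, Complex.conj_ofReal]
  push_cast
  ring

/-! ### The estimator as a quadratic form in the data -/

variable {Ω : Type*} [MeasurableSpace Ω] {X : ℕ → ℤ → RandomL2 Ω}

lemma blockSpectrum_eq (T B K b : ℕ) (ω : ℝ) (x : Ω) (τ σ : unitInterval) :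
    blockSpectrum X T B K b ω x τ σ = ∑ s ∈ Finset.Icc (1 : ℤ) T, ∑ t ∈ Finset.Icc (1 : ℤ) T,
      (pairWeight T B K b s t : ℂ) * phase ω (s - t) *
        (((X T t).val x σ * (X T s).val x τ : ℝ) : ℂ) := by
  unfold blockSpectrum fDFT pairWeight
  simp_rw [map_sum, Finset.sum_mul_sum]
  rw [Finset.sum_comm, Finset.mul_sum]
  refine Finset.sum_congr rfl fun s _ => ?_
  rw [Finset.sum_comm, Finset.mul_sum]
  refine Finset.sum_congr rfl fun t _ => ?_
  rw [← phase_mul_conj]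
  unfold phase
  push_cast
  simp only [Finset.mul_sum, Finset.sum_mul, map_mul, Complex.conj_ofReal]
  refine Finset.sum_congr rfl fun k _ => ?_
  ring

lemma spectrumEstimator_eq {B b : ℕ} (hb : b ∈ Finset.Icc 1 B) (T K : ℕ) (ω : ℝ) (x : Ω)
    (τ σ : unitInterval) :
    spectrumEstimator X T B K ((b : ℝ) / B) ω x τ σ = blockSpectrum X T B K b ω x τ σ := by
  have hB : 0 < B := by
    rw [Finset.mem_Icc] at hb
    omega
  unfold spectrumEstimator
  rw [Finset.sum_eq_single_of_mem b hb]
  -- Blocks of length one place the grid point `b/B` at time `b`. Being closed on the right and open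
  -- on the left, the `b`-th block is the only one that contains it.
  · have h := blockIndicator_div (n := 1) (b := b) hB one_pos (b : ℤ)
    rw [if_pos (by rw [block, Finset.mem_Ioc]; simp), mul_one] at h
    have h' : blockIndicator B b ((b : ℝ) / B) = 1 := by simpa using h
    rw [h']
    simp
  · intro l _ hl
    have h := blockIndicator_div (n := 1) (b := l) hB one_pos (b : ℤ)
    rw [if_neg (by
      rw [block, Finset.mem_Ioc]
      intro h
      apply hl
      have h1 := h.1
      have h2 := h.2
      push_cast at h1 h2
      omega), mul_one] at h
    have h' : blockIndicator B l ((b : ℝ) / B) = 0 := by simpa using h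
    rw [h']
    simp

/-- The coefficients of the demeaned estimator in the `b`-th block. -/
def demeanedWeight (T B K b : ℕ) (s t : ℤ) : ℝ :=
  pairWeight T B K b s t - 1 / (B : ℝ) * ∑ l ∈ Finset.Icc 1 B, pairWeight T B K l s t

lemma sum_demeanedWeight (T B K b : ℕ) (F : ℤ → ℤ → ℂ) :
    ∑ s ∈ Finset.Icc (1 : ℤ) T, ∑ t ∈ Finset.Icc (1 : ℤ) T,
      (pairWeight T B K b s t : ℂ) * F s t - 1 / (B : ℂ) * ∑ l ∈ Finset.Icc 1 B,
        ∑ s ∈ Finset.Icc (1 : ℤ) T, ∑ t ∈ Finset.Icc (1 : ℤ) T,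
          (pairWeight T B K l s t : ℂ) * F s t =
    ∑ i ∈ Finset.Icc (1 : ℤ) T ×ˢ Finset.Icc (1 : ℤ) T,
      (demeanedWeight T B K b i.1 i.2 : ℂ) * F i.1 i.2 := by
  rw [Finset.sum_product, Finset.sum_comm (s := Finset.Icc 1 B), Finset.mul_sum,
    ← Finset.sum_sub_distrib]
  refine Finset.sum_congr rfl fun s _ => ?_
  rw [Finset.sum_comm (s := Finset.Icc 1 B), Finset.mul_sum, ← Finset.sum_sub_distrib]
  refine Finset.sum_congr rfl fun t _ => ?_
  unfold demeanedWeight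
  push_cast
  rw [sub_mul, ← Finset.sum_mul, mul_assoc]

lemma demeanedEstimator_eq {B b : ℕ} (hb : b ∈ Finset.Icc 1 B) (T K : ℕ) (ω : ℝ) (x : Ω)
    (τ σ : unitInterval) :
    demeanedEstimator X T B K b ω x τ σ =
      ∑ i ∈ Finset.Icc (1 : ℤ) T ×ˢ Finset.Icc (1 : ℤ) T,
        (demeanedWeight T B K b i.1 i.2 : ℂ) * phase ω (i.1 - i.2) *
          (((X T i.2).val x σ * (X T i.1).val x τ : ℝ) : ℂ) := by
  unfold demeanedEstimator
  rw [spectrumEstimator_eq hb, Finset.sum_congr rfl fun l hl => spectrumEstimator_eq hl T K ω x τ σ]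
  simp_rw [blockSpectrum_eq, mul_assoc]
  exact sum_demeanedWeight T B K b _

lemma sum_sq_norm_blockStat_le {A A' : Set unitInterval} (hA : MeasurableSet A)
    (hA' : MeasurableSet A') {φ : ℝ → ℝ} (hφ : Continuous φ) {α β ω₁ ω₂ : ℝ} (h1 : ω₁ ≤ α)
    (hαβ : α ≤ β) (h2 : β ≤ ω₂) (hlen : β - α ≤ 1) (hφ1 : ∀ ω ∈ Set.Icc α β, |φ ω| ≤ 1)
    (T B K : ℕ) (x : Ω) {c : ℤ → ℂ} (hc : ∀ h, c h = ∫ ω in α..β, (φ ω : ℂ) * phase ω h) :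
    ∑ b ∈ Finset.Icc 1 B, ‖blockStat X c A A' T B K b x -
      1 / (B : ℂ) * ∑ l ∈ Finset.Icc 1 B, blockStat X c A A' T B K l x‖ ^ 2 ≤
    stationarityStatistic X T B K ω₁ ω₂ x := by
  unfold stationarityStatistic
  refine Finset.sum_le_sum fun b hb => ?_
  simp_rw [demeanedEstimator_eq hb]
  refine le_trans (le_of_eq ?_) (sq_norm_sum_le_integral
    (p := fun i ω => (demeanedWeight T B K b i.1 i.2 : ℂ) * phase ω (i.1 - i.2))
    (Finset.Icc (1 : ℤ) T ×ˢ Finset.Icc (1 : ℤ) T) (fun i => continuous_const.mul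
      (continuous_phase _)) (fun i : ℤ × ℤ => (X T i.1).memLp_val x)
      (fun i : ℤ × ℤ => (X T i.2).memLp_val x) hA hA' hφ h1 hαβ h2 hlen hφ1)
  congr 2
  unfold blockStat
  simp_rw [mul_assoc]
  rw [sum_demeanedWeight]
  refine Finset.sum_congr rfl fun i _ => ?_
  rw [hc, ← mul_assoc, ← intervalIntegral.integral_const_mul]
  congr 1
  refine intervalIntegral.integral_congr fun ω _ => ?_
  ring

end FunctionalTimeSeries

end

noncomputable section

namespace FunctionalTimeSeries

/-! ### The time-varying spectrum -/

/-- Rectangles form a generating π-system. The passage to complements uses that the total integral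
vanishes, the whole square being a rectangle. -/
lemma integral_mul_of_rectangles {g : unitInterval × unitInterval → ℂ} (hg : Integrable g volume)
    (h : ∀ A A' : Set unitInterval, MeasurableSet A → MeasurableSet A' →
      ∫ p in A ×ˢ A', g p = 0) : g =ᵐ[volume] 0 := by
  refine hg.ae_eq_zero_of_forall_setIntegral_eq_zero fun s hs _ => ?_
  have huniv : ∫ p, g p = 0 := by
    have := h Set.univ Set.univ MeasurableSet.univ MeasurableSet.univ
    rwa [Set.univ_prod_univ, setIntegral_univ] at this
  induction s, hs using MeasurableSpace.induction_on_inter generateFrom_prod.symm isPiSystem_prod with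
  | empty => simp
  | basic t ht =>
    obtain ⟨A, hA, A', hA', rfl⟩ := ht
    exact h A A' hA hA'
  | compl t ht ih =>
    have := integral_add_compl ht hg
    rw [huniv, ih (measure_lt_top _ _), zero_add] at this
    exact this
  | iUnion f hd hm ih =>
    rw [integral_iUnion hm hd hg.integrableOn]
    simp [fun i => ih i (measure_lt_top _ _)]

lemma norm_toL2_le {α E : Type*} [MeasureSpace α] [NormedAddCommGroup E] {f : α → E} {c : ℝ}
    (hc : 0 ≤ c) (h : eLpNorm f 2 volume ≤ ENNReal.ofReal c) : ‖toL2 f‖ ≤ c := by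
  unfold toL2
  split_ifs with hf
  · rw [Lp.norm_toLp]
    exact ENNReal.toReal_le_of_le_ofReal hc h
  · rwa [norm_zero]

lemma coeFn_toL2 {α E : Type*} [MeasureSpace α] [NormedAddCommGroup E] {f : α → E}
    (hf : MemLp f 2 volume) : toL2 f =ᵐ[volume] f := by
  unfold toL2
  rw [dif_pos hf]
  exact hf.coeFn_toLp

/-- Passing from real kernels of two arguments to complex kernels on the unit square. -/
def kernelMap (f : Lp ℝ 2 (volume : Measure (Fin 2 → unitInterval))) :
    Lp ℂ 2 (volume : Measure (unitInterval × unitInterval)) :=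
  Complex.ofRealCLM.compLp (Lp.compMeasurePreserving _
    (volume_preserving_finTwoArrow unitInterval).symm f)

lemma continuous_kernelMap : Continuous kernelMap :=
  (Complex.ofRealCLM.compLpL 2 volume).continuous.comp
    (Lp.isometry_compMeasurePreserving _).continuous

lemma norm_kernelMap_le (f : Lp ℝ 2 (volume : Measure (Fin 2 → unitInterval))) :
    ‖kernelMap f‖ ≤ ‖f‖ := by
  unfold kernelMap
  refine (ContinuousLinearMap.norm_compLp_le _ _).trans ?_
  rw [Complex.ofRealCLM_norm, one_mul, Lp.norm_compMeasurePreserving]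

lemma coeFn_kernelMap (f : Lp ℝ 2 (volume : Measure (Fin 2 → unitInterval))) :
    kernelMap f =ᵐ[volume] fun p => (f ![p.1, p.2] : ℂ) := by
  unfold kernelMap
  filter_upwards [Complex.ofRealCLM.coeFn_compLp (Lp.compMeasurePreserving _
    (volume_preserving_finTwoArrow unitInterval).symm f),
    Lp.coeFn_compMeasurePreserving f (volume_preserving_finTwoArrow unitInterval).symm] with p h1 h2
  rw [h1, h2]
  rfl

variable {Ω : Type*} [MeasurableSpace Ω] {μ : Measure Ω}
  {X : ℕ → ℤ → RandomL2 Ω} {S : ℝ → ℤ → RandomL2 Ω}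
  {κ : (m : ℕ) → (Fin m → ℤ) → Lp ℝ 2 (volume : Measure (Fin (m + 1) → unitInterval))}

/-- The covariance kernel at lag `h`, as a cumulant kernel. -/
def covCum (μ : Measure Ω) (S : ℝ → ℤ → RandomL2 Ω) (u : ℝ) (h : ℤ) :
    Lp ℝ 2 (volume : Measure (Fin 2 → unitInterval)) :=
  toL2 (cumKernel μ (fun i => (S u (![h, 0] i)).val))

namespace CumulantMixing

lemma eLpNorm_covCum_le (hX : CumulantMixing μ X S κ) {u : ℝ} (hu : u ∈ Set.Icc (0 : ℝ) 1) (h : ℤ) :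
    eLpNorm (cumKernel μ (fun i => (S u (![h, 0] i)).val)) 2 volume ≤
      ENNReal.ofReal (covBound κ h) := by
  have := hX.cum_stationary 1 le_rfl ![h, 0] u hu
  rwa [lags_pair, sub_zero] at this

lemma cumKernel_ae_eq (hX : CumulantMixing μ X S κ) {u : ℝ} (hu : u ∈ Set.Icc (0 : ℝ) 1) (h : ℤ) :
    cumKernel μ (fun i => (S u (![h, 0] i)).val) =ᵐ[volume]
      momentKernel μ (fun i => S u (![h, 0] i)) :=
  cumKernel_two_ae fun _ => (hX.centered_approx u hu _).2

variable [IsProbabilityMeasure μ]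

/-- The cumulant bound gives a finite norm and Fubini gives measurability, so `toL2` does not take
its default value `0` here. -/
lemma coeFn_covCum (hX : CumulantMixing μ X S κ) {u : ℝ} (hu : u ∈ Set.Icc (0 : ℝ) 1) (h : ℤ) :
    covCum μ S u h =ᵐ[volume] momentKernel μ (fun i => S u (![h, 0] i)) := by
  have hae := hX.cumKernel_ae_eq hu h
  have hm : AEStronglyMeasurable (momentKernel μ (fun i => S u (![h, 0] i))) volume :=
    (integrable_momentKernel fun i => (hX.centered_approx u hu _).1).1
  exact (coeFn_toL2 ⟨hm.congr hae.symm, (hX.eLpNorm_covCum_le hu h).trans_lt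
    ENNReal.ofReal_lt_top⟩).trans hae

lemma kernelMap_ae_eq (hX : CumulantMixing μ X S κ) {u : ℝ} (hu : u ∈ Set.Icc (0 : ℝ) 1) (h : ℤ) :
    kernelMap (covCum μ S u h) =ᵐ[volume]
      fun p => ((∫ x, (S u h).val x p.1 * (S u 0).val x p.2 ∂μ : ℝ) : ℂ) := by
  have h2 := (volume_preserving_finTwoArrow unitInterval).symm.quasiMeasurePreserving.ae
    (hX.coeFn_covCum hu h)
  filter_upwards [coeFn_kernelMap (covCum μ S u h), h2] with p hp1 hp2
  rw [hp1]
  congr 1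
  refine Eq.trans hp2 ?_
  simp [momentKernel, Fin.prod_univ_two, MeasurableEquiv.finTwoArrow]

lemma covKernel_eq (hX : CumulantMixing μ X S κ) {u : ℝ} (hu : u ∈ Set.Icc (0 : ℝ) 1) (h : ℤ) :
    covKernel μ S u h = kernelMap (covCum μ S u h) := by
  have hae := hX.kernelMap_ae_eq hu h
  have hm : MemLp (fun p : unitInterval × unitInterval =>
      ((∫ x, (S u h).val x p.1 * (S u 0).val x p.2 ∂μ : ℝ) : ℂ)) 2 volume :=
    (memLp_congr_ae hae).1 (Lp.memLp _)
  exact Lp.ext ((coeFn_toL2 hm).trans hae.symm)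

lemma norm_covKernel_le (hX : CumulantMixing μ X S κ) {u : ℝ} (hu : u ∈ Set.Icc (0 : ℝ) 1) (h : ℤ) :
    ‖covKernel μ S u h‖ ≤ covBound κ h := by
  rw [hX.covKernel_eq hu]
  exact (norm_kernelMap_le _).trans (norm_toL2_le (covBound_nonneg h) (hX.eLpNorm_covCum_le hu h))

/-- Differentiability of the second cumulant in rescaled time gives continuity in `L²`, which
`kernelMap` transports to the complex kernel. -/
lemma continuousOn_covKernel (hX : CumulantMixing μ X S κ) (h : ℤ) :
    ContinuousOn (fun u => covKernel μ S u h) (Set.Icc 0 1) := by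
  have h1 : ContinuousOn (fun u => covCum μ S u h) (Set.Icc 0 1) := fun u hu => by
    obtain ⟨D, hD, -⟩ := hX.cum_deriv 1 le_rfl ![h, 0] u hu
    exact hD.continuousWithinAt
  exact (continuous_kernelMap.comp_continuousOn h1).congr fun u hu => hX.covKernel_eq hu h

end CumulantMixing

/-- Integration over the rectangle `A × A'`, as a functional on complex kernels. -/
def rectangle (A A' : Set unitInterval) (hA : MeasurableSet A) (hA' : MeasurableSet A') :
    Lp ℂ 2 (volume : Measure (unitInterval × unitInterval)) →L[ℂ] ℂ :=
  innerSL ℂ (indicatorConstLp 2 (hA.prod hA') (measure_ne_top volume _) (1 : ℂ))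

lemma rectangle_apply {A A' : Set unitInterval} (hA : MeasurableSet A) (hA' : MeasurableSet A')
    (f : Lp ℂ 2 (volume : Measure (unitInterval × unitInterval))) :
    rectangle A A' hA hA' f = ∫ p in A ×ˢ A', f p := by
  unfold rectangle
  rw [innerSL_apply_apply, L2.inner_indicatorConstLp_one]

namespace CumulantMixing

variable [IsProbabilityMeasure μ]

lemma rectangle_covKernel (hX : CumulantMixing μ X S κ) {u : ℝ} (hu : u ∈ Set.Icc (0 : ℝ) 1)
    {A A' : Set unitInterval} (hA : MeasurableSet A) (hA' : MeasurableSet A') (h : ℤ) :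
    rectangle A A' hA hA' (covKernel μ S u h) = (avgCov μ S A A' u h : ℂ) := by
  rw [rectangle_apply, hX.covKernel_eq hu, setIntegral_congr_ae (hA.prod hA')
    ((hX.kernelMap_ae_eq hu h).mono fun p hp _ => hp), integral_complex_ofReal]
  congr 1
  have h1 := setIntegral_momentKernel (μ := μ) (Z := fun i => S u (![h, 0] i))
    (fun i => (hX.centered_approx u hu _).1) ![A, A']
  have h2 := (volume_preserving_finTwoArrow unitInterval).symm.setIntegral_preimage_emb
    (MeasurableEquiv.measurableEmbedding _) (momentKernel μ (fun i => S u (![h, 0] i)))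
    (Set.univ.pi ![A, A'])
  rw [h1] at h2
  have e : (MeasurableEquiv.finTwoArrow (α := unitInterval)).symm ⁻¹' (Set.univ.pi ![A, A']) =
      A ×ˢ A' := by
    ext p
    simp [Set.mem_pi, Fin.forall_fin_two, MeasurableEquiv.finTwoArrow]
  rw [e] at h2
  unfold avgCov
  simpa [momentKernel, Fin.prod_univ_two, MeasurableEquiv.finTwoArrow] using h2

lemma continuousOn_avgCov (hX : CumulantMixing μ X S κ)
    {A A' : Set unitInterval} (hA : MeasurableSet A) (hA' : MeasurableSet A') (h : ℤ) :
    ContinuousOn (fun u => (avgCov μ S A A' u h : ℂ)) (Set.Icc 0 1) :=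
  ((rectangle A A' hA hA').continuous.comp_continuousOn (hX.continuousOn_covKernel h)).congr
    fun _ hu => (hX.rectangle_covKernel hu hA hA' h).symm

lemma norm_phase_smul_covKernel_le (hX : CumulantMixing μ X S κ) {u : ℝ}
    (hu : u ∈ Set.Icc (0 : ℝ) 1) (ω : ℝ) (h : ℤ) :
    ‖phase ω h • covKernel μ S u h‖ ≤ covBound κ h := by
  rw [norm_smul, norm_phase, one_mul]
  exact hX.norm_covKernel_le hu h

lemma hasSum_spectralKernel (hX : CumulantMixing μ X S κ) {u : ℝ} (hu : u ∈ Set.Icc (0 : ℝ) 1)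
    (ω : ℝ) : HasSum (fun h => phase ω h • covKernel μ S u h) (spectralKernel μ S u ω) :=
  (hX.summable_covBound.of_norm_bounded (hX.norm_phase_smul_covKernel_le hu ω)).hasSum

lemma continuousOn_spectralKernel (hX : CumulantMixing μ X S κ) (ω : ℝ) :
    ContinuousOn (fun u => spectralKernel μ S u ω) (Set.Icc 0 1) :=
  continuousOn_tsum (fun h => (hX.continuousOn_covKernel h).const_smul (phase ω h))
    hX.summable_covBound fun h _ hu => hX.norm_phase_smul_covKernel_le hu ω h

lemma norm_avgCov_le (hX : CumulantMixing μ X S κ) {u : ℝ} (hu : u ∈ Set.Icc (0 : ℝ) 1)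
    (A A' : Set unitInterval) (h : ℤ) : ‖(avgCov μ S A A' u h : ℂ)‖ ≤ covBound κ h := by
  rw [Complex.norm_real]
  exact hX.abs_avgCov_le hu A A' h

end CumulantMixing

lemma hasSum_intervalIntegral_of_continuousOn {a b : ℝ} (hab : a ≤ b) {f : ℤ → ℝ → ℂ} {M : ℤ → ℝ}
    (hM : Summable M) (hf : ∀ h, ContinuousOn (f h) (Set.Icc a b))
    (hb : ∀ h, ∀ y ∈ Set.Icc a b, ‖f h y‖ ≤ M h) :
    HasSum (fun h => ∫ y in a..b, f h y) (∫ y in a..b, ∑' h, f h y) := by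
  refine intervalIntegral.hasSum_integral_of_dominated_convergence (fun h _ => M h) (fun h => ?_)
    (fun h => ae_of_all _ fun y hy => hb h y ?_) (ae_of_all _ fun y _ => hM)
    intervalIntegrable_const (ae_of_all _ fun y hy => ?_)
  · rw [Set.uIoc_of_le hab]
    exact ((hf h).mono Set.Ioc_subset_Icc_self).aestronglyMeasurable measurableSet_Ioc
  · rw [Set.uIoc_of_le hab] at hy
    exact Set.Ioc_subset_Icc_self hy
  · rw [Set.uIoc_of_le hab] at hy
    exact (hM.of_norm_bounded fun h => hb h y (Set.Ioc_subset_Icc_self hy)).hasSum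

/-- The demeaned covariance at lag `h` of the averages over `A` and `A'`. -/
def demeanedCov (μ : Measure Ω) (S : ℝ → ℤ → RandomL2 Ω) (A A' : Set unitInterval) (u : ℝ) (h : ℤ) :
    ℂ :=
  avgCov μ S A A' u h - ∫ v in (0 : ℝ)..1, (avgCov μ S A A' v h : ℂ)

namespace CumulantMixing

variable [IsProbabilityMeasure μ]

lemma norm_demeanedCov_le (hX : CumulantMixing μ X S κ) {u : ℝ} (hu : u ∈ Set.Icc (0 : ℝ) 1)
    (A A' : Set unitInterval) (h : ℤ) : ‖demeanedCov μ S A A' u h‖ ≤ 2 * covBound κ h := by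
  unfold demeanedCov
  have h1 := hX.norm_avgCov_le hu A A' h
  have h2 : ‖∫ v in (0 : ℝ)..1, (avgCov μ S A A' v h : ℂ)‖ ≤ covBound κ h * |1 - 0| :=
    intervalIntegral.norm_integral_le_of_norm_le_const fun v hv => by
      rw [Set.uIoc_of_le zero_le_one] at hv
      exact hX.norm_avgCov_le (Set.Ioc_subset_Icc_self hv) A A' h
  rw [sub_zero, abs_one, mul_one] at h2
  exact (norm_sub_le _ _).trans (by linarith)

lemma rectangle_spectralKernel (hX : CumulantMixing μ X S κ) {u : ℝ} (hu : u ∈ Set.Icc (0 : ℝ) 1)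
    {A A' : Set unitInterval} (hA : MeasurableSet A) (hA' : MeasurableSet A') (ω : ℝ) :
    HasSum (fun h => phase ω h * (avgCov μ S A A' u h : ℂ))
      (rectangle A A' hA hA' (spectralKernel μ S u ω)) := by
  have := (rectangle A A' hA hA').hasSum (hX.hasSum_spectralKernel hu ω)
  refine this.congr_fun fun h => ?_
  rw [map_smul, hX.rectangle_covKernel hu, smul_eq_mul]

lemma hasSum_integral_mul_avgCov (hX : CumulantMixing μ X S κ)
    {A A' : Set unitInterval} (hA : MeasurableSet A) (hA' : MeasurableSet A') {c : ℤ → ℂ}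
    {C : ℝ} (hc : ∀ h, ‖c h‖ ≤ C) :
    HasSum (fun h => c h * ∫ v in (0 : ℝ)..1, (avgCov μ S A A' v h : ℂ))
      (∫ v in (0 : ℝ)..1, ∑' h, c h * (avgCov μ S A A' v h : ℂ)) := by
  have := hasSum_intervalIntegral_of_continuousOn (f := fun h v => c h * (avgCov μ S A A' v h : ℂ))
    zero_le_one (hX.summable_covBound.mul_left C)
    (fun h => (hX.continuousOn_avgCov hA hA' h).const_smul (c h)) fun h v hv => by
      rw [norm_mul]
      exact mul_le_mul (hc h) (hX.norm_avgCov_le hv A A' h) (norm_nonneg _)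
        ((norm_nonneg _).trans (hc h))
  simpa only [intervalIntegral.integral_const_mul] using this

/-- A continuous linear functional commutes with the sum over lags and with the integral over `v`;
dominated convergence interchanges these two. -/
lemma rectangle_demeanedSpectrum (hX : CumulantMixing μ X S κ) {u : ℝ}
    (hu : u ∈ Set.Icc (0 : ℝ) 1)
    {A A' : Set unitInterval} (hA : MeasurableSet A) (hA' : MeasurableSet A') (ω : ℝ) :
    HasSum (fun h => phase ω h * demeanedCov μ S A A' u h)
      (rectangle A A' hA hA' (demeanedSpectrum μ S u ω)) := by
  unfold demeanedSpectrum demeanedCov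
  rw [map_sub]
  simp_rw [mul_sub]
  refine (hX.rectangle_spectralKernel hu hA hA' ω).sub ?_
  have hint : IntervalIntegrable (fun v => spectralKernel μ S v ω) volume 0 1 := by
    refine ContinuousOn.intervalIntegrable ?_
    rw [Set.uIcc_of_le zero_le_one]
    exact hX.continuousOn_spectralKernel ω
  rw [← (rectangle A A' hA hA').intervalIntegral_comp_comm hint]
  have h1 := hX.hasSum_integral_mul_avgCov hA hA' (c := phase ω) (C := 1)
    fun h => (norm_phase ω h).le
  have h2 : ∫ v in (0 : ℝ)..1, rectangle A A' hA hA' (spectralKernel μ S v ω) =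
      ∫ v in (0 : ℝ)..1, ∑' h, phase ω h * (avgCov μ S A A' v h : ℂ) := by
    refine intervalIntegral.integral_congr fun v hv => ?_
    rw [Set.uIcc_of_le zero_le_one] at hv
    exact (hX.rectangle_spectralKernel hv hA hA' ω).tsum_eq.symm
  rw [h2]
  exact h1

lemma continuousOn_popStat (hX : CumulantMixing μ X S κ)
    {A A' : Set unitInterval} (hA : MeasurableSet A) (hA' : MeasurableSet A') {c : ℤ → ℂ}
    {C : ℝ} (hc : ∀ h, ‖c h‖ ≤ C) : ContinuousOn (popStat μ S c A A') (Set.Icc 0 1) :=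
  continuousOn_tsum (fun h => (hX.continuousOn_avgCov hA hA' h).const_smul (c h))
    (hX.summable_covBound.mul_left C) fun h v hv => by
      refine (norm_mul_le _ _).trans ?_
      exact mul_le_mul (hc h) (hX.norm_avgCov_le hv A A' h) (norm_nonneg _)
        ((norm_nonneg _).trans (hc h))

lemma popStat_sub_integral (hX : CumulantMixing μ X S κ) {u : ℝ} (hu : u ∈ Set.Icc (0 : ℝ) 1)
    {A A' : Set unitInterval} (hA : MeasurableSet A) (hA' : MeasurableSet A') {c : ℤ → ℂ}
    (hc : Summable fun h => ‖c h‖) :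
    popStat μ S c A A' u - ∫ v in (0 : ℝ)..1, popStat μ S c A A' v =
      ∑' h, c h * demeanedCov μ S A A' u h := by
  have h1 := (hX.summable_mul_avgCov hu A A' hc).hasSum
  have h2 := hX.hasSum_integral_mul_avgCov hA hA' (c := c) (C := ∑' h, ‖c h‖)
    fun h => hc.le_tsum h fun _ _ => norm_nonneg _
  have h3 := (h1.sub h2).tsum_eq
  unfold demeanedCov
  simp_rw [mul_sub]
  exact h3.symm

end CumulantMixing

/-- Otherwise the set in `halt` would lie on the two lines `ω = ω₁` and `ω = ω₂`, which are null. A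
frequency in the open band leaves room for a bump around it. -/
lemma exists_demeanedSpectrum_ne_zero {ω₁ ω₂ : ℝ}
    (halt : 0 < volume {q : ℝ × ℝ | q.1 ∈ Set.Icc (0 : ℝ) 1 ∧ q.2 ∈ Set.Icc ω₁ ω₂ ∧
      0 < volume {p : unitInterval × unitInterval | demeanedSpectrum μ S q.1 q.2 p ≠ 0}}) :
    ∃ u ∈ Set.Icc (0 : ℝ) 1, ∃ ω ∈ Set.Ioo ω₁ ω₂, demeanedSpectrum μ S u ω ≠ 0 := by
  by_contra! hcon
  refine halt.ne' (measure_mono_null (t := Set.univ ×ˢ {ω₁, ω₂}) ?_ ?_)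
  · rintro ⟨u, ω⟩ ⟨hu, hω, hpos⟩
    simp only at hu hω hpos
    refine ⟨Set.mem_univ _, ?_⟩
    by_contra hne
    simp only [Set.mem_insert_iff, Set.mem_singleton_iff, not_or] at hne
    have h0 := hcon u hu ω ⟨lt_of_le_of_ne hω.1 (Ne.symm hne.1), lt_of_le_of_ne hω.2 hne.2⟩
    rw [h0] at hpos
    refine hpos.ne' ?_
    have := Lp.coeFn_zero ℂ 2 (volume : Measure (unitInterval × unitInterval))
    exact this
  · rw [Measure.volume_eq_prod, Measure.prod_prod,
      (Set.toFinite ({ω₁, ω₂} : Set ℝ)).measure_zero volume, mul_zero]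

lemma exists_rectangle_ne_zero {f : Lp ℂ 2 (volume : Measure (unitInterval × unitInterval))}
    (hf : f ≠ 0) : ∃ (A A' : Set unitInterval) (hA : MeasurableSet A) (hA' : MeasurableSet A'),
      rectangle A A' hA hA' f ≠ 0 := by
  by_contra! hcon
  refine hf ((Lp.eq_zero_iff_ae_eq_zero).2 (integral_mul_of_rectangles
    ((Lp.memLp f).integrable (by norm_num)) fun A A' hA hA' => ?_))
  rw [← rectangle_apply hA hA']
  exact hcon A A' hA hA'

end FunctionalTimeSeries

end

noncomputable section

namespace FunctionalTimeSeries

/-! ### A test function in frequency -/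

/-- A quadratic bump on the interval `[α, β]`. -/
def bump (α β ω : ℝ) : ℝ := (ω - α) * (β - ω)

lemma continuous_bump (α β : ℝ) : Continuous (bump α β) := by
  unfold bump
  fun_prop

/-- The Fourier coefficients of the bump. -/
def bumpCoeff (α β : ℝ) (h : ℤ) : ℂ := ∫ ω in α..β, (bump α β ω : ℂ) * phase ω h

/-- Repeated integration by parts ends after `1/a³`, the bump being quadratic. It vanishes at both
endpoints, so the `1/a` boundary terms disappear and the decay is `h⁻²`; an indicator would give
`h⁻¹`, which is not summable. -/
lemma bumpCoeff_eq (α β : ℝ) {h : ℤ} (hh : h ≠ 0) : ∃ a : ℂ, ‖a‖ = 2 * Real.pi * |(h : ℝ)| ∧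
    bumpCoeff α β h = phase β h * ((β - α) / a ^ 2 - 2 / a ^ 3) -
      phase α h * (-(β - α) / a ^ 2 - 2 / a ^ 3) := by
  set a : ℂ := -(Complex.I * (2 * Real.pi * h : ℝ)) with ha
  have hna : ‖a‖ = 2 * Real.pi * |(h : ℝ)| := by
    rw [ha, norm_neg, norm_mul, Complex.norm_I, one_mul, Complex.norm_real, Real.norm_eq_abs,
      abs_mul, abs_of_pos (by positivity)]
  have ha0 : a ≠ 0 := by
    rw [← norm_pos_iff, hna]
    have : (h : ℝ) ≠ 0 := by exact_mod_cast hh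
    positivity
  have hph : ∀ ω : ℝ, phase ω h = Complex.exp (a * ω) := fun ω => by
    unfold phase
    rw [ha]
    congr 1
    push_cast
    ring
  refine ⟨a, hna, ?_⟩
  -- With `p` the bump, the antiderivative is `e^{aω} (p/a - p'/a² + p''/a³)`, where `p' = α + β -
  -- 2ω` and `p'' = -2`.
  have hderiv : ∀ ω ∈ Set.uIcc α β, HasDerivAt (fun ω : ℝ => Complex.exp (a * ω) *
      (((ω - α) * (β - ω) : ℂ) / a - (α + β - 2 * ω) / a ^ 2 - 2 / a ^ 3))
      ((bump α β ω : ℂ) * phase ω h) ω := fun ω _ => by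
    have h1 : HasDerivAt (fun ω : ℝ => (ω : ℂ)) 1 ω := Complex.ofRealCLM.hasDerivAt
    have h2 : HasDerivAt (fun ω : ℝ => Complex.exp (a * ω)) (Complex.exp (a * ω) * (a * 1)) ω :=
      (h1.const_mul a).cexp
    have h3 := (h1.sub_const (α : ℂ)).mul (h1.const_sub (β : ℂ))
    have h4 : HasDerivAt (fun ω : ℝ => (α + β - 2 * ω : ℂ)) (-(2 * 1)) ω :=
      (h1.const_mul 2).const_sub _
    have h5 := h2.mul (((h3.div_const a).sub (h4.div_const (a ^ 2))).sub_const (2 / a ^ 3))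
    convert! h5 using 1
    rw [hph]
    unfold bump
    simp only [Pi.mul_apply, Pi.sub_apply]
    push_cast
    field_simp
    ring
  unfold bumpCoeff
  rw [intervalIntegral.integral_eq_sub_of_hasDerivAt hderiv]
  · rw [hph, hph]
    ring
  · refine Continuous.intervalIntegrable ?_ _ _
    exact (Complex.continuous_ofReal.comp (continuous_bump α β)).mul (continuous_phase h)

lemma norm_bumpCoeff_le {α β : ℝ} {h : ℤ} (hh : h ≠ 0) :
    ‖bumpCoeff α β h‖ ≤ (2 * |β - α| + 4) * (1 / |(h : ℝ)| ^ 2) := by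
  obtain ⟨a, hna, he⟩ := bumpCoeff_eq α β hh
  have h1 : (1 : ℝ) ≤ |(h : ℝ)| := by exact_mod_cast Int.one_le_abs hh
  have ha : |(h : ℝ)| ≤ ‖a‖ := by
    rw [hna]
    have := Real.pi_gt_three
    nlinarith
  have hpos : 0 < |(h : ℝ)| := by linarith
  have hterm : ∀ z : ℂ, ‖z‖ = |β - α| → ‖z / a ^ 2 - 2 / a ^ 3‖ ≤
      (|β - α| + 2) * (1 / |(h : ℝ)| ^ 2) := fun z hz => by
    refine (norm_sub_le _ _).trans ?_
    rw [norm_div, norm_div, norm_pow, norm_pow, hz, Complex.norm_two, add_mul, mul_one_div,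
      mul_one_div]
    have h3 : |(h : ℝ)| ^ 2 ≤ ‖a‖ ^ 3 := by
      calc |(h : ℝ)| ^ 2 ≤ ‖a‖ ^ 2 := by gcongr
        _ ≤ ‖a‖ ^ 3 := pow_le_pow_right₀ (h1.trans ha) (by norm_num)
    gcongr
  rw [he]
  have hz1 : ‖((β : ℂ) - α)‖ = |β - α| := by
    rw [← Complex.ofReal_sub, Complex.norm_real, Real.norm_eq_abs]
  refine (norm_sub_le _ _).trans ?_
  rw [norm_mul, norm_mul, norm_phase, norm_phase, one_mul, one_mul]
  have e1 := hterm _ hz1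
  have e2 := hterm (-((β : ℂ) - α)) (by rw [norm_neg, hz1])
  linarith

lemma summable_bumpCoeff (α β : ℝ) : Summable fun h => ‖bumpCoeff α β h‖ := by
  have h1 : Summable fun h : ℤ => (2 * |β - α| + 4) * (1 / |(h : ℝ)| ^ 2) := by
    have := (Real.summable_one_div_int_pow (p := 2)).2 one_lt_two
    simpa only [sq_abs] using this.mul_left (2 * |β - α| + 4)
  refine h1.of_norm_bounded_eventually (f := fun h => ‖bumpCoeff α β h‖) ?_
  rw [Filter.eventually_cofinite]
  refine (Set.finite_singleton (0 : ℤ)).subset fun h hh => ?_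
  by_contra hne
  exact hh (by rw [norm_norm]; exact norm_bumpCoeff_le hne)

/-- Rotating by the conjugate of `G ω₀` makes the real part positive at `ω₀`, hence nearby. Against
a nonnegative bump with small enough support nothing can cancel. -/
lemma exists_integral_bump_ne_zero {G : ℝ → ℂ} (hG : Continuous G) {ω₀ ω₁ ω₂ : ℝ}
    (hω : ω₀ ∈ Set.Ioo ω₁ ω₂) (h0 : G ω₀ ≠ 0) : ∃ α β : ℝ, ω₁ ≤ α ∧ α < β ∧ β ≤ ω₂ ∧ β - α ≤ 1 ∧
      ∫ ω in α..β, (bump α β ω : ℂ) * G ω ≠ 0 := by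
  set r : ℝ → ℝ := fun ω => ((starRingEnd ℂ) (G ω₀) * G ω).re with hr
  have hrc : Continuous r := Complex.continuous_re.comp (continuous_const.mul hG)
  have hr0 : 0 < r ω₀ := by
    simp only [hr]
    rw [mul_comm, Complex.mul_conj, Complex.ofReal_re]
    exact Complex.normSq_pos.2 h0
  obtain ⟨δ, hδ, hball⟩ := Metric.eventually_nhds_iff.1
    (hrc.continuousAt.eventually (lt_mem_nhds hr0))
  set η := min (min δ (1 / 2)) (min (ω₀ - ω₁) (ω₂ - ω₀)) / 2 with hη
  have hmin : 0 < min (min δ (1 / 2)) (min (ω₀ - ω₁) (ω₂ - ω₀)) :=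
    lt_min (lt_min hδ (by norm_num)) (lt_min (by linarith [hω.1]) (by linarith [hω.2]))
  have b1 : min (min δ (1 / 2)) (min (ω₀ - ω₁) (ω₂ - ω₀)) ≤ δ :=
    (min_le_left _ _).trans (min_le_left _ _)
  have b2 : min (min δ (1 / 2)) (min (ω₀ - ω₁) (ω₂ - ω₀)) ≤ 1 / 2 :=
    (min_le_left _ _).trans (min_le_right _ _)
  have b3 : min (min δ (1 / 2)) (min (ω₀ - ω₁) (ω₂ - ω₀)) ≤ ω₀ - ω₁ :=
    (min_le_right _ _).trans (min_le_left _ _)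
  have b4 : min (min δ (1 / 2)) (min (ω₀ - ω₁) (ω₂ - ω₀)) ≤ ω₂ - ω₀ :=
    (min_le_right _ _).trans (min_le_right _ _)
  refine ⟨ω₀ - η, ω₀ + η, by linarith, by linarith, by linarith, by linarith, fun hzero => ?_⟩
  have hlt : ω₀ - η < ω₀ + η := by linarith
  have hcont : Continuous fun ω => (bump (ω₀ - η) (ω₀ + η) ω : ℂ) * G ω :=
    (Complex.continuous_ofReal.comp (continuous_bump _ _)).mul hG
  have hre : ∫ ω in (ω₀ - η)..(ω₀ + η), bump (ω₀ - η) (ω₀ + η) ω * r ω = 0 := by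
    have hI : IntervalIntegrable (fun ω => (starRingEnd ℂ) (G ω₀) *
        ((bump (ω₀ - η) (ω₀ + η) ω : ℂ) * G ω)) volume (ω₀ - η) (ω₀ + η) :=
      (continuous_const.mul hcont).intervalIntegrable _ _
    have h1 := Complex.reCLM.intervalIntegral_comp_comm hI
    rw [intervalIntegral.integral_const_mul, hzero, mul_zero, map_zero] at h1
    rw [← h1]
    refine intervalIntegral.integral_congr fun ω _ => ?_
    simp only [hr, Complex.reCLM_apply]
    rw [mul_left_comm, Complex.re_ofReal_mul]
  have hpos : 0 < ∫ ω in (ω₀ - η)..(ω₀ + η), bump (ω₀ - η) (ω₀ + η) ω * r ω := by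
    have hrpos : ∀ ω ∈ Set.Ioc (ω₀ - η) (ω₀ + η), 0 < r ω := fun ω hω => by
      apply hball
      rw [Real.dist_eq, abs_lt]
      constructor <;> linarith [hω.1, hω.2]
    refine intervalIntegral.integral_pos hlt ((continuous_bump _ _).mul hrc).continuousOn
      (fun ω hω => mul_nonneg ?_ (hrpos ω hω).le) ⟨ω₀, ⟨by linarith, by linarith⟩, mul_pos ?_ hr0⟩
    · exact mul_nonneg (by linarith [hω.1]) (by linarith [hω.2])
    · exact mul_pos (by linarith) (by linarith)
  exact hpos.ne' hre

lemma abs_bump_le_one {α β ω : ℝ} (hω : ω ∈ Set.Icc α β) (hlen : β - α ≤ 1) :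
    |bump α β ω| ≤ 1 := by
  unfold bump
  rw [abs_of_nonneg (mul_nonneg (by linarith [hω.1]) (by linarith [hω.2]))]
  exact mul_le_one₀ (by linarith [hω.2]) (by linarith [hω.2]) (by linarith [hω.1])

variable {Ω : Type*} [MeasurableSpace Ω] {μ : Measure Ω}
  {X : ℕ → ℤ → RandomL2 Ω} {S : ℝ → ℤ → RandomL2 Ω}
  {κ : (m : ℕ) → (Fin m → ℤ) → Lp ℝ 2 (volume : Measure (Fin (m + 1) → unitInterval))}

/-- The deviation of `popStat` from its mean is the integral, against the bump, of the rectangle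
pairing of the demeaned spectrum, which is continuous in frequency and nonzero at `ω₀`. -/
lemma CumulantMixing.exists_popStat_ne [IsProbabilityMeasure μ] (hX : CumulantMixing μ X S κ)
    {ω₁ ω₂ : ℝ} (halt : 0 < volume {q : ℝ × ℝ | q.1 ∈ Set.Icc (0 : ℝ) 1 ∧ q.2 ∈ Set.Icc ω₁ ω₂ ∧
      0 < volume {p : unitInterval × unitInterval | demeanedSpectrum μ S q.1 q.2 p ≠ 0}}) :
    ∃ (α β : ℝ) (A A' : Set unitInterval), ω₁ ≤ α ∧ α < β ∧ β ≤ ω₂ ∧ β - α ≤ 1 ∧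
      MeasurableSet A ∧ MeasurableSet A' ∧ ∃ u ∈ Set.Icc (0 : ℝ) 1,
        popStat μ S (bumpCoeff α β) A A' u ≠
          ∫ v in (0 : ℝ)..1, popStat μ S (bumpCoeff α β) A A' v := by
  obtain ⟨u, hu, ω₀, hω₀, hne⟩ := exists_demeanedSpectrum_ne_zero halt
  obtain ⟨A, A', hA, hA', hr⟩ := exists_rectangle_ne_zero hne
  have hM : Summable fun h => 2 * covBound κ h := hX.summable_covBound.mul_left 2
  have hb : ∀ ω h, ‖phase ω h * demeanedCov μ S A A' u h‖ ≤ 2 * covBound κ h := fun ω h => by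
    rw [norm_mul, norm_phase, one_mul]
    exact hX.norm_demeanedCov_le hu A A' h
  have hG : Continuous fun ω => ∑' h, phase ω h * demeanedCov μ S A A' u h :=
    continuous_tsum (fun h => (continuous_phase h).mul continuous_const) hM fun h ω => hb ω h
  rw [← (hX.rectangle_demeanedSpectrum hu hA hA' ω₀).tsum_eq] at hr
  obtain ⟨α, β, h1, h2, h3, h4, h5⟩ := exists_integral_bump_ne_zero hG hω₀ hr
  refine ⟨α, β, A, A', h1, h2, h3, h4, hA, hA', u, hu, sub_ne_zero.1 ?_⟩
  rw [hX.popStat_sub_integral hu hA hA' (summable_bumpCoeff α β)]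
  convert h5 using 1
  have hs := hasSum_intervalIntegral_of_continuousOn h2.le (M := fun h => 2 * covBound κ h)
    (f := fun h ω => (bump α β ω : ℂ) * phase ω h * demeanedCov μ S A A' u h) hM
    (fun h => (((Complex.continuous_ofReal.comp (continuous_bump α β)).mul
      (continuous_phase h)).mul continuous_const).continuousOn) fun h ω hω => by
        rw [mul_assoc, norm_mul, Complex.norm_real, Real.norm_eq_abs]
        exact (mul_le_of_le_one_left (norm_nonneg _) (abs_bump_le_one hω h4)).trans (hb ω h)
  simp only [intervalIntegral.integral_mul_const] at hs
  refine hs.tsum_eq.trans (intervalIntegral.integral_congr fun ω _ => ?_)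
  simp only [mul_assoc]
  rw [tsum_mul_left]

/-! ### Riemann sums -/

/-- General values are allowed because the limit is needed twice: for the complex function
`popStat`, and for the real function measuring its distance from its mean. -/
lemma tendsto_riemann_sum {E : Type*} [NormedAddCommGroup E] [NormedSpace ℝ E] [CompleteSpace E]
    {f : ℝ → E} (hf : ContinuousOn f (Set.Icc 0 1)) :
    Tendsto (fun n : ℕ => (1 / (n : ℝ)) • ∑ b ∈ Finset.Icc 1 n, f ((b : ℝ) / n)) atTop
      (𝓝 (∫ v in (0 : ℝ)..1, f v)) := by
  rw [Metric.tendsto_nhds]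
  intro ε hε
  obtain ⟨δ, hδ, hfδ⟩ := Metric.uniformContinuousOn_iff.1
    (isCompact_Icc.uniformContinuousOn_of_continuous hf) (ε / 2) (half_pos hε)
  have hlim := tendsto_one_div_atTop_nhds_zero_nat (𝕜 := ℝ)
  filter_upwards [eventually_gt_atTop 0, hlim.eventually (gt_mem_nhds hδ)] with n hn hnδ
  have hn' : (0 : ℝ) < n := by exact_mod_cast hn
  have hsub : ∀ i < n, Set.Icc ((i : ℝ) / n) (((i + 1 : ℕ) : ℝ) / n) ⊆ Set.Icc 0 1 := fun i hi => by
    refine Set.Icc_subset_Icc (by positivity) (div_le_one_of_le₀ ?_ hn'.le)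
    exact_mod_cast hi
  have hle : ∀ i : ℕ, (i : ℝ) / n ≤ ((i + 1 : ℕ) : ℝ) / n := fun i => by
    gcongr
    exact_mod_cast i.le_succ
  have hint : ∀ i < n, IntervalIntegrable f volume ((i : ℝ) / n) (((i + 1 : ℕ) : ℝ) / n) :=
    fun i hi => ContinuousOn.intervalIntegrable (by
      rw [Set.uIcc_of_le (hle i)]
      exact hf.mono (hsub i hi))
  have hsum := intervalIntegral.sum_integral_adjacent_intervals (a := fun i : ℕ => (i : ℝ) / n) hint
  simp only [Nat.cast_zero, zero_div, div_self hn'.ne'] at hsum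
  have hlen : ∀ i : ℕ, ((i + 1 : ℕ) : ℝ) / n - (i : ℝ) / n = 1 / n := fun i => by
    push_cast
    ring
  have hre : ∑ b ∈ Finset.Icc 1 n, f ((b : ℝ) / n) =
      ∑ i ∈ Finset.range n, f (((i + 1 : ℕ) : ℝ) / n) := by
    rw [Finset.range_eq_Ico, Finset.sum_Ico_add' (fun b : ℕ => f ((b : ℝ) / n)) 0 n 1, zero_add]
    rfl
  rw [dist_eq_norm, ← hsum, hre, Finset.smul_sum, ← Finset.sum_sub_distrib]
  have hterm : ∀ i ∈ Finset.range n, ‖(1 / (n : ℝ)) • f (((i + 1 : ℕ) : ℝ) / n) -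
      ∫ v in (i : ℝ) / n..((i + 1 : ℕ) : ℝ) / n, f v‖ ≤ ε / 2 * (1 / n) := fun i hi => by
    rw [Finset.mem_range] at hi
    have e : (1 / (n : ℝ)) • f (((i + 1 : ℕ) : ℝ) / n) =
        ∫ v in (i : ℝ) / n..((i + 1 : ℕ) : ℝ) / n, f (((i + 1 : ℕ) : ℝ) / n) := by
      rw [intervalIntegral.integral_const, hlen]
    rw [e, ← intervalIntegral.integral_sub intervalIntegrable_const (hint i hi)]
    refine (intervalIntegral.norm_integral_le_of_norm_le_const (C := ε / 2) fun v hv => ?_).trans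
      (le_of_eq ?_)
    · rw [Set.uIoc_of_le (hle i)] at hv
      have hv' := Set.Ioc_subset_Icc_self hv
      rw [← dist_eq_norm]
      refine (hfδ _ (hsub i hi ⟨hle i, le_rfl⟩) v (hsub i hi hv') ?_).le
      rw [Real.dist_eq, abs_of_nonneg (by linarith [hv.2])]
      linarith [hlen i, hv.1]
    · rw [hlen, abs_of_pos (by positivity)]
  refine ((norm_sum_le _ _).trans (Finset.sum_le_sum hterm)).trans_lt ?_
  rw [Finset.sum_const, Finset.card_range, nsmul_eq_mul]
  have : (n : ℝ) * (ε / 2 * (1 / n)) = ε / 2 := by field_simp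
  rw [this]
  exact half_lt_self hε

/-! ### Consistency -/

/-- Bars denote means over blocks: `P - m = (H - H̄) - (H - P) + (H̄ - P̄) + (P̄ - m)`. The third
term is bounded by the average of the second, hence the factor `2`. -/
lemma average_norm_sub_le {B : ℕ} (hB : 0 < B) (P H : ℕ → ℂ) (m : ℂ) :
    1 / (B : ℝ) * ∑ b ∈ Finset.Icc 1 B, ‖P b - m‖ ≤
      1 / (B : ℝ) * ∑ b ∈ Finset.Icc 1 B, ‖H b - 1 / (B : ℂ) * ∑ l ∈ Finset.Icc 1 B, H l‖ +
      2 * (1 / (B : ℝ) * ∑ b ∈ Finset.Icc 1 B, ‖H b - P b‖) +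
      ‖(1 / (B : ℝ)) • ∑ l ∈ Finset.Icc 1 B, P l - m‖ := by
  have hB' : (0 : ℝ) < B := by exact_mod_cast hB
  set d := 1 / (B : ℝ) * ∑ b ∈ Finset.Icc 1 B, ‖H b - P b‖ with hd
  have hmean : ‖1 / (B : ℂ) * ∑ l ∈ Finset.Icc 1 B, H l -
      (1 / (B : ℝ)) • ∑ l ∈ Finset.Icc 1 B, P l‖ ≤ d := by
    have e : 1 / (B : ℂ) * ∑ l ∈ Finset.Icc 1 B, H l - (1 / (B : ℝ)) • ∑ l ∈ Finset.Icc 1 B, P l =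
        (1 / (B : ℝ)) • ∑ l ∈ Finset.Icc 1 B, (H l - P l) := by
      rw [Finset.sum_sub_distrib, smul_sub, Complex.real_smul, Complex.real_smul]
      push_cast
      rfl
    rw [e, norm_smul, Real.norm_of_nonneg (by positivity)]
    exact mul_le_mul_of_nonneg_left (norm_sum_le _ _) (by positivity)
  have hpt : ∀ b ∈ Finset.Icc 1 B, ‖P b - m‖ ≤
      ‖H b - 1 / (B : ℂ) * ∑ l ∈ Finset.Icc 1 B, H l‖ + ‖H b - P b‖ +
        (d + ‖(1 / (B : ℝ)) • ∑ l ∈ Finset.Icc 1 B, P l - m‖) := fun b _ => by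
    have e : P b - m = (H b - 1 / (B : ℂ) * ∑ l ∈ Finset.Icc 1 B, H l) - (H b - P b) +
        ((1 / (B : ℂ) * ∑ l ∈ Finset.Icc 1 B, H l - (1 / (B : ℝ)) • ∑ l ∈ Finset.Icc 1 B, P l) +
          ((1 / (B : ℝ)) • ∑ l ∈ Finset.Icc 1 B, P l - m)) := by ring
    rw [e]
    refine (norm_add_le _ _).trans (add_le_add (norm_sub_le _ _)
      ((norm_add_le _ _).trans (add_le_add hmean le_rfl)))
  have h1 := mul_le_mul_of_nonneg_left (Finset.sum_le_sum hpt)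
    (show 0 ≤ 1 / (B : ℝ) by positivity)
  refine h1.trans (le_of_eq ?_)
  rw [Finset.sum_add_distrib, Finset.sum_add_distrib, mul_add, mul_add, ← hd]
  simp only [Finset.sum_const, Nat.card_Icc, Nat.add_sub_cancel, nsmul_eq_mul]
  field_simp
  ring

lemma sq_average_le {B : ℕ} (hB : 0 < B) (f : ℕ → ℝ) :
    (1 / (B : ℝ) * ∑ b ∈ Finset.Icc 1 B, f b) ^ 2 ≤
      (∑ b ∈ Finset.Icc 1 B, f b ^ 2) / (B : ℝ) := by
  have hB' : (0 : ℝ) < B := by exact_mod_cast hB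
  have h := sq_sum_le_card_mul_sum_sq (s := Finset.Icc 1 B) (f := f)
  rw [Nat.card_Icc, Nat.add_sub_cancel] at h
  rw [mul_pow, one_div, inv_pow, inv_mul_le_iff₀ (by positivity)]
  refine h.trans (le_of_eq ?_)
  field_simp

lemma tendsto_one_of_eventually_one_le {f : ℕ → ENNReal} (hf : ∀ n, f n ≤ 1)
    (h : ∀ ε : ℝ, 0 < ε → ∀ᶠ n in atTop, 1 ≤ f n + ENNReal.ofReal ε) :
    Tendsto f atTop (𝓝 1) := by
  refine tendsto_order.2 ⟨fun a ha => ?_, fun a ha => Eventually.of_forall fun n =>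
    (hf n).trans_lt ha⟩
  have hr : a.toReal < 1 := by
    rw [← ENNReal.toReal_one]
    exact (ENNReal.toReal_lt_toReal ha.ne_top ENNReal.one_ne_top).2 ha
  filter_upwards [h ((1 - a.toReal) / 2) (by linarith)] with n hn
  by_contra! hcon
  have h1 : f n + ENNReal.ofReal ((1 - a.toReal) / 2) ≤
      ENNReal.ofReal (a.toReal + (1 - a.toReal) / 2) := by
    rw [ENNReal.ofReal_add ENNReal.toReal_nonneg (by linarith), ENNReal.ofReal_toReal ha.ne_top]
    gcongr
  have h2 := hn.trans h1
  rw [ENNReal.one_le_ofReal] at h2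
  linarith

/-- Off the exceptional sets the statistic divided by `B` stays above the fixed constant `(L/2)²`,
so the factor `K` passes every `M`. The sets themselves do not depend on `M`. -/
lemma CumulantMixing.exists_eventually_lt_statistic [IsProbabilityMeasure μ]
    (hX : CumulantMixing μ X S κ) {T B K : ℕ → ℕ} (hs : AsymptoticScheme T B K) {ω₁ ω₂ : ℝ}
    (halt : 0 < volume {q : ℝ × ℝ | q.1 ∈ Set.Icc (0 : ℝ) 1 ∧ q.2 ∈ Set.Icc ω₁ ω₂ ∧
      0 < volume {p : unitInterval × unitInterval | demeanedSpectrum μ S q.1 q.2 p ≠ 0}}) :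
    ∃ E : ℕ → Set Ω, Tendsto (fun n => μ (E n)) atTop (𝓝 0) ∧ ∀ M : ℝ, ∀ᶠ n in atTop,
      ∀ x ∉ E n, M < (K n : ℝ) * stationarityStatistic X (T n) (B n) (K n) ω₁ ω₂ x / (B n : ℝ) := by
  obtain ⟨α, β, A, A', h1, h2, h3, h4, hA, hA', u, hu, hne⟩ := hX.exists_popStat_ne halt
  set c := bumpCoeff α β with hc
  have hcs : Summable fun h => ‖c h‖ := summable_bumpCoeff α β
  set F := popStat μ S c A A' with hF
  have hFc : ContinuousOn F (Set.Icc 0 1) :=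
    hX.continuousOn_popStat hA hA' fun h => hcs.le_tsum h fun _ _ => norm_nonneg _
  set m := ∫ v in (0 : ℝ)..1, F v with hm
  have hFm : ContinuousOn (fun v => ‖F v - m‖) (Set.Icc 0 1) := (hFc.sub continuousOn_const).norm
  set L := ∫ v in (0 : ℝ)..1, ‖F v - m‖ with hL
  -- A continuous nonnegative function that is positive at the single point `u` has a positive
  -- integral.
  have hL0 : 0 < L := intervalIntegral.integral_pos zero_lt_one hFm (fun _ _ => norm_nonneg _)
    ⟨u, hu, norm_pos_iff.2 (sub_ne_zero.2 hne)⟩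
  refine ⟨fun n => {x | L / 8 ≤ 1 / (B n : ℝ) * ∑ b ∈ Finset.Icc 1 (B n),
    ‖blockStat X c A A' (T n) (B n) (K n) b x - F (b / B n)‖},
    hX.tendsto_measure_average hs hA hA' hcs (by positivity), fun M => ?_⟩
  have hR1 := (tendsto_riemann_sum hFm).comp hs.tendsto_B
  have hR2 := tendsto_iff_norm_sub_tendsto_zero.1 ((tendsto_riemann_sum hFc).comp hs.tendsto_B)
  have hKM : Tendsto (fun n => (K n : ℝ) * (L / 2) ^ 2) atTop atTop :=
    (tendsto_natCast_atTop_atTop.comp hs.tendsto_K).atTop_mul_const (by positivity)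
  filter_upwards [hR1.eventually (lt_mem_nhds (show 7 * L / 8 < L by linarith)),
    hR2.eventually (gt_mem_nhds (show 0 < L / 8 by positivity)), hKM.eventually_gt_atTop M,
    hs.tendsto_B.eventually_gt_atTop 0] with n e1 e2 e3 hB x hx
  replace hx := not_le.1 hx
  simp only [Function.comp_apply, smul_eq_mul] at e1 e2
  have key := average_norm_sub_le hB (fun b => F ((b : ℝ) / B n))
    (fun b => blockStat X c A A' (T n) (B n) (K n) b x) m
  -- The budget is `7L/8 - 2 · L/8 - L/8 = L/2`: Riemann sum, estimation error counted twice, and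
  -- error of the population mean.
  have hlow : L / 2 ≤ 1 / (B n : ℝ) * ∑ b ∈ Finset.Icc 1 (B n),
      ‖blockStat X c A A' (T n) (B n) (K n) b x - 1 / (B n : ℂ) *
        ∑ l ∈ Finset.Icc 1 (B n), blockStat X c A A' (T n) (B n) (K n) l x‖ := by
    linarith
  have hB' : (0 : ℝ) < B n := by exact_mod_cast hB
  have hQ := sum_sq_norm_blockStat_le (X := X) hA hA' (continuous_bump α β) h1 h2.le h3 h4
    (fun ω hω => abs_bump_le_one hω h4) (T n) (B n) (K n) x (c := c) (fun h => rfl)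
  have hsq := (pow_le_pow_left₀ (by positivity) hlow 2).trans (sq_average_le hB _)
  refine e3.trans_le ?_
  rw [mul_div_assoc]
  gcongr
  refine hsq.trans ?_
  gcongr

/-- The whole space is covered by the rejection event, the event that `c` exceeds `M`, and the
exceptional set. Subadditivity suffices, so no measurability of the rejection event is needed. -/
lemma CumulantMixing.tendsto_measure_lt_statistic [IsProbabilityMeasure μ]
    (hX : CumulantMixing μ X S κ) {T B K : ℕ → ℕ} (hs : AsymptoticScheme T B K) {ω₁ ω₂ : ℝ}
    (halt : 0 < volume {q : ℝ × ℝ | q.1 ∈ Set.Icc (0 : ℝ) 1 ∧ q.2 ∈ Set.Icc ω₁ ω₂ ∧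
      0 < volume {p : unitInterval × unitInterval | demeanedSpectrum μ S q.1 q.2 p ≠ 0}})
    (c : ℕ → Ω → ℝ)
    (hc : ∀ ε : ENNReal, 0 < ε → ∃ M : ℝ, ∀ᶠ n in atTop, μ {x | M < c n x} ≤ ε) :
    Tendsto (fun n => μ {x | c n x < (K n : ℝ) *
      stationarityStatistic X (T n) (B n) (K n) ω₁ ω₂ x / (B n : ℝ)}) atTop (𝓝 1) := by
  obtain ⟨E, hE, hlt⟩ := hX.exists_eventually_lt_statistic hs halt
  refine tendsto_one_of_eventually_one_le (fun n => prob_le_one) fun ε hε => ?_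
  have hε2 : 0 < ENNReal.ofReal (ε / 2) := by simpa using hε
  obtain ⟨M, hM⟩ := hc _ hε2
  filter_upwards [hM, hlt M, hE.eventually (ge_mem_nhds hε2)] with n h1 h2 h3
  set R := {x | c n x < (K n : ℝ) *
      stationarityStatistic X (T n) (B n) (K n) ω₁ ω₂ x / (B n : ℝ)} with hR
  have hcover : (Set.univ : Set Ω) ⊆ R ∪ ({x | M < c n x} ∪ E n) := fun x _ => by
    by_cases hx : x ∈ E n
    · exact Or.inr (Or.inr hx)
    by_cases hx2 : M < c n x
    · exact Or.inr (Or.inl hx2)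
    · exact Or.inl ((not_lt.1 hx2).trans_lt (h2 x hx))
  calc (1 : ENNReal) = μ Set.univ := measure_univ.symm
    _ ≤ μ R + (μ {x | M < c n x} + μ (E n)) :=
      (measure_mono hcover).trans ((measure_union_le _ _).trans
        (add_le_add le_rfl (measure_union_le _ _)))
    _ ≤ μ R + (ENNReal.ofReal (ε / 2) + ENNReal.ofReal (ε / 2)) := by gcongr
    _ = μ R + ENNReal.ofReal ε := by
      rw [← ENNReal.ofReal_add (by positivity) (by positivity), add_halves]

end FunctionalTimeSeries

end

theorem mainTheorem6 {Ω : Type*} [MeasurableSpace Ω] (μ : Measure Ω) [IsProbabilityMeasure μ]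
    (X : ℕ → ℤ → FunctionalTimeSeries.RandomL2 Ω)
    (S : ℝ → ℤ → FunctionalTimeSeries.RandomL2 Ω)
    (κ : (m : ℕ) → (Fin m → ℤ) → Lp ℝ 2 (volume : Measure (Fin (m + 1) → unitInterval)))
    (hX : FunctionalTimeSeries.CumulantMixing μ X S κ)
    (T B K : ℕ → ℕ) (hscheme : FunctionalTimeSeries.AsymptoticScheme T B K)
    (ω₁ ω₂ : ℝ) (h₁ : 0 ≤ ω₁) (h₁₂ : ω₁ < ω₂) (h₂ : ω₂ ≤ 1 / 2)
    (halt : 0 < volume {q : ℝ × ℝ | q.1 ∈ Set.Icc (0 : ℝ) 1 ∧ q.2 ∈ Set.Icc ω₁ ω₂ ∧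
      0 < volume {p : unitInterval × unitInterval |
        FunctionalTimeSeries.demeanedSpectrum μ S q.1 q.2 p ≠ 0}}) :
    (∀ M : ℝ, Tendsto (fun n => μ {x | M < (K n : ℝ) *
        FunctionalTimeSeries.stationarityStatistic X (T n) (B n) (K n) ω₁ ω₂ x / (B n : ℝ)})
      atTop (𝓝 1)) ∧
    (∀ c : ℕ → Ω → ℝ, (∀ n, Measurable (c n)) →
      (∀ ε : ENNReal, 0 < ε → ∃ M : ℝ, ∀ᶠ n in atTop, μ {x | M < c n x} ≤ ε) →
      Tendsto (fun n => μ {x | c n x < (K n : ℝ) *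
        FunctionalTimeSeries.stationarityStatistic X (T n) (B n) (K n) ω₁ ω₂ x / (B n : ℝ)})
      atTop (𝓝 1)) := by
  -- Divergence in probability is the case of the constant critical value `M`, which is its own
  -- bound because `{M < M}` is empty.
  refine ⟨fun M => hX.tendsto_measure_lt_statistic hscheme halt (fun _ _ => M) fun ε _ => ⟨M, ?_⟩,
    fun c _ hc => hX.tendsto_measure_lt_statistic hscheme halt c hc⟩
  simp
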